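/- Let $\mu_{\max},\epsilon_{\max},\delta_{\min},\delta_{\max}>0$ and let $\mathcal P$ be the set of $\mathfrak p=(\mu,\epsilon,\delta,\gamma)$ with $0\le\mu\le\mu_{\max}$, $0\le\epsilon\le\epsilon_{\max}$, $\delta_{\min}<\delta<\delta_{\max}$, $0\le\gamma<1$. Let $0<T\le\infty$, and let $\|u\|_{L^\infty([0,T);H^\sigma)}=\sup_{0\le t<T}|u(t,\cdot)|_{H^\sigma(\mathbb R)}$ and $\|u\|_{W^1([0,T);H^{\sigma})}=\|u\|_{L^\infty([0,T);H^{\sigma})}+\|\partial_tu\|_{L^\infty([0,T);H^{\sigma-1})}$. **Weakly coupled system.** Consider $$\partial_t u_l+\partial_x u_l+f_l(u_l,u_r)=0,\qquad \partial_t u_r-\partial_x u_r+f_r(u_l,u_r)=0,\tag{1}$$ where, with $\alpha_1=\frac32\frac{\delta^2-\gamma}{\gamma+\delta}$, $\alpha_2=-3\frac{\gamma\delta(\delta+1)^2}{(\gamma+\delta)^2}$, $\alpha_3=-5\frac{\delta^2(\delta+1)^2\gamma(1-\gamma)}{(\gamma+\delta)^3}$, $\nu=\frac16\frac{1+\gamma\delta}{\delta(\delta+\gamma)}$,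 $\kappa_1=\frac{(1+\gamma\delta)(\delta^2-\gamma)}{3\delta(\gamma+\delta)^2}$, $\kappa_2=\frac{1-\gamma}{3(\gamma+\delta)}$, $\kappa_3=\frac{\gamma-1}{2(\gamma+\delta)}$ and $B(a,b)=\kappa_1(a\partial_x^2a-b\partial_x^2b)+\kappa_2(b\partial_x^2a-a\partial_x^2b)+(\kappa_1+\frac{\kappa_2}2)\big((\partial_xa)^2-(\partial_xb)^2\big)$, $$\begin{aligned}f_l=\ &\tfrac{\epsilon\alpha_1}{2}\partial_x\big((u_l+\tfrac13u_r)(u_l-u_r)\big)+\tfrac{\epsilon^2\alpha_2}3\partial_x\big((u_l-u_r)u_l(u_l+u_r)\big)+\tfrac{\epsilon^3\alpha_3}4\partial_x\big((u_l-\tfrac15u_r)(u_l-u_r)(u_l+u_r)^2\big)\\&-\mu\nu\partial_x^2\partial_t(u_l-u_r)+\mu\epsilon\kappa_3\partial_x\big(\tfrac13(u_l-u_r)\partial_x^2(u_l-u_r)+\tfrac12(\partial_xu_l-\partial_xu_r)^2\big)-\mu\epsilon\,\partial_tB(u_l,u_r),\\ f_r=\ &-\tfrac{\epsilon\alpha_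1}{2}\partial_x\big((\tfrac13u_l+u_r)(u_r-u_l)\big)-\tfrac{\epsilon^2\alpha_2}3\partial_x\big((u_r-u_l)u_r(u_l+u_r)\big)-\tfrac{\epsilon^3\alpha_3}4\partial_x\big((u_r-\tfrac15u_l)(u_r-u_l)(u_l+u_r)^2\big)\\&-\mu\nu\partial_x^2\partial_t(u_r-u_l)-\mu\epsilon\kappa_3\partial_x\big(\tfrac13(u_r-u_l)\partial_x^2(u_r-u_l)+\tfrac12(\partial_xu_r-\partial_xu_l)^2\big)-\mu\epsilon\,\partial_tB(u_r,u_l).\end{aligned}$$ **Green–Naghdi system.** With $h_1=1-\epsilon\zeta$, $h_2=\frac1\delta+\epsilon\zeta$, $L=\partial_x\big(h_2^3\partial_x\frac{h_1v}{h_1+\gamma h_2}\big)$, $U=\partial_x\big(h_1^3\partial_x\frac{h_2v}{h_1+\gamma h_2}\big)$, $\mathcal Q v=-\frac1{3h_1h_2}(h_1L+\gamma h_2U)$ and $\mathcal R v=\frac12\big((h_2\partial_x\frac{h_1v}{h_1+\gamma h_2})^2-\gamma(h_1\partial_x\frac{h_2v}{h_1+\gamma h_2})^2\big)+\frac13\frac{v}{h_1+\gamma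 h_2}\big(\frac{h_1}{h_2}L-\gamma\frac{h_2}{h_1}U\big)$, put $$\begin{aligned}GN_1(\zeta,v)&=\partial_t\zeta+\partial_x\Big(\tfrac{h_1h_2}{h_1+\gamma h_2}v\Big),\\ GN_2(\zeta,v)&=\partial_t(v+\mu\mathcal Qv)+(\gamma+\delta)\partial_x\zeta+\tfrac\epsilon2\partial_x\Big(\tfrac{h_1^2-\gamma h_2^2}{(h_1+\gamma h_2)^2}v^2\Big)-\mu\epsilon\,\partial_x(\mathcal Rv).\end{aligned}$$ **Statement.** Let $s>1/2$, $h,M>0$, and for each $\mathfrak p=(\mu,\epsilon,\delta,\gamma)$ in a subset $S\subseteq\mathcal P$ let $(u_l^{\mathfrak p},u_r^{\mathfrak p})$ be a strong (pointwise) solution of (1) on $[0,T)\times\mathbb R$ such that, for all $\mathfrak p\in S$, $$\|u_l^{\mathfrak p}\|_{W^1([0,T);H^{s+3})}+\|u_r^{\mathfrak p}\|_{W^1([0,T);H^{s+3})}\le M,\qquad 1-\epsilon(u_l^{\mathfrak p}+u_r^{\mathfrak p})\ge h,\qquad \tfrac1\delta+\epsilon(u_l^{\mathfrak p}+u_r^{\mathfrak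 p})\ge h .$$ Put $\zeta^{\mathfrak p}=u_l^{\mathfrak p}+u_r^{\mathfrak p}$ and $v^{\mathfrak p}=(\gamma+\delta)(u_l^{\mathfrak p}-u_r^{\mathfrak p})$. Then $(\zeta^{\mathfrak p},v^{\mathfrak p})$ is consistent with the Green–Naghdi system, of order $s$ on $[0,T)$, at precision $O(\mu\epsilon^2+\epsilon^4)$. That is, the family is uniformly bounded in $L^\infty([0,T);H^{s+3})$, and: 1. for every $\mathfrak p\in S$ there are $r_1,r_2$ with $GN_i(\zeta^{\mathfrak p},v^{\mathfrak p})=(\mu\epsilon^2+\epsilon^4)\,r_i$ $(i=1,2)$ on $[0,T)\times\mathbb R$ and $\|r_1\|_{L^\infty([0,T);H^s)}+\|r_2\|_{L^\infty([0,T);H^s)}\le C$, where $C$ depends only on $s,\mu_{\max},\epsilon_{\max},\delta_{\min},\delta_{\max},h,M$; 2. when $\mu\epsilon^2+\epsilon^4\le\rho$, where $\rho>0$ depends only on $s,\mu_{\max},\epsilon_{\max},\delta_{\min},\delta_{\max},h,M$, the bound of 1 holds with $C$ replaced by $C'\big(\|\zeta^{\mathfrak p}\|_{L^\infty([0,T);H^{s+3})},\|v^{\mathfrak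 p}\|_{L^\infty([0,T);H^{s+3})}\big)$, where the function $C'$, nondecreasing in both arguments, depends only on $s,\mu_{\max},\epsilon_{\max},\delta_{\min},\delta_{\max}$. -/

import Mathlib

open MeasureTheory
open scoped ENNReal

noncomputable section

/-! ### Parameters -/

/-- The dimensionless parameters: shallowness `μ`, nonlinearity `ε`, depth ratio `δ`,
density ratio `γ`. -/
structure Param where
  μ : ℝ
  ε : ℝ
  δ : ℝ
  γ : ℝ

/-- The admissible parameters. -/
def paramSet (μmax εmax δmin δmax : ℝ) : Set Param :=
  {p | 0 ≤ p.μ ∧ p.μ ≤ μmax ∧ 0 ≤ p.ε ∧ p.ε ≤ εmax ∧ δmin < p.δ ∧ p.δ < δmax ∧ 0 ≤ p.γ ∧ p.γ < 1}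

/-- The precision `μ ε² + ε⁴`. -/
def serrePrecision (p : Param) : ℝ := p.μ * p.ε ^ 2 + p.ε ^ 4

/-! ### Sobolev spaces

Functions of time and space are maps `u : ℝ → ℝ → ℝ`, `u t x`. Only spaces `H^σ(ℝ)` with
`σ > 1/2` occur, and their elements are identified with their continuous representatives. -/

/-- The norm `|f|_{H^σ} = ‖(1 - ∂ₓ²)^{σ/2} f‖_{L²} = ‖(1 + (2πξ)²)^{σ/2} 𝓕f(ξ)‖_{L²}`, for `σ ≥ 0`,
where `𝓕` is the Fourier transform on `L²` with kernel `exp(-2πixξ)`; it is `∞` when `f` does not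
belong to `H^σ` (an infimum over the empty set is `∞`). -/
def sobolevENorm (σ : ℝ) (f : ℝ → ℝ) : ℝ≥0∞ :=
  ⨅ hf : MemLp (fun x => (f x : ℂ)) 2 (volume : Measure ℝ),
    eLpNorm (fun ξ : ℝ => (((1 + (2 * Real.pi * ξ) ^ 2) ^ (σ / 2) : ℝ) : ℂ) *
      (Lp.fourierTransformₗᵢ ℝ ℂ (hf.toLp fun x => (f x : ℂ)) : ℝ → ℂ) ξ) 2 (volume : Measure ℝ)

/-- The time interval `[0, T)`, where `T = ⊤` is allowed. -/
def timeInterval (T : EReal) : Set ℝ := {t | 0 ≤ t ∧ (t : EReal) < T}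

/-- The norm of `L^∞([0,T); H^σ)`: the supremum over all times of the `H^σ` norm. -/
def linftyENorm (T : EReal) (σ : ℝ) (u : ℝ → ℝ → ℝ) : ℝ≥0∞ :=
  ⨆ t ∈ timeInterval T, sobolevENorm σ (u t)

/-- `u ∈ L^∞([0,T); H^σ)`. -/
def MemLinfty (T : EReal) (σ : ℝ) (u : ℝ → ℝ → ℝ) : Prop :=
  (∀ t ∈ timeInterval T, Continuous (u t)) ∧ linftyENorm T σ u < ⊤

/-- The time derivative `∂ₜ u` on `[0,T)`, one-sided at `t = 0`. -/
def dt (T : EReal) (u : ℝ → ℝ → ℝ) : ℝ → ℝ → ℝ :=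
  fun t x => derivWithin (fun τ => u τ x) (timeInterval T) t

/-- `u ∈ W¹([0,T); H^σ)`: `u ∈ L^∞([0,T); H^σ)` and `∂ₜ u ∈ L^∞([0,T); H^{σ-1})`. -/
def MemW1 (T : EReal) (σ : ℝ) (u : ℝ → ℝ → ℝ) : Prop :=
  MemLinfty T σ u ∧
  (∀ t ∈ timeInterval T, ∀ x, DifferentiableWithinAt ℝ (fun τ => u τ x) (timeInterval T) t) ∧
  MemLinfty T (σ - 1) (dt T u)

/-- The norm of `W¹([0,T); H^σ)`. -/
def w1ENorm (T : EReal) (σ : ℝ) (u : ℝ → ℝ → ℝ) : ℝ≥0∞ :=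
  linftyENorm T σ u + linftyENorm T (σ - 1) (dt T u)

/-! ### The Green–Naghdi system -/

/-- Depth of the upper layer, `h₁ = 1 - ε ζ`. -/
def depth₁ (p : Param) (ζ : ℝ → ℝ) : ℝ → ℝ := fun x => 1 - p.ε * ζ x

/-- Depth of the lower layer, `h₂ = 1/δ + ε ζ`. -/
def depth₂ (p : Param) (ζ : ℝ → ℝ) : ℝ → ℝ := fun x => 1 / p.δ + p.ε * ζ x

/-- `∂ₓ (h₂³ ∂ₓ (h₁ V / (h₁ + γ h₂)))`. -/
def lowerTerm (γ : ℝ) (h₁ h₂ V : ℝ → ℝ) : ℝ → ℝ :=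
  deriv fun y => h₂ y ^ 3 * deriv (fun z => h₁ z * V z / (h₁ z + γ * h₂ z)) y

/-- `∂ₓ (h₁³ ∂ₓ (h₂ V / (h₁ + γ h₂)))`. -/
def upperTerm (γ : ℝ) (h₁ h₂ V : ℝ → ℝ) : ℝ → ℝ :=
  deriv fun y => h₁ y ^ 3 * deriv (fun z => h₂ z * V z / (h₁ z + γ * h₂ z)) y

/-- The operator `𝒬̄[h₁,h₂] V`. -/
def opQ (γ : ℝ) (h₁ h₂ V : ℝ → ℝ) : ℝ → ℝ := fun x =>
  -1 / (3 * h₁ x * h₂ x) *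
    (h₁ x * lowerTerm γ h₁ h₂ V x + γ * h₂ x * upperTerm γ h₁ h₂ V x)

/-- The operator `ℛ̄[h₁,h₂] V`. -/
def opR (γ : ℝ) (h₁ h₂ V : ℝ → ℝ) : ℝ → ℝ := fun x =>
  1 / 2 * ((h₂ x * deriv (fun z => h₁ z * V z / (h₁ z + γ * h₂ z)) x) ^ 2
      - γ * (h₁ x * deriv (fun z => h₂ z * V z / (h₁ z + γ * h₂ z)) x) ^ 2)
    + 1 / 3 * (V x / (h₁ x + γ * h₂ x)) *
      (h₁ x / h₂ x * lowerTerm γ h₁ h₂ V x - γ * (h₂ x / h₁ x) * upperTerm γ h₁ h₂ V x)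

/-- The flux `h₁ h₂ / (h₁ + γ h₂) v` of the mass equation. -/
def massFlux (p : Param) (ζ v : ℝ → ℝ) : ℝ → ℝ := fun x =>
  depth₁ p ζ x * depth₂ p ζ x / (depth₁ p ζ x + p.γ * depth₂ p ζ x) * v x

/-- `(h₁² - γ h₂²) / (h₁ + γ h₂)² |v|²`. -/
def velocityFlux (p : Param) (ζ v : ℝ → ℝ) : ℝ → ℝ := fun x =>
  (depth₁ p ζ x ^ 2 - p.γ * depth₂ p ζ x ^ 2) / (depth₁ p ζ x + p.γ * depth₂ p ζ x) ^ 2 * v x ^ 2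

/-- `v + μ 𝒬̄[h₁,h₂] v` as a function of time and space. -/
def momentum (p : Param) (ζ v : ℝ → ℝ → ℝ) : ℝ → ℝ → ℝ := fun t x =>
  v t x + p.μ * opQ p.γ (depth₁ p (ζ t)) (depth₂ p (ζ t)) (v t) x

/-- `ℛ̄[h₁,h₂] v`. -/
def quadraticTerm (p : Param) (ζ v : ℝ → ℝ) : ℝ → ℝ :=
  opR p.γ (depth₁ p ζ) (depth₂ p ζ) v

/-- `(ζ, v)` satisfies the Green–Naghdi system on `[0,T)` with right-hand sides `R₁, R₂`; all the
derivatives exist in the classical sense. -/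
def SolvesGN (p : Param) (T : EReal) (ζ v R₁ R₂ : ℝ → ℝ → ℝ) : Prop :=
  ∀ t ∈ timeInterval T, ∀ x : ℝ,
    DifferentiableWithinAt ℝ (fun τ => ζ τ x) (timeInterval T) t ∧
    DifferentiableWithinAt ℝ (fun τ => momentum p ζ v τ x) (timeInterval T) t ∧
    DifferentiableAt ℝ (ζ t) x ∧
    DifferentiableAt ℝ (massFlux p (ζ t) (v t)) x ∧
    DifferentiableAt ℝ (velocityFlux p (ζ t) (v t)) x ∧
    DifferentiableAt ℝ (quadraticTerm p (ζ t) (v t)) x ∧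
    dt T ζ t x + deriv (massFlux p (ζ t) (v t)) x = R₁ t x ∧
    dt T (momentum p ζ v) t x + (p.γ + p.δ) * deriv (ζ t) x
        + p.ε / 2 * deriv (velocityFlux p (ζ t) (v t)) x
        - p.μ * p.ε * deriv (quadraticTerm p (ζ t) (v t)) x = R₂ t x

/-- Consistency of a family `(ζ^p, v^p)`, `p ∈ S`, with the Green–Naghdi system, of order `s` on
`[0,T)`, at precision `O(prec p)`: the family is uniformly bounded in `L^∞([0,T); H^{s+s'})` and
satisfies the system up to `prec p • (r₁, r₂)`, where
`‖(r₁,r₂)‖_{L^∞([0,T); H^s)} ≤ C(‖ζ^p‖_{L^∞([0,T); H^{s+s'})}, ‖v^p‖_{L^∞([0,T); H^{s+s'})})`. -/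
def ConsistentGN (S : Set Param) (T : EReal) (s s' : ℝ) (prec : Param → ℝ)
    (ζ v : Param → ℝ → ℝ → ℝ) (C : ℝ → ℝ → ℝ) : Prop :=
  (∃ K : ℝ, ∀ p ∈ S,
    MemLinfty T (s + s') (ζ p) ∧ MemLinfty T (s + s') (v p) ∧
    linftyENorm T (s + s') (ζ p) + linftyENorm T (s + s') (v p) ≤ ENNReal.ofReal K) ∧
  ∀ p ∈ S, ∃ r₁ r₂ : ℝ → ℝ → ℝ,
    SolvesGN p T (ζ p) (v p) (fun t x => prec p * r₁ t x) (fun t x => prec p * r₂ t x) ∧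
    MemLinfty T s r₁ ∧ MemLinfty T s r₂ ∧
    linftyENorm T s r₁ + linftyENorm T s r₂ ≤
      ENNReal.ofReal (C (linftyENorm T (s + s') (ζ p)).toReal (linftyENorm T (s + s') (v p)).toReal)

/-! ### The weakly coupled system -/

namespace Param

def α₁ (p : Param) : ℝ := 3 / 2 * ((p.δ ^ 2 - p.γ) / (p.γ + p.δ))

def α₂ (p : Param) : ℝ := -3 * (p.γ * p.δ * (p.δ + 1) ^ 2 / (p.γ + p.δ) ^ 2)

def α₃ (p : Param) : ℝ :=
  -5 * (p.δ ^ 2 * (p.δ + 1) ^ 2 * p.γ * (1 - p.γ) / (p.γ + p.δ) ^ 3)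

def ν (p : Param) : ℝ := 1 / 6 * ((1 + p.γ * p.δ) / (p.δ * (p.δ + p.γ)))

def κ₁ (p : Param) : ℝ :=
  (1 + p.γ * p.δ) * (p.δ ^ 2 - p.γ) / (3 * p.δ * (p.γ + p.δ) ^ 2)

def κ₂ (p : Param) : ℝ := (1 - p.γ) / (3 * (p.γ + p.δ))

def κ₃ (p : Param) : ℝ := (p.γ - 1) / (2 * (p.γ + p.δ))

end Param

/-- `κ₁ (a ∂ₓ²a - b ∂ₓ²b) + κ₂ (b ∂ₓ²a - a ∂ₓ²b) + (κ₁ + κ₂/2) ((∂ₓa)² - (∂ₓb)²)`. -/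
def serreBracket (p : Param) (a b : ℝ → ℝ → ℝ) : ℝ → ℝ → ℝ := fun t x =>
  p.κ₁ * (a t x * iteratedDeriv 2 (a t) x - b t x * iteratedDeriv 2 (b t) x)
    + p.κ₂ * (b t x * iteratedDeriv 2 (a t) x - a t x * iteratedDeriv 2 (b t) x)
    + (p.κ₁ + p.κ₂ / 2) * (deriv (a t) x ^ 2 - deriv (b t) x ^ 2)

/-- The nonlinear term `f_l^{ε,μ}(u_l,u_r)`. -/
def serreL (p : Param) (T : EReal) (ul ur : ℝ → ℝ → ℝ) : ℝ → ℝ → ℝ := fun t x =>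
  p.ε * (p.α₁ / 2) * deriv (fun y => (ul t y + 1 / 3 * ur t y) * (ul t y - ur t y)) x
  + p.ε ^ 2 * (p.α₂ / 3) *
      deriv (fun y => (ul t y - ur t y) * ul t y * (ul t y + ur t y)) x
  + p.ε ^ 3 * (p.α₃ / 4) *
      deriv (fun y => (ul t y - 1 / 5 * ur t y) * (ul t y - ur t y) * (ul t y + ur t y) ^ 2) x
  - p.μ * p.ν * iteratedDeriv 2 (dt T (fun τ y => ul τ y - ur τ y) t) x
  + p.μ * p.ε * p.κ₃ *
      deriv (fun y => 1 / 3 * (ul t y - ur t y) *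
          (iteratedDeriv 2 (ul t) y - iteratedDeriv 2 (ur t) y)
        + 1 / 2 * (deriv (ul t) y - deriv (ur t) y) ^ 2) x
  - p.μ * p.ε * dt T (serreBracket p ul ur) t x

/-- The nonlinear term `f_r^{ε,μ}(u_l,u_r)`. -/
def serreR (p : Param) (T : EReal) (ul ur : ℝ → ℝ → ℝ) : ℝ → ℝ → ℝ := fun t x =>
  - (p.ε * (p.α₁ / 2) * deriv (fun y => (1 / 3 * ul t y + ur t y) * (ur t y - ul t y)) x)
  - p.ε ^ 2 * (p.α₂ / 3) *
      deriv (fun y => (ur t y - ul t y) * ur t y * (ul t y + ur t y)) x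
  - p.ε ^ 3 * (p.α₃ / 4) *
      deriv (fun y => (ur t y - 1 / 5 * ul t y) * (ur t y - ul t y) * (ul t y + ur t y) ^ 2) x
  - p.μ * p.ν * iteratedDeriv 2 (dt T (fun τ y => ur τ y - ul τ y) t) x
  - p.μ * p.ε * p.κ₃ *
      deriv (fun y => 1 / 3 * (ur t y - ul t y) *
          (iteratedDeriv 2 (ur t) y - iteratedDeriv 2 (ul t) y)
        + 1 / 2 * (deriv (ur t) y - deriv (ul t) y) ^ 2) x
  - p.μ * p.ε * dt T (serreBracket p ur ul) t x

/-- `(u_l, u_r)` satisfies pointwise on `[0,T) × ℝ` the system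
`∂ₜu_l + ∂ₓu_l + f_l(u_l,u_r) = 0`, `∂ₜu_r - ∂ₓu_r + f_r(u_l,u_r) = 0`. -/
def SolvesSerre (p : Param) (T : EReal) (ul ur : ℝ → ℝ → ℝ) : Prop :=
  ∀ t ∈ timeInterval T, ∀ x : ℝ,
    dt T ul t x + deriv (ul t) x + serreL p T ul ur t x = 0 ∧
    dt T ur t x - deriv (ur t) x + serreR p T ul ur t x = 0

/-- A family of strong solutions `(u_l^p, u_r^p)`, `p ∈ S`, of the weakly coupled system on
`[0,T)`, bounded by `M` in `W¹([0,T); H^{s+3})` uniformly in `p`, both depths being at least `h`. -/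
def SerreFamily (S : Set Param) (T : EReal) (s h M : ℝ) (ul ur : Param → ℝ → ℝ → ℝ) : Prop :=
  ∀ p ∈ S,
    MemW1 T (s + 3) (ul p) ∧ MemW1 T (s + 3) (ur p) ∧
    w1ENorm T (s + 3) (ul p) + w1ENorm T (s + 3) (ur p) ≤ ENNReal.ofReal M ∧
    SolvesSerre p T (ul p) (ur p) ∧
    ∀ t ∈ timeInterval T, ∀ x : ℝ,
      h ≤ depth₁ p (fun y => ul p t y + ur p t y) x ∧
      h ≤ depth₂ p (fun y => ul p t y + ur p t y) x

/-- The deformation `ζ^p = u_l^p + u_r^p`. -/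
def serreZeta (ul ur : Param → ℝ → ℝ → ℝ) : Param → ℝ → ℝ → ℝ :=
  fun p t x => ul p t x + ur p t x

/-- The velocity `v^p = (γ + δ) (u_l^p - u_r^p)`. -/
def serreVelocity (ul ur : Param → ℝ → ℝ → ℝ) : Param → ℝ → ℝ → ℝ :=
  fun p t x => (p.γ + p.δ) * (ul p t x - ur p t x)

end

/-!
In the variables `ζ = u_l + u_r` and `w = u_l - u_r`, with `v = (γ + δ) w`, the weakly coupled
system has polynomial fluxes. With `q = (1 - γ) δ / (γ + δ)` one has
`h₁ + γ h₂ = ((γ + δ) / δ) (1 - q ε ζ)`, so the nonpolynomial coefficients of the Green–Naghdi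
system are functions of `ζ / (1 - q ε ζ)`, and their Taylor polynomials in `ε` are exactly those of
the weakly coupled system. What remains is `ε⁴` times the remainders of the fluxes and `μ ε²` times
those of `𝒬` and `ℛ`, all of them differential polynomials in `ζ`, `w` and `ζ / (1 - q ε ζ)`; as
`H^σ` is an algebra stable under this quotient, they are bounded in `H^s`. For small `ε` the
equations bound the time derivatives by the `H^{s+3}` norms of `ζ` and `v`, which removes the
dependence on `h` and `M`.
-/

noncomputable section

open Filter Topology FourierTransform SchwartzMap LineDeriv

/-! ### The Fourier transform on `L²` -/

section FourierLp

variable {V F : Type*} [NormedAddCommGroup V] [InnerProductSpace ℝ V] [FiniteDimensional ℝ V]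
  [MeasurableSpace V] [BorelSpace V] [NormedAddCommGroup F] [InnerProductSpace ℂ F]

theorem integral_fourier_smul_lineDeriv_eq {f f' : V → F} {m : V} (hf : MemLp f 2)
    (hf' : MemLp f' 2) (hd : ∀ x, HasLineDerivAt ℝ f (f' x) x m) (φ : 𝓢(V, ℂ)) :
    ∫ x, 𝓕 φ x • f' x = -∫ x, (∂_{m} (𝓕 φ) : 𝓢(V, ℂ)) x • f x := by
  have hint : ∀ {k : V → F} (_ : MemLp k 2) (χ : 𝓢(V, ℂ)), Integrable fun x => χ x • k x :=
    fun hk χ => memLp_one_iff_integrable.1 (hk.smul (χ.memLp 2 volume))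
  have hder : ∀ x, HasLineDerivAt ℝ (𝓕 φ : 𝓢(V, ℂ)) ((∂_{m} (𝓕 φ) : 𝓢(V, ℂ)) x) x m := fun x => by
    rw [SchwartzMap.lineDerivOp_apply]
    exact ((𝓕 φ : 𝓢(V, ℂ)).differentiableAt.lineDifferentiableAt).hasLineDerivAt
  exact integral_bilinear_hasLineDerivAt_right_eq_neg_left_of_integrable
    (B := ContinuousLinearMap.lsmul ℝ ℂ) (hint hf _) (hint hf' _) (hint hf _)
    (fun x _ => hder x) (fun x _ => hd x)

theorem continuous_fourierInv {g : V → F} (hg : Integrable g) : Continuous (𝓕⁻ g) :=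
  VectorFourier.fourierIntegral_continuous Real.continuous_fourierChar
    (by simpa using continuous_inner.fun_neg) hg

variable [CompleteSpace F]

theorem integral_smul_fourier_toLp {f : V → F} (hf : MemLp f 2) (φ : 𝓢(V, ℂ)) :
    ∫ x, φ x • (𝓕 (hf.toLp f) : Lp F 2 (volume : Measure V)) x = ∫ x, 𝓕 φ x • f x := by
  have h := DFunLike.congr_fun (Lp.fourier_toTemperedDistribution_eq (hf.toLp f)) φ
  simp only [TemperedDistribution.fourier_apply, Lp.toTemperedDistribution_apply] at h
  refine h.symm.trans (integral_congr_ae ?_)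
  filter_upwards [hf.coeFn_toLp] with x hx
  rw [hx]

theorem integral_smul_fourierInv_toLp {g : V → F} (hg : MemLp g 2) (φ : 𝓢(V, ℂ)) :
    ∫ x, φ x • (𝓕⁻ (hg.toLp g) : Lp F 2 (volume : Measure V)) x = ∫ x, 𝓕⁻ φ x • g x := by
  have h := DFunLike.congr_fun (Lp.fourierInv_toTemperedDistribution_eq (hg.toLp g)) φ
  simp only [TemperedDistribution.fourierInv_apply, Lp.toTemperedDistribution_apply] at h
  refine h.symm.trans (integral_congr_ae ?_)
  filter_upwards [hg.coeFn_toLp] with x hx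
  rw [hx]

theorem integral_fourierInv_smul_eq {g : V → F} (hg : Integrable g) (φ : 𝓢(V, ℂ)) :
    ∫ x, 𝓕⁻ φ x • g x = ∫ x, φ x • 𝓕⁻ g x := by
  have hflip : (-innerₗ V).flip = (-innerₗ V : V →ₗ[ℝ] V →ₗ[ℝ] ℝ) := by
    ext x y
    simp [real_inner_comm]
  have h := VectorFourier.integral_fourierIntegral_smul_eq_flip (μ := volume) (ν := volume)
    (L := -innerₗ V) (f := φ) (g := g) Real.continuous_fourierChar
    (by simpa using continuous_inner.fun_neg) φ.integrable hg
  rw [hflip] at h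
  rwa [SchwartzMap.fourierInv_coe]

theorem ae_eq_of_forall_integral_schwartzMap_smul_eq {f g : V → F} (hf : LocallyIntegrable f)
    (hg : LocallyIntegrable g) (h : ∀ φ : 𝓢(V, ℂ), ∫ x, φ x • f x = ∫ x, φ x • g x) :
    f =ᵐ[volume] g := by
  refine ae_eq_of_integral_contDiff_smul_eq hf hg fun φ φ_smooth φ_cpt => ?_
  have h₁ : HasCompactSupport (Complex.ofRealCLM ∘ φ) := φ_cpt.comp_left rfl
  have h₂ : ContDiff ℝ (⊤ : ℕ∞) (Complex.ofRealCLM ∘ φ) := by fun_prop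
  simpa using h (h₁.toSchwartzMap h₂)

theorem coeFn_fourierInv_toLp {g : V → F} (hg : Integrable g) (hg2 : MemLp g 2) :
    (𝓕⁻ (hg2.toLp g) : Lp F 2 (volume : Measure V)) =ᵐ[volume] 𝓕⁻ g :=
  ae_eq_of_forall_integral_schwartzMap_smul_eq ((Lp.memLp _).locallyIntegrable (by norm_num))
    (continuous_fourierInv hg).locallyIntegrable fun φ =>
      (integral_smul_fourierInv_toLp hg2 φ).trans (integral_fourierInv_smul_eq hg φ)

theorem memLp_fourierInv {g : V → F} (hg : Integrable g) (hg2 : MemLp g 2) : MemLp (𝓕⁻ g) 2 :=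
  (memLp_congr_ae (coeFn_fourierInv_toLp hg hg2)).1 (Lp.memLp _)

theorem fourier_toLp_fourierInv {g : V → F} (hg : Integrable g) (hg2 : MemLp g 2) :
    𝓕 ((memLp_fourierInv hg hg2).toLp (𝓕⁻ g)) = hg2.toLp g := by
  have h : (memLp_fourierInv hg hg2).toLp (𝓕⁻ g) = 𝓕⁻ (hg2.toLp g) :=
    Lp.ext ((memLp_fourierInv hg hg2).coeFn_toLp.trans (coeFn_fourierInv_toLp hg hg2).symm)
  rw [h, FourierTransform.fourier_fourierInv_eq]

theorem coeFn_fourier_toLp_lineDeriv {f f' : V → F} {m : V} (hf : MemLp f 2) (hf' : MemLp f' 2)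
    (hd : ∀ x, HasLineDerivAt ℝ f (f' x) x m) :
    (𝓕 (hf'.toLp f') : Lp F 2 (volume : Measure V)) =ᵐ[volume] fun ξ =>
      (2 * Real.pi * Complex.I * inner ℝ ξ m) •
        (𝓕 (hf.toLp f) : Lp F 2 (volume : Measure V)) ξ := by
  have hsymbol : Continuous fun ξ : V => 2 * Real.pi * Complex.I * inner ℝ ξ m := by fun_prop
  refine ae_eq_of_forall_integral_schwartzMap_smul_eq
    ((Lp.memLp _).locallyIntegrable (by norm_num)) ?_ fun φ => ?_
  · rw [← locallyIntegrableOn_univ]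
    exact (((Lp.memLp _).locallyIntegrable (by norm_num)).locallyIntegrableOn _).continuousOn_smul
      isOpen_univ.isLocallyClosed hsymbol.continuousOn
  set ψ : 𝓢(V, ℂ) := (2 * Real.pi * Complex.I) • smulLeftCLM ℂ (inner ℝ · m) φ with hψ
  have hψ_apply : ∀ x, ψ x = φ x * (2 * Real.pi * Complex.I * inner ℝ x m) := fun x => by
    rw [hψ, smul_apply, smulLeftCLM_apply_apply (by fun_prop), Complex.real_smul,
      smul_eq_mul]
    ring
  calc ∫ x, φ x • (𝓕 (hf'.toLp f') : Lp F 2 (volume : Measure V)) x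
      = -∫ x, (∂_{m} (𝓕 φ) : 𝓢(V, ℂ)) x • f x :=
        (integral_smul_fourier_toLp hf' φ).trans (integral_fourier_smul_lineDeriv_eq hf hf' hd φ)
    _ = ∫ x, 𝓕 ψ x • f x := by
        rw [SchwartzMap.lineDerivOp_fourier_eq, ← integral_neg]
        simp only [hψ, neg_smul, FourierTransform.fourier_neg, neg_apply, neg_neg]
    _ = ∫ x, φ x • (2 * Real.pi * Complex.I * inner ℝ x m) •
          (𝓕 (hf.toLp f) : Lp F 2 (volume : Measure V)) x := by
        refine (integral_smul_fourier_toLp hf ψ).symm.trans ?_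
        simp only [hψ_apply, mul_smul]

end FourierLp

/-! ### Weighted `L²` norms -/

theorem eLpNorm_two_sq {α E : Type*} [MeasurableSpace α] {μ : Measure α} [NormedAddCommGroup E]
    (g : α → E) : eLpNorm g 2 μ ^ 2 = ∫⁻ x, ‖g x‖ₑ ^ 2 ∂μ := by
  have := eLpNorm_nnreal_pow_eq_lintegral (f := g) (μ := μ) (p := 2) (by norm_num)
  simpa using this

theorem lintegral_mul_sq_le {α : Type*} [MeasurableSpace α] {μ : Measure α} {f g : α → ℝ≥0∞}
    (hf : AEMeasurable f μ) (hg : AEMeasurable g μ) :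
    (∫⁻ x, f x * g x ∂μ) ^ 2 ≤ (∫⁻ x, f x ^ 2 ∂μ) * ∫⁻ x, g x ^ 2 ∂μ := by
  have h := pow_le_pow_left'
    (ENNReal.lintegral_mul_le_Lp_mul_Lq μ Real.HolderConjugate.two_two hf hg) 2
  rw [mul_pow, ← ENNReal.rpow_mul_natCast, ← ENNReal.rpow_mul_natCast] at h
  simpa using h

/-- The weight `(1 + (2πξ)²)^{σ/2}`, the symbol of `(1 - ∂ₓ²)^{σ/2}`. -/
def sobolevWeight (σ ξ : ℝ) : ℝ := (1 + (2 * Real.pi * ξ) ^ 2) ^ (σ / 2)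

theorem sobolevWeight_pos (σ ξ : ℝ) : 0 < sobolevWeight σ ξ := by unfold sobolevWeight; positivity

theorem sobolevWeight_add (σ τ ξ : ℝ) :
    sobolevWeight (σ + τ) ξ = sobolevWeight σ ξ * sobolevWeight τ ξ := by
  unfold sobolevWeight
  rw [← Real.rpow_add (by positivity), add_div]

theorem sobolevWeight_zero (ξ : ℝ) : sobolevWeight 0 ξ = 1 := by simp [sobolevWeight]

theorem sobolevWeight_mono {σ τ : ℝ} (h : σ ≤ τ) (ξ : ℝ) :
    sobolevWeight σ ξ ≤ sobolevWeight τ ξ :=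
  Real.rpow_le_rpow_of_exponent_le (by nlinarith [sq_nonneg (2 * Real.pi * ξ)]) (by linarith)

theorem sobolevWeight_two (ξ : ℝ) : sobolevWeight 2 ξ = 1 + (2 * Real.pi * ξ) ^ 2 := by
  simp [sobolevWeight]

theorem sobolevWeight_one_sq (ξ : ℝ) : sobolevWeight 1 ξ ^ 2 = 1 + (2 * Real.pi * ξ) ^ 2 := by
  rw [← sobolevWeight_two, sq, ← sobolevWeight_add]
  norm_num

theorem abs_le_sobolevWeight_one (ξ : ℝ) : |2 * Real.pi * ξ| ≤ sobolevWeight 1 ξ := by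
  apply abs_le_of_sq_le_sq _ (sobolevWeight_pos _ _).le
  rw [sobolevWeight_one_sq]
  linarith

@[fun_prop]
theorem continuous_sobolevWeight (σ : ℝ) : Continuous (sobolevWeight σ) := by
  unfold sobolevWeight
  exact Continuous.rpow_const (by fun_prop) fun x => Or.inl (by positivity)

theorem sobolevWeight_sq (σ ξ : ℝ) : sobolevWeight σ ξ ^ 2 = (1 + (2 * Real.pi * ξ) ^ 2) ^ σ := by
  unfold sobolevWeight
  rw [← Real.rpow_mul_natCast (by positivity)]
  norm_num

theorem sobolevWeight_sq_le {σ : ℝ} (hσ : 0 ≤ σ) (ξ η : ℝ) :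
    sobolevWeight σ ξ ^ 2 ≤ 4 ^ σ * (sobolevWeight σ η ^ 2 + sobolevWeight σ (ξ - η) ^ 2) := by
  simp only [sobolevWeight_sq]
  set a := 1 + (2 * Real.pi * η) ^ 2
  set b := 1 + (2 * Real.pi * (ξ - η)) ^ 2
  have ha : 0 < a := by positivity
  have hb : 0 < b := by positivity
  have hab : 1 + (2 * Real.pi * ξ) ^ 2 ≤ 4 * max a b := by
    have h : 1 + (2 * Real.pi * ξ) ^ 2 ≤ 2 * a + 2 * b := by
      have := sq_nonneg (2 * Real.pi * η - 2 * Real.pi * (ξ - η))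
      simp only [a, b]
      nlinarith
    linarith [le_max_left a b, le_max_right a b]
  calc (1 + (2 * Real.pi * ξ) ^ 2) ^ σ ≤ (4 * max a b) ^ σ :=
        Real.rpow_le_rpow (by positivity) hab hσ
    _ = 4 ^ σ * (max a b) ^ σ := Real.mul_rpow (by norm_num) (by positivity)
    _ ≤ 4 ^ σ * (a ^ σ + b ^ σ) := by
        gcongr
        rcases max_choice a b with h | h <;> rw [h] <;>
          linarith [Real.rpow_nonneg ha.le σ, Real.rpow_nonneg hb.le σ]

theorem lintegral_sobolevWeight_neg_sq_lt_top {σ : ℝ} (hσ : 1 / 2 < σ) :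
    ∫⁻ ξ, ENNReal.ofReal (sobolevWeight (-σ) ξ) ^ 2 < ⊤ := by
  have h : Integrable fun x : ℝ => (1 + ‖x‖ ^ 2) ^ (-(2 * σ) / 2) :=
    integrable_rpow_neg_one_add_norm_sq (by simp; linarith)
  refine lt_of_le_of_lt (lintegral_mono fun ξ => ?_) h.lintegral_lt_top
  rw [← ENNReal.ofReal_pow (sobolevWeight_pos _ _).le, sobolevWeight_sq]
  apply ENNReal.ofReal_le_ofReal
  rw [show -(2 * σ) / 2 = -σ by ring]
  apply Real.rpow_le_rpow_of_nonpos (by positivity) _ (by linarith)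
  rw [Real.norm_eq_abs, sq_abs, mul_pow]
  have : 1 ≤ (2 * Real.pi) ^ 2 := by nlinarith [Real.pi_gt_three]
  nlinarith [sq_nonneg ξ]

/-- The weighted norm `‖(1 + (2πξ)²)^{σ/2} g‖_{L²}`, that is, the `H^σ` norm read on the Fourier
side. -/
def weightedENorm (σ : ℝ) (g : ℝ → ℂ) : ℝ≥0∞ :=
  eLpNorm (fun ξ => ((sobolevWeight σ ξ : ℝ) : ℂ) * g ξ) 2 volume

theorem weightedENorm_sq (σ : ℝ) (g : ℝ → ℂ) :
    weightedENorm σ g ^ 2 = ∫⁻ ξ, (ENNReal.ofReal (sobolevWeight σ ξ) * ‖g ξ‖ₑ) ^ 2 := by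
  rw [weightedENorm, eLpNorm_two_sq]
  congr 1 with ξ
  rw [enorm_mul, ← ofReal_norm (_ : ℂ), Complex.norm_real,
    Real.norm_of_nonneg (sobolevWeight_pos _ _).le]

theorem weightedENorm_congr_ae {σ : ℝ} {g₁ g₂ : ℝ → ℂ} (h : g₁ =ᵐ[volume] g₂) :
    weightedENorm σ g₁ = weightedENorm σ g₂ := by
  apply eLpNorm_congr_ae
  filter_upwards [h] with ξ hξ
  rw [hξ]

theorem weightedENorm_mono {σ τ : ℝ} (h : σ ≤ τ) (g : ℝ → ℂ) :
    weightedENorm σ g ≤ weightedENorm τ g := by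
  apply eLpNorm_mono
  intro ξ
  rw [norm_mul, norm_mul, Complex.norm_real, Complex.norm_real,
    Real.norm_of_nonneg (sobolevWeight_pos _ _).le, Real.norm_of_nonneg (sobolevWeight_pos _ _).le]
  gcongr
  exact sobolevWeight_mono h ξ

theorem weightedENorm_zero (g : ℝ → ℂ) : weightedENorm 0 g = eLpNorm g 2 volume := by
  simp [weightedENorm, sobolevWeight_zero]

theorem weightedENorm_add_le {σ : ℝ} {g₁ g₂ : ℝ → ℂ} (h₁ : AEStronglyMeasurable g₁ volume)
    (h₂ : AEStronglyMeasurable g₂ volume) :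
    weightedENorm σ (fun ξ => g₁ ξ + g₂ ξ) ≤ weightedENorm σ g₁ + weightedENorm σ g₂ := by
  have hw : AEStronglyMeasurable (fun ξ => ((sobolevWeight σ ξ : ℝ) : ℂ)) volume :=
    (by fun_prop : Continuous _).aestronglyMeasurable
  unfold weightedENorm
  simp only [mul_add]
  exact eLpNorm_add_le (hw.mul h₁) (hw.mul h₂) (by norm_num)

theorem weightedENorm_const_mul (σ : ℝ) (c : ℂ) (g : ℝ → ℂ) :
    weightedENorm σ (fun ξ => c * g ξ) = ‖c‖ₑ * weightedENorm σ g := by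
  unfold weightedENorm
  simp only [mul_left_comm _ c]
  exact eLpNorm_const_smul c _ 2 volume

theorem memLp_of_weightedENorm_lt_top {σ : ℝ} (hσ : 0 ≤ σ) {g : ℝ → ℂ}
    (hm : AEStronglyMeasurable g volume) (hg : weightedENorm σ g < ⊤) : MemLp g 2 :=
  ⟨hm, weightedENorm_zero g ▸ (weightedENorm_mono hσ g).trans_lt hg⟩

/-- The constant of the embedding of `H^σ` in the bounded functions, finite for `σ > 1/2`. -/
def sobolevEmbeddingConst (σ : ℝ) : ℝ≥0∞ :=
  (∫⁻ ξ, ENNReal.ofReal (sobolevWeight (-σ) ξ) ^ 2) ^ (1 / 2 : ℝ)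

theorem sobolevEmbeddingConst_lt_top {σ : ℝ} (hσ : 1 / 2 < σ) : sobolevEmbeddingConst σ < ⊤ :=
  ENNReal.rpow_lt_top_of_nonneg (by norm_num) (lintegral_sobolevWeight_neg_sq_lt_top hσ).ne

theorem sobolevEmbeddingConst_sq (σ : ℝ) :
    sobolevEmbeddingConst σ ^ 2 = ∫⁻ ξ, ENNReal.ofReal (sobolevWeight (-σ) ξ) ^ 2 := by
  rw [sobolevEmbeddingConst, ← ENNReal.rpow_mul_natCast]
  norm_num

theorem lintegral_mul_enorm_sq_le {σ : ℝ} {g : ℝ → ℂ} {w : ℝ → ℝ≥0∞} (hw : Measurable w)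
    (hm : AEStronglyMeasurable g volume) :
    (∫⁻ ξ, w ξ * ‖g ξ‖ₑ) ^ 2
      ≤ (∫⁻ ξ, (w ξ * ENNReal.ofReal (sobolevWeight (-σ) ξ)) ^ 2) * weightedENorm σ g ^ 2 := by
  have hweight : ∀ τ, Measurable fun ξ => ENNReal.ofReal (sobolevWeight τ ξ) := fun τ =>
    (continuous_sobolevWeight τ).measurable.ennreal_ofReal
  have hsplit : ∀ ξ, w ξ * ‖g ξ‖ₑ = w ξ * ENNReal.ofReal (sobolevWeight (-σ) ξ) *
      (ENNReal.ofReal (sobolevWeight σ ξ) * ‖g ξ‖ₑ) := fun ξ => by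
    rw [← mul_assoc, mul_assoc (w ξ), ← ENNReal.ofReal_mul (sobolevWeight_pos _ _).le,
      ← sobolevWeight_add, neg_add_cancel, sobolevWeight_zero, ENNReal.ofReal_one, mul_one]
  rw [weightedENorm_sq, lintegral_congr hsplit]
  exact lintegral_mul_sq_le (hw.mul (hweight (-σ))).aemeasurable
    ((hweight σ).aemeasurable.mul hm.enorm)

theorem lintegral_enorm_le {σ : ℝ} {g : ℝ → ℂ} (hm : AEStronglyMeasurable g volume) :
    ∫⁻ ξ, ‖g ξ‖ₑ ≤ sobolevEmbeddingConst σ * weightedENorm σ g := by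
  refine (ENNReal.pow_le_pow_left_iff two_ne_zero).1 ?_
  rw [mul_pow, sobolevEmbeddingConst_sq]
  simpa using lintegral_mul_enorm_sq_le (σ := σ) (w := 1) measurable_one hm

theorem integrable_of_weightedENorm_lt_top {σ : ℝ} (hσ : 1 / 2 < σ) {g : ℝ → ℂ}
    (hm : AEStronglyMeasurable g volume) (hg : weightedENorm σ g < ⊤) : Integrable g :=
  ⟨hm, (lintegral_enorm_le hm).trans_lt (ENNReal.mul_lt_top (sobolevEmbeddingConst_lt_top hσ) hg)⟩

theorem sobolevENorm_of_memLp {f : ℝ → ℝ} (hf : MemLp (fun x => (f x : ℂ)) 2) (σ : ℝ) :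
    sobolevENorm σ f =
      weightedENorm σ (𝓕 (hf.toLp fun x => (f x : ℂ)) : Lp ℂ 2 (volume : Measure ℝ)) :=
  iInf_pos hf

theorem memLp_of_sobolevENorm_lt_top {σ : ℝ} {f : ℝ → ℝ} (hf : sobolevENorm σ f < ⊤) :
    MemLp (fun x => (f x : ℂ)) 2 :=
  (iInf_lt_top.1 hf).1

theorem sobolevENorm_add_le (σ : ℝ) (f₁ f₂ : ℝ → ℝ) :
    sobolevENorm σ (fun x => f₁ x + f₂ x) ≤ sobolevENorm σ f₁ + sobolevENorm σ f₂ := by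
  by_cases htop : sobolevENorm σ f₁ + sobolevENorm σ f₂ = ⊤
  · exact htop ▸ le_top
  obtain ⟨ht₁, ht₂⟩ := ENNReal.add_lt_top.1 (lt_top_iff_ne_top.2 htop)
  have h₁ := memLp_of_sobolevENorm_lt_top ht₁
  have h₂ := memLp_of_sobolevENorm_lt_top ht₂
  have hsum : MemLp (fun x => ((f₁ x + f₂ x : ℝ) : ℂ)) 2 := by
    simp only [Complex.ofReal_add]
    exact h₁.add h₂
  have hF : 𝓕 (hsum.toLp fun x => ((f₁ x + f₂ x : ℝ) : ℂ)) = 𝓕 (h₁.toLp _) + 𝓕 (h₂.toLp _) := by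
    rw [← FourierTransform.fourier_add, ← MemLp.toLp_add]
    congr 2
    ext x
    simp
  rw [sobolevENorm_of_memLp hsum, sobolevENorm_of_memLp h₁, sobolevENorm_of_memLp h₂, hF,
    weightedENorm_congr_ae (Lp.coeFn_add _ _)]
  exact weightedENorm_add_le (Lp.memLp _).1 (Lp.memLp _).1

theorem sobolevENorm_zero (σ : ℝ) : sobolevENorm σ (fun _ => 0) = 0 := by
  have h : MemLp (fun _ : ℝ => ((0 : ℝ) : ℂ)) 2 := by simp
  have h0 : h.toLp (fun _ : ℝ => ((0 : ℝ) : ℂ)) = 0 := by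
    simp only [Complex.ofReal_zero]
    exact MemLp.toLp_zero MemLp.zero'
  rw [sobolevENorm_of_memLp h, h0, FourierTransform.fourier_zero,
    weightedENorm_congr_ae (Lp.coeFn_zero ℂ 2 volume)]
  simp [weightedENorm]

theorem sobolevENorm_const_mul_le (σ c : ℝ) (f : ℝ → ℝ) :
    sobolevENorm σ (fun x => c * f x) ≤ ‖c‖ₑ * sobolevENorm σ f := by
  rcases eq_or_ne c 0 with rfl | hc
  · simp [sobolevENorm_zero]
  by_cases htop : sobolevENorm σ f = ⊤
  · simp [htop, ENNReal.mul_top, hc]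
  have hf := memLp_of_sobolevENorm_lt_top (lt_top_iff_ne_top.2 htop)
  have hcf : MemLp (fun x => ((c * f x : ℝ) : ℂ)) 2 := by
    simpa only [Complex.ofReal_mul] using hf.const_mul (c : ℂ)
  have hF : 𝓕 (hcf.toLp fun x => ((c * f x : ℝ) : ℂ)) = (c : ℂ) • 𝓕 (hf.toLp _) := by
    rw [← FourierTransform.fourier_smul, ← MemLp.toLp_const_smul]
    congr 2
    ext x
    simp
  rw [sobolevENorm_of_memLp hcf, sobolevENorm_of_memLp hf, hF,
    weightedENorm_congr_ae (Lp.coeFn_smul _ _)]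
  refine (weightedENorm_const_mul σ (c : ℂ) _).trans_le ?_
  rw [← ofReal_norm, Complex.norm_real, ofReal_norm]

/-! ### Functions represented by an integrable Fourier transform -/

/-- `f` is the inverse Fourier transform of `g ∈ L¹ ∩ L²`. Every continuous function of `H^σ`,
`σ > 1/2`, is of this form, and norms, products and derivatives can then be computed on `g`. -/
structure FourierRep (f : ℝ → ℝ) (g : ℝ → ℂ) : Prop where
  integrable : Integrable g
  memLp : MemLp g 2
  eq_fourierInv : ∀ x, (f x : ℂ) = 𝓕⁻ g x

namespace FourierRep

variable {f f₁ f₂ : ℝ → ℝ} {g g₁ g₂ : ℝ → ℂ}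

theorem coe_eq (h : FourierRep f g) : (fun x => (f x : ℂ)) = 𝓕⁻ g := funext h.eq_fourierInv

theorem continuous (h : FourierRep f g) : Continuous f := by
  have hinv := continuous_fourierInv h.integrable
  rw [← h.coe_eq] at hinv
  exact Complex.continuous_re.comp hinv

theorem integrable_fourierChar_smul (h : FourierRep f g) (x : ℝ) :
    Integrable fun ξ => Real.fourierChar (inner ℝ ξ x) • g ξ := by
  simpa using (Real.fourierIntegral_convergent_iff (-x)).2 h.integrable

theorem sobolevENorm_eq (h : FourierRep f g) (σ : ℝ) : sobolevENorm σ f = weightedENorm σ g := by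
  have hf : MemLp (fun x => (f x : ℂ)) 2 := h.coe_eq ▸ memLp_fourierInv h.integrable h.memLp
  have hF : 𝓕 (hf.toLp fun x => (f x : ℂ)) = h.memLp.toLp g := by
    rw [← fourier_toLp_fourierInv h.integrable h.memLp]
    simp only [h.coe_eq]
  rw [sobolevENorm_of_memLp hf, hF, weightedENorm_congr_ae h.memLp.coeFn_toLp]

theorem exists_of_sobolevENorm {σ : ℝ} (hσ : 1 / 2 < σ) (hc : Continuous f)
    (hf : sobolevENorm σ f < ⊤) : ∃ g, FourierRep f g := by
  have hf2 := memLp_of_sobolevENorm_lt_top hf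
  rw [sobolevENorm_of_memLp hf2] at hf
  set G : Lp ℂ 2 (volume : Measure ℝ) := 𝓕 (hf2.toLp fun x => (f x : ℂ)) with hG
  have hG1 : Integrable G := integrable_of_weightedENorm_lt_top hσ (Lp.memLp G).1 hf
  have hinv : 𝓕⁻ ((Lp.memLp G).toLp G) = hf2.toLp fun x => (f x : ℂ) := by
    rw [Lp.toLp_coeFn, hG, FourierTransform.fourierInv_fourier_eq]
  have hae : (fun x => (f x : ℂ)) =ᵐ[volume] 𝓕⁻ (G : ℝ → ℂ) :=
    hf2.coeFn_toLp.symm.trans (hinv ▸ coeFn_fourierInv_toLp hG1 (Lp.memLp G))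
  have heq := (Continuous.ae_eq_iff_eq volume (by fun_prop) (continuous_fourierInv hG1)).1 hae
  exact ⟨G, hG1, Lp.memLp G, congrFun heq⟩

theorem add (h₁ : FourierRep f₁ g₁) (h₂ : FourierRep f₂ g₂) :
    FourierRep (fun x => f₁ x + f₂ x) (fun ξ => g₁ ξ + g₂ ξ) := by
  refine ⟨h₁.integrable.add h₂.integrable, h₁.memLp.add h₂.memLp, fun x => ?_⟩
  rw [Complex.ofReal_add, h₁.eq_fourierInv, h₂.eq_fourierInv]
  simp only [Real.fourierInv_eq, smul_add]
  exact (integral_add (h₁.integrable_fourierChar_smul x) (h₂.integrable_fourierChar_smul x)).symm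

theorem const_mul (c : ℝ) (h : FourierRep f g) :
    FourierRep (fun x => c * f x) (fun ξ => (c : ℂ) * g ξ) := by
  refine ⟨h.integrable.const_mul _, h.memLp.const_mul _, fun x => ?_⟩
  rw [Complex.ofReal_mul, h.eq_fourierInv]
  simp only [Real.fourierInv_eq, mul_smul_comm, ← integral_const_mul]

theorem mul (h₁ : FourierRep f₁ g₁) (h₂ : FourierRep f₂ g₂)
    (hm : MemLp (convolution g₁ g₂ (ContinuousLinearMap.mul ℂ ℂ) volume) 2) :
    FourierRep (fun x => f₁ x * f₂ x)
      (convolution g₁ g₂ (ContinuousLinearMap.mul ℂ ℂ) volume) := by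
  refine ⟨h₁.integrable.integrable_convolution _ h₂.integrable, hm, fun x => ?_⟩
  rw [Complex.ofReal_mul, h₁.eq_fourierInv, h₂.eq_fourierInv]
  simp only [Real.fourierInv_eq_fourier_neg]
  exact (Real.fourier_mul_convolution_eq h₁.integrable h₂.integrable (-x)).symm

theorem hasDerivAt (h : FourierRep f g)
    (hg : Integrable fun ξ : ℝ => (2 * Real.pi * Complex.I * ξ) * g ξ) (x : ℝ) :
    HasDerivAt (fun y => (f y : ℂ))
      (𝓕⁻ (fun ξ : ℝ => (2 * Real.pi * Complex.I * ξ) * g ξ) x) x := by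
  have hg' : Integrable fun ξ : ℝ => ξ • g ξ := by
    refine (hg.const_mul (2 * Real.pi * Complex.I)⁻¹).congr (Eventually.of_forall fun ξ => ?_)
    simp only [Complex.real_smul]
    field_simp [Complex.two_pi_I_ne_zero]
  have hF := (Real.hasDerivAt_fourier h.integrable hg' (-x)).scomp x (hasDerivAt_neg x)
  have hf : (𝓕 g ∘ fun y : ℝ => -y) = fun y => (f y : ℂ) := by
    rw [h.coe_eq]
    ext y
    exact (Real.fourierInv_eq_fourier_neg g y).symm
  have hval : (-1 : ℝ) • 𝓕 (fun x : ℝ => (-2 * Real.pi * Complex.I * x) • g x) (-x)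
      = 𝓕⁻ (fun ξ : ℝ => (2 * Real.pi * Complex.I * ξ) * g ξ) x := by
    rw [Real.fourierInv_eq_fourier_neg, Real.fourier_eq, Real.fourier_eq, ← integral_smul]
    congr 1 with ξ
    simp [Circle.smul_def]
  rwa [hf, hval] at hF

end FourierRep

/-! ### The algebra property -/

/-- The square of the constant of the product estimate in `H^σ`, finite for `σ > 1/2`. -/
def sobolevProductConstSq (σ : ℝ) : ℝ≥0∞ :=
  ENNReal.ofReal (4 ^ σ) * (2 * ∫⁻ ξ, ENNReal.ofReal (sobolevWeight (-σ) ξ) ^ 2)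

theorem sobolevProductConstSq_lt_top {σ : ℝ} (hσ : 1 / 2 < σ) : sobolevProductConstSq σ < ⊤ :=
  ENNReal.mul_lt_top ENNReal.ofReal_lt_top
    (ENNReal.mul_lt_top (by norm_num) (lintegral_sobolevWeight_neg_sq_lt_top hσ))

theorem sobolevWeight_neg (σ ξ : ℝ) : sobolevWeight (-σ) ξ = (sobolevWeight σ ξ)⁻¹ := by
  apply eq_inv_of_mul_eq_one_left
  rw [← sobolevWeight_add, neg_add_cancel, sobolevWeight_zero]

theorem ofReal_sobolevWeight_neg_mul (σ ξ : ℝ) :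
    ENNReal.ofReal (sobolevWeight (-σ) ξ) * ENNReal.ofReal (sobolevWeight σ ξ) = 1 := by
  rw [← ENNReal.ofReal_mul (sobolevWeight_pos _ _).le, ← sobolevWeight_add, neg_add_cancel,
    sobolevWeight_zero, ENNReal.ofReal_one]

theorem measurable_ofReal_sobolevWeight (σ : ℝ) :
    Measurable fun ξ => ENNReal.ofReal (sobolevWeight σ ξ) :=
  (continuous_sobolevWeight σ).measurable.ennreal_ofReal

theorem sobolevWeight_sq_mul_neg_le {σ : ℝ} (hσ : 0 ≤ σ) (ξ η : ℝ) :
    sobolevWeight σ ξ ^ 2 * (sobolevWeight (-σ) η * sobolevWeight (-σ) (ξ - η)) ^ 2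
      ≤ 4 ^ σ * (sobolevWeight (-σ) η ^ 2 + sobolevWeight (-σ) (ξ - η) ^ 2) := by
  have hη := sobolevWeight_pos σ η
  have hξη := sobolevWeight_pos σ (ξ - η)
  rw [sobolevWeight_neg, sobolevWeight_neg]
  calc sobolevWeight σ ξ ^ 2 * ((sobolevWeight σ η)⁻¹ * (sobolevWeight σ (ξ - η))⁻¹) ^ 2
      ≤ (4 ^ σ * (sobolevWeight σ η ^ 2 + sobolevWeight σ (ξ - η) ^ 2)) *
        ((sobolevWeight σ η)⁻¹ * (sobolevWeight σ (ξ - η))⁻¹) ^ 2 := by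
        gcongr
        exact sobolevWeight_sq_le hσ ξ η
    _ = _ := by field_simp; ring

theorem lintegral_sobolevWeight_kernel_le {σ : ℝ} (hσ : 0 ≤ σ) (ξ : ℝ) :
    ENNReal.ofReal (sobolevWeight σ ξ) ^ 2 * ∫⁻ η, (ENNReal.ofReal (sobolevWeight (-σ) η) *
      ENNReal.ofReal (sobolevWeight (-σ) (ξ - η))) ^ 2 ≤ sobolevProductConstSq σ := by
  have hpos := sobolevWeight_pos
  rw [← lintegral_const_mul' _ _ (by simp)]
  calc _ ≤ ∫⁻ η, ENNReal.ofReal (4 ^ σ) * (ENNReal.ofReal (sobolevWeight (-σ) η) ^ 2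
          + ENNReal.ofReal (sobolevWeight (-σ) (ξ - η)) ^ 2) := by
        refine lintegral_mono fun η => ?_
        rw [← ENNReal.ofReal_mul (hpos _ _).le, ← ENNReal.ofReal_pow (hpos _ _).le,
          ← ENNReal.ofReal_pow (mul_pos (hpos _ _) (hpos _ _)).le,
          ← ENNReal.ofReal_mul (sq_nonneg _), ← ENNReal.ofReal_pow (hpos _ _).le,
          ← ENNReal.ofReal_pow (hpos _ _).le,
          ← ENNReal.ofReal_add (sq_nonneg _) (sq_nonneg _),
          ← ENNReal.ofReal_mul (by positivity)]
        exact ENNReal.ofReal_le_ofReal (sobolevWeight_sq_mul_neg_le hσ ξ η)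
    _ = sobolevProductConstSq σ := by
        rw [lintegral_const_mul' _ _ (by simp),
          lintegral_add_left ((measurable_ofReal_sobolevWeight _).pow_const 2),
          lintegral_sub_left_eq_self (fun η => ENNReal.ofReal (sobolevWeight (-σ) η) ^ 2) ξ,
          sobolevProductConstSq, two_mul]

section Convolution

variable {σ : ℝ} {g₁ g₂ : ℝ → ℂ}

theorem weighted_convolution_sq_le (hσ : 0 ≤ σ) (h₁ : AEStronglyMeasurable g₁ volume)
    (h₂ : AEStronglyMeasurable g₂ volume) (ξ : ℝ) :
    (ENNReal.ofReal (sobolevWeight σ ξ) *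
      ‖convolution g₁ g₂ (ContinuousLinearMap.mul ℂ ℂ) volume ξ‖ₑ) ^ 2
      ≤ sobolevProductConstSq σ * ∫⁻ η, (ENNReal.ofReal (sobolevWeight σ η) * ‖g₁ η‖ₑ) ^ 2 *
        (ENNReal.ofReal (sobolevWeight σ (ξ - η)) * ‖g₂ (ξ - η)‖ₑ) ^ 2 := by
  set w : ℝ → ℝ → ℝ≥0∞ := fun τ η => ENNReal.ofReal (sobolevWeight τ η)
  have hw : ∀ τ, Measurable (w τ) := measurable_ofReal_sobolevWeight
  have hA : AEMeasurable (fun η => w σ η * ‖g₁ η‖ₑ) := (hw σ).aemeasurable.mul h₁.enorm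
  have hB : AEMeasurable (fun η => w σ (ξ - η) * ‖g₂ (ξ - η)‖ₑ) :=
    ((hw σ).aemeasurable.mul h₂.enorm).comp_quasiMeasurePreserving
      (quasiMeasurePreserving_sub_left volume ξ)
  have hconv : ‖convolution g₁ g₂ (ContinuousLinearMap.mul ℂ ℂ) volume ξ‖ₑ ≤
      ∫⁻ η, (w σ η * ‖g₁ η‖ₑ * (w σ (ξ - η) * ‖g₂ (ξ - η)‖ₑ)) * (w (-σ) η * w (-σ) (ξ - η)) := by
    refine (enorm_integral_le_lintegral_enorm _).trans_eq (lintegral_congr fun η => ?_)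
    rw [ContinuousLinearMap.mul_apply', enorm_mul,
      show ∀ a b c d e f : ℝ≥0∞, a * b * (c * d) * (e * f) = (e * a) * (f * c) * (b * d) by
        intros; ring]
    simp only [w, ofReal_sobolevWeight_neg_mul, one_mul]
  have hcs := (pow_le_pow_left' hconv 2).trans (lintegral_mul_sq_le (hA.mul hB)
    ((hw (-σ)).mul ((hw (-σ)).comp (measurable_const_sub ξ))).aemeasurable)
  calc _ ≤ w σ ξ ^ 2 * ((∫⁻ η, (w σ η * ‖g₁ η‖ₑ * (w σ (ξ - η) * ‖g₂ (ξ - η)‖ₑ)) ^ 2) *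
          ∫⁻ η, (w (-σ) η * w (-σ) (ξ - η)) ^ 2) := by
        rw [mul_pow]
        exact mul_le_mul_right hcs _
    _ = (w σ ξ ^ 2 * ∫⁻ η, (w (-σ) η * w (-σ) (ξ - η)) ^ 2) *
          ∫⁻ η, (w σ η * ‖g₁ η‖ₑ) ^ 2 * (w σ (ξ - η) * ‖g₂ (ξ - η)‖ₑ) ^ 2 := by
        simp only [mul_pow]
        ring
    _ ≤ _ := mul_le_mul_left (lintegral_sobolevWeight_kernel_le hσ ξ) _

theorem lintegral_lintegral_mul_sub {G : Type*} [AddCommGroup G] [MeasurableSpace G]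
    [MeasurableAdd₂ G] [MeasurableNeg G] {μ : Measure G} [SFinite μ] [μ.IsAddLeftInvariant]
    {A B : G → ℝ≥0∞} (hA : AEMeasurable A μ) (hB : AEMeasurable B μ) :
    ∫⁻ ξ, ∫⁻ η, A η * B (ξ - η) ∂μ ∂μ = (∫⁻ η, A η ∂μ) * ∫⁻ η, B η ∂μ := by
  rw [lintegral_lintegral_swap (hA.comp_snd.mul
    (hB.comp_quasiMeasurePreserving (quasiMeasurePreserving_sub μ μ)))]
  have hinner : ∀ η, ∫⁻ ξ, A η * B (ξ - η) ∂μ = A η * ∫⁻ ξ, B ξ ∂μ := fun η => by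
    have hBη : AEMeasurable (fun ξ => B (ξ - η)) μ := hB.comp_quasiMeasurePreserving
      (measurePreserving_sub_right μ η).quasiMeasurePreserving
    rw [lintegral_const_mul'' _ hBη, lintegral_sub_right_eq_self]
  simp_rw [hinner]
  exact lintegral_mul_const'' _ hA

theorem weightedENorm_convolution_sq_le (hσ : 1 / 2 < σ) (h₁ : AEStronglyMeasurable g₁ volume)
    (h₂ : AEStronglyMeasurable g₂ volume) :
    weightedENorm σ (convolution g₁ g₂ (ContinuousLinearMap.mul ℂ ℂ) volume) ^ 2
      ≤ sobolevProductConstSq σ * (weightedENorm σ g₁ ^ 2 * weightedENorm σ g₂ ^ 2) := by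
  have hmeas : ∀ {g : ℝ → ℂ}, AEStronglyMeasurable g volume →
      AEMeasurable fun ξ => (ENNReal.ofReal (sobolevWeight σ ξ) * ‖g ξ‖ₑ) ^ 2 := fun h =>
    ((measurable_ofReal_sobolevWeight σ).aemeasurable.mul h.enorm).pow_const 2
  simp only [weightedENorm_sq]
  rw [← lintegral_lintegral_mul_sub (hmeas h₁) (hmeas h₂),
    ← lintegral_const_mul' _ _ (sobolevProductConstSq_lt_top hσ).ne]
  exact lintegral_mono fun ξ => weighted_convolution_sq_le (by linarith) h₁ h₂ ξ

end Convolution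

theorem sobolevENorm_mul_sq_le {σ : ℝ} (hσ : 1 / 2 < σ) {f₁ f₂ : ℝ → ℝ} (h₁ : Continuous f₁)
    (h₂ : Continuous f₂) (l₁ : sobolevENorm σ f₁ < ⊤) (l₂ : sobolevENorm σ f₂ < ⊤) :
    sobolevENorm σ (fun x => f₁ x * f₂ x) ^ 2
      ≤ sobolevProductConstSq σ * (sobolevENorm σ f₁ ^ 2 * sobolevENorm σ f₂ ^ 2) := by
  obtain ⟨g₁, r₁⟩ := FourierRep.exists_of_sobolevENorm hσ h₁ l₁
  obtain ⟨g₂, r₂⟩ := FourierRep.exists_of_sobolevENorm hσ h₂ l₂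
  rw [r₁.sobolevENorm_eq] at l₁ ⊢
  rw [r₂.sobolevENorm_eq] at l₂ ⊢
  have hle := weightedENorm_convolution_sq_le hσ r₁.memLp.1 r₂.memLp.1
  have hlt := hle.trans_lt (ENNReal.mul_lt_top (sobolevProductConstSq_lt_top hσ)
    (ENNReal.mul_lt_top (ENNReal.pow_lt_top l₁) (ENNReal.pow_lt_top l₂)))
  have hm := memLp_of_weightedENorm_lt_top (by linarith)
    (r₁.integrable.integrable_convolution (ContinuousLinearMap.mul ℂ ℂ) r₂.integrable).1
    ((ENNReal.pow_lt_top_iff.1 hlt).resolve_right two_ne_zero)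
  rw [(r₁.mul r₂ hm).sobolevENorm_eq]
  exact hle

/-! ### Derivatives in `H^σ` -/

theorem sobolevENorm_mono {σ τ : ℝ} (h : σ ≤ τ) (f : ℝ → ℝ) :
    sobolevENorm σ f ≤ sobolevENorm τ f :=
  iInf_mono fun _ => weightedENorm_mono h _

theorem sobolevENorm_order_zero {f : ℝ → ℝ} (hf : MemLp (fun x => (f x : ℂ)) 2) :
    sobolevENorm 0 f = eLpNorm (fun x => (f x : ℂ)) 2 volume := by
  rw [sobolevENorm_of_memLp hf, weightedENorm_zero]
  have h := (Lp.fourierTransformₗᵢ ℝ ℂ).norm_map (hf.toLp fun x => (f x : ℂ))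
  rw [Lp.norm_def, Lp.norm_toLp, ENNReal.toReal_eq_toReal_iff' (Lp.eLpNorm_ne_top _) hf.2.ne] at h
  exact h

theorem norm_two_pi_I_mul (ξ : ℝ) (z : ℂ) :
    ‖2 * Real.pi * Complex.I * ξ * z‖ = |2 * Real.pi * ξ| * ‖z‖ := by
  simp [abs_mul]

theorem aestronglyMeasurable_two_pi_I_mul {g : ℝ → ℂ} (hg : AEStronglyMeasurable g volume) :
    AEStronglyMeasurable (fun ξ : ℝ => (2 * Real.pi * Complex.I * ξ) * g ξ) volume :=
  (by fun_prop : Continuous fun ξ : ℝ => (2 * Real.pi * Complex.I * ξ : ℂ)).aestronglyMeasurable.mul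
    hg

theorem weightedENorm_two_pi_I_mul_le (σ : ℝ) (g : ℝ → ℂ) :
    weightedENorm σ (fun ξ : ℝ => (2 * Real.pi * Complex.I * ξ) * g ξ)
      ≤ weightedENorm (σ + 1) g := by
  refine eLpNorm_mono fun ξ => ?_
  rw [norm_mul, norm_two_pi_I_mul, norm_mul, Complex.norm_real, Complex.norm_real,
    Real.norm_of_nonneg (sobolevWeight_pos _ _).le, Real.norm_of_nonneg (sobolevWeight_pos _ _).le,
    sobolevWeight_add, ← mul_assoc]
  have hσ := (sobolevWeight_pos σ ξ).le
  gcongr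
  exact abs_le_sobolevWeight_one ξ

namespace FourierRep

variable {σ : ℝ} {f : ℝ → ℝ} {g : ℝ → ℂ}

theorem integrable_two_pi_I_mul (hσ : 1 / 2 < σ) (r : FourierRep f g)
    (hfin : weightedENorm (σ + 1) g < ⊤) :
    Integrable fun ξ : ℝ => (2 * Real.pi * Complex.I * ξ) * g ξ :=
  integrable_of_weightedENorm_lt_top hσ (aestronglyMeasurable_two_pi_I_mul r.memLp.1)
    ((weightedENorm_two_pi_I_mul_le σ g).trans_lt hfin)

theorem differentiable (hσ : 1 / 2 < σ) (r : FourierRep f g)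
    (hfin : weightedENorm (σ + 1) g < ⊤) : Differentiable ℝ f := fun x =>
  (Complex.reCLM.hasFDerivAt.comp_hasDerivAt x
    (r.hasDerivAt (r.integrable_two_pi_I_mul hσ hfin) x)).differentiableAt

protected theorem deriv (hσ : 1 / 2 < σ) (r : FourierRep f g)
    (hfin : weightedENorm (σ + 1) g < ⊤) :
    FourierRep (_root_.deriv f) fun ξ => (2 * Real.pi * Complex.I * ξ) * g ξ where
  integrable := r.integrable_two_pi_I_mul hσ hfin
  memLp := memLp_of_weightedENorm_lt_top (by linarith)
    (aestronglyMeasurable_two_pi_I_mul r.memLp.1)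
    ((weightedENorm_two_pi_I_mul_le σ g).trans_lt hfin)
  eq_fourierInv x := (r.differentiable hσ hfin x).hasDerivAt.ofReal_comp.unique
    (r.hasDerivAt (r.integrable_two_pi_I_mul hσ hfin) x)

end FourierRep

section Derivative

variable {σ : ℝ} {f : ℝ → ℝ}

theorem differentiable_of_sobolevENorm (hσ : 1 / 2 < σ) (hf : Continuous f)
    (hfin : sobolevENorm (σ + 1) f < ⊤) : Differentiable ℝ f := by
  obtain ⟨g, r⟩ := FourierRep.exists_of_sobolevENorm (by linarith) hf hfin
  exact r.differentiable hσ (r.sobolevENorm_eq _ ▸ hfin)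

theorem continuous_deriv_of_sobolevENorm (hσ : 1 / 2 < σ) (hf : Continuous f)
    (hfin : sobolevENorm (σ + 1) f < ⊤) : Continuous (deriv f) := by
  obtain ⟨g, r⟩ := FourierRep.exists_of_sobolevENorm (by linarith) hf hfin
  exact (r.deriv hσ (r.sobolevENorm_eq _ ▸ hfin)).continuous

theorem sobolevENorm_deriv_le (hσ : 1 / 2 < σ) (hf : Continuous f) :
    sobolevENorm σ (deriv f) ≤ sobolevENorm (σ + 1) f := by
  rcases eq_top_or_lt_top (sobolevENorm (σ + 1) f) with htop | hfin
  · exact htop ▸ le_top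
  obtain ⟨g, r⟩ := FourierRep.exists_of_sobolevENorm (by linarith) hf hfin
  rw [r.sobolevENorm_eq] at hfin ⊢
  rw [(r.deriv hσ hfin).sobolevENorm_eq]
  exact weightedENorm_two_pi_I_mul_le σ g

end Derivative

theorem eLpNorm_le_add_of_norm_le_add {α E F G : Type*} [MeasurableSpace α] {μ : Measure α}
    [NormedAddCommGroup E] [NormedAddCommGroup F] [NormedAddCommGroup G] {p : ℝ≥0∞} (hp : 1 ≤ p)
    {f : α → E} {f₁ : α → F} {f₂ : α → G} (h₁ : AEStronglyMeasurable f₁ μ)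
    (h₂ : AEStronglyMeasurable f₂ μ) (h : ∀ x, ‖f x‖ ≤ ‖f₁ x‖ + ‖f₂ x‖) :
    eLpNorm f p μ ≤ eLpNorm f₁ p μ + eLpNorm f₂ p μ := by
  rw [← eLpNorm_norm f₁, ← eLpNorm_norm f₂]
  exact (eLpNorm_mono_real h).trans (eLpNorm_add_le h₁.norm h₂.norm hp)

theorem aestronglyMeasurable_sobolevWeight_mul (σ : ℝ) {g : ℝ → ℂ}
    (hg : AEStronglyMeasurable g volume) :
    AEStronglyMeasurable (fun ξ => ((sobolevWeight σ ξ : ℝ) : ℂ) * g ξ) volume :=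
  (by fun_prop : Continuous fun ξ => ((sobolevWeight σ ξ : ℝ) : ℂ)).aestronglyMeasurable.mul hg

theorem sobolevWeight_one_le (ξ : ℝ) : sobolevWeight 1 ξ ≤ 1 + |2 * Real.pi * ξ| := by
  apply le_of_sq_le_sq _ (by positivity)
  rw [sobolevWeight_one_sq, ← sq_abs]
  nlinarith [abs_nonneg (2 * Real.pi * ξ)]

theorem sobolevENorm_add_one_le (σ : ℝ) {f f' : ℝ → ℝ} (hf : MemLp (fun x => (f x : ℂ)) 2)
    (hf' : MemLp (fun x => (f' x : ℂ)) 2) (hd : ∀ x, HasDerivAt f (f' x) x) :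
    sobolevENorm (σ + 1) f ≤ sobolevENorm σ f + sobolevENorm σ f' := by
  set F : Lp ℂ 2 (volume : Measure ℝ) := 𝓕 (hf.toLp fun x => (f x : ℂ)) with hF
  have hF' : (𝓕 (hf'.toLp fun x => (f' x : ℂ)) : Lp ℂ 2 (volume : Measure ℝ))
      =ᵐ[volume] fun ξ => (2 * Real.pi * Complex.I * ξ) * F ξ := by
    simpa [hF] using coeFn_fourier_toLp_lineDeriv (m := (1 : ℝ)) hf hf' fun x => by
      simpa using (hd x).ofReal_comp.hasFDerivAt.hasLineDerivAt 1
  rw [sobolevENorm_of_memLp hf, sobolevENorm_of_memLp hf, sobolevENorm_of_memLp hf',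
    weightedENorm_congr_ae hF']
  have hFm := (Lp.memLp F).1
  refine eLpNorm_le_add_of_norm_le_add (by norm_num) (aestronglyMeasurable_sobolevWeight_mul σ hFm)
    (aestronglyMeasurable_sobolevWeight_mul σ (aestronglyMeasurable_two_pi_I_mul hFm)) fun ξ => ?_
  have hσ := sobolevWeight_pos σ ξ
  rw [norm_mul, norm_mul, norm_mul, norm_two_pi_I_mul, Complex.norm_real, Complex.norm_real,
    Real.norm_of_nonneg hσ.le, Real.norm_of_nonneg (sobolevWeight_pos _ _).le, sobolevWeight_add]
  calc sobolevWeight σ ξ * sobolevWeight 1 ξ * ‖F ξ‖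
      ≤ sobolevWeight σ ξ * (1 + |2 * Real.pi * ξ|) * ‖F ξ‖ := by
        gcongr
        exact sobolevWeight_one_le ξ
    _ = _ := by ring

/-! ### Embedding and equicontinuity -/

theorem enorm_le_sobolevENorm {σ : ℝ} (hσ : 1 / 2 < σ) {f : ℝ → ℝ} (hf : Continuous f)
    (hfin : sobolevENorm σ f < ⊤) (x : ℝ) :
    ‖f x‖ₑ ≤ sobolevEmbeddingConst σ * sobolevENorm σ f := by
  obtain ⟨g, r⟩ := FourierRep.exists_of_sobolevENorm hσ hf hfin
  rw [← ofReal_norm, ← Complex.norm_real, ofReal_norm, r.eq_fourierInv, Real.fourierInv_eq,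
    r.sobolevENorm_eq]
  refine ((enorm_integral_le_lintegral_enorm _).trans_eq (lintegral_congr fun ξ => ?_)).trans
    (lintegral_enorm_le r.memLp.1)
  rw [← ofReal_norm, Circle.norm_smul, ofReal_norm]

/-- The square of a modulus of continuity common to the unit ball of `H^σ`, `σ > 1/2`. -/
def sobolevModulusSq (σ d : ℝ) : ℝ≥0∞ :=
  ∫⁻ ξ, (‖(Real.fourierChar (ξ * d) : ℂ) - 1‖ₑ * ENNReal.ofReal (sobolevWeight (-σ) ξ)) ^ 2

theorem continuous_fourierChar_mul_sub_one :
    Continuous fun p : ℝ × ℝ => (Real.fourierChar (p.1 * p.2) : ℂ) - 1 :=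
  (continuous_subtype_val.comp (Real.continuous_fourierChar.comp continuous_mul)).sub
    continuous_const

theorem enorm_fourierChar_sub_one_le (x : ℝ) : ‖(Real.fourierChar x : ℂ) - 1‖ₑ ≤ 2 := by
  refine enorm_sub_le.trans_eq ?_
  rw [← ofReal_norm, ← ofReal_norm, Circle.norm_coe, norm_one, ENNReal.ofReal_one,
    one_add_one_eq_two]

theorem tendsto_sobolevModulusSq {σ : ℝ} (hσ : 1 / 2 < σ) :
    Tendsto (sobolevModulusSq σ) (𝓝 0) (𝓝 0) := by
  have hw := measurable_ofReal_sobolevWeight (-σ)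
  have hbound : ∫⁻ ξ, (2 * ENNReal.ofReal (sobolevWeight (-σ) ξ)) ^ 2 ≠ ⊤ := by
    simp only [mul_pow]
    rw [lintegral_const_mul' _ _ (by simp)]
    exact (ENNReal.mul_lt_top (by norm_num) (lintegral_sobolevWeight_neg_sq_lt_top hσ)).ne
  have hptwise (ξ : ℝ) : Tendsto (fun d => (‖(Real.fourierChar (ξ * d) : ℂ) - 1‖ₑ *
      ENNReal.ofReal (sobolevWeight (-σ) ξ)) ^ 2) (𝓝 0) (𝓝 0) := by
    have h0 := (continuous_fourierChar_mul_sub_one.comp (Continuous.prodMk_right ξ)).enorm.tendsto 0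
    have h1 := ENNReal.Tendsto.pow (n := 2) (ENNReal.Tendsto.mul_const
      (b := ENNReal.ofReal (sobolevWeight (-σ) ξ)) h0 (Or.inr ENNReal.ofReal_ne_top))
    simpa using h1
  have hmeas (d : ℝ) : Measurable fun ξ => (‖(Real.fourierChar (ξ * d) : ℂ) - 1‖ₑ *
      ENNReal.ofReal (sobolevWeight (-σ) ξ)) ^ 2 :=
    (((continuous_fourierChar_mul_sub_one.comp (Continuous.prodMk_left d)).measurable.enorm).mul
      hw).pow_const 2
  have h := tendsto_lintegral_filter_of_dominated_convergence (μ := volume) (l := 𝓝 (0 : ℝ))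
    (fun ξ => (2 * ENNReal.ofReal (sobolevWeight (-σ) ξ)) ^ 2) (Eventually.of_forall hmeas)
    (Eventually.of_forall fun d => Eventually.of_forall fun ξ => by
      gcongr
      exact enorm_fourierChar_sub_one_le _)
    hbound (Eventually.of_forall hptwise)
  rwa [lintegral_zero] at h

theorem enorm_sub_sq_le_sobolevModulusSq {σ : ℝ} (hσ : 1 / 2 < σ) {f : ℝ → ℝ} (hf : Continuous f)
    (hfin : sobolevENorm σ f < ⊤) (x y : ℝ) :
    ‖f x - f y‖ₑ ^ 2 ≤ sobolevModulusSq σ (x - y) * sobolevENorm σ f ^ 2 := by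
  obtain ⟨g, r⟩ := FourierRep.exists_of_sobolevENorm hσ hf hfin
  have hshift (ξ : ℝ) : Real.fourierChar (inner ℝ ξ x) • g ξ - Real.fourierChar (inner ℝ ξ y) • g ξ
      = Real.fourierChar (inner ℝ ξ y) • (((Real.fourierChar (ξ * (x - y)) : ℂ) - 1) * g ξ) := by
    have hsplit : (inner ℝ ξ x : ℝ) = inner ℝ ξ y + ξ * (x - y) := by
      simp only [RCLike.inner_apply, conj_trivial]
      ring
    rw [hsplit, AddChar.map_add_eq_mul]
    simp only [Circle.smul_def, smul_eq_mul, Circle.coe_mul]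
    ring
  have hle : ‖f x - f y‖ₑ ≤ ∫⁻ ξ, ‖(Real.fourierChar (ξ * (x - y)) : ℂ) - 1‖ₑ * ‖g ξ‖ₑ := by
    rw [← ofReal_norm, ← Complex.norm_real, ofReal_norm, Complex.ofReal_sub, r.eq_fourierInv,
      r.eq_fourierInv, Real.fourierInv_eq, Real.fourierInv_eq, ← integral_sub
      (r.integrable_fourierChar_smul x) (r.integrable_fourierChar_smul y)]
    refine (enorm_integral_le_lintegral_enorm _).trans_eq (lintegral_congr fun ξ => ?_)
    rw [hshift, ← ofReal_norm, Circle.norm_smul, ofReal_norm, enorm_mul]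
  rw [r.sobolevENorm_eq]
  exact (pow_le_pow_left' hle 2).trans (lintegral_mul_enorm_sq_le
    (continuous_fourierChar_mul_sub_one.comp (Continuous.prodMk_left (x - y))).measurable.enorm
    r.memLp.1)

theorem equicontinuous_of_sobolevENorm {σ : ℝ} (hσ : 1 / 2 < σ) {M : ℝ≥0∞} (hM : M < ⊤) {e : ℝ}
    (he : 0 < e) : ∃ d > 0, ∀ f : ℝ → ℝ, Continuous f → sobolevENorm σ f ≤ M →
      ∀ x y, |x - y| < d → |f x - f y| ≤ e := by
  have hlim : Tendsto (fun d => sobolevModulusSq σ d * M ^ 2) (𝓝 0) (𝓝 0) := by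
    simpa using ENNReal.Tendsto.mul_const (b := M ^ 2) (tendsto_sobolevModulusSq hσ)
      (Or.inr (ENNReal.pow_lt_top hM).ne)
  have hev : ∀ᶠ d in 𝓝 (0 : ℝ), sobolevModulusSq σ d * M ^ 2 < ENNReal.ofReal e ^ 2 :=
    hlim.eventually (gt_mem_nhds (ENNReal.pow_pos (by simpa using he) 2))
  obtain ⟨d, hd, hsmall⟩ := Metric.eventually_nhds_iff.1 hev
  refine ⟨d, hd, fun f hf hfM x y hxy => ?_⟩
  have hsq : ‖f x - f y‖ₑ ^ 2 ≤ ENNReal.ofReal e ^ 2 :=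
    calc ‖f x - f y‖ₑ ^ 2 ≤ sobolevModulusSq σ (x - y) * sobolevENorm σ f ^ 2 :=
          enorm_sub_sq_le_sobolevModulusSq hσ hf (hfM.trans_lt hM) x y
      _ ≤ sobolevModulusSq σ (x - y) * M ^ 2 := by gcongr
      _ ≤ ENNReal.ofReal e ^ 2 := (hsmall (by simpa using hxy)).le
  have hle := (ENNReal.pow_le_pow_left_iff two_ne_zero).1 hsq
  rwa [← ofReal_norm, ENNReal.ofReal_le_ofReal_iff he.le] at hle

/-! ### The elliptic operator `1 - c ∂ₓ²` -/

section Elliptic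

variable {σ c m k : ℝ}

theorem sobolevWeight_mul_le_of_elliptic (hc : 0 ≤ c)
    (hmk : ∀ y : ℝ, 0 ≤ y → m * (1 + y) ≤ k * (1 + c * y)) {ξ w a b : ℝ} (ha : 0 ≤ a) (hb : 0 ≤ b)
    (h : (1 + c * (2 * Real.pi * ξ) ^ 2) * w ≤ a + m * b) :
    sobolevWeight (σ + 2) ξ * w ≤ sobolevWeight (σ + 2) ξ * a + k * (sobolevWeight σ ξ * b) := by
  have hσ := sobolevWeight_pos σ ξ
  have hσ2 := sobolevWeight_pos (σ + 2) ξ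
  set y := (2 * Real.pi * ξ) ^ 2
  have hy0 : 0 ≤ y := sq_nonneg _
  have hpos : 0 < 1 + c * y := by positivity
  have hm : m * sobolevWeight (σ + 2) ξ ≤ k * (1 + c * y) * sobolevWeight σ ξ := by
    rw [sobolevWeight_add, sobolevWeight_two]
    nlinarith [hmk y hy0]
  refine le_of_mul_le_mul_left ?_ hpos
  calc (1 + c * y) * (sobolevWeight (σ + 2) ξ * w)
      = sobolevWeight (σ + 2) ξ * ((1 + c * y) * w) := by ring
    _ ≤ sobolevWeight (σ + 2) ξ * (a + m * b) := by gcongr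
    _ = sobolevWeight (σ + 2) ξ * a + (m * sobolevWeight (σ + 2) ξ) * b := by ring
    _ ≤ (1 + c * y) * (sobolevWeight (σ + 2) ξ * a) + (k * (1 + c * y) * sobolevWeight σ ξ) * b :=
        add_le_add (le_mul_of_one_le_left (by positivity) (le_add_of_nonneg_right (by positivity)))
          (mul_le_mul_of_nonneg_right hm hb)
    _ = _ := by ring

theorem weightedENorm_le_of_elliptic (hc : 0 ≤ c) (hm : 0 ≤ m) (hk : 0 ≤ k)
    (hmk : ∀ y : ℝ, 0 ≤ y → m * (1 + y) ≤ k * (1 + c * y)) {w a b : ℝ → ℂ}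
    (ha : AEStronglyMeasurable a volume) (hb : AEStronglyMeasurable b volume)
    (heq : ∀ ξ, ((1 + c * (2 * Real.pi * ξ) ^ 2 : ℝ) : ℂ) * w ξ = a ξ + m * b ξ) :
    weightedENorm (σ + 2) w ≤ weightedENorm (σ + 2) a + ENNReal.ofReal k * weightedENorm σ b := by
  have hkb : ENNReal.ofReal k * weightedENorm σ b = weightedENorm σ fun ξ => (k : ℂ) * b ξ := by
    rw [weightedENorm_const_mul, ← ofReal_norm, Complex.norm_real, Real.norm_of_nonneg hk]
  rw [hkb]
  refine eLpNorm_le_add_of_norm_le_add (by norm_num)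
    (aestronglyMeasurable_sobolevWeight_mul _ ha)
    (aestronglyMeasurable_sobolevWeight_mul _ (hb.const_mul _)) fun ξ => ?_
  have hnorm : (1 + c * (2 * Real.pi * ξ) ^ 2) * ‖w ξ‖ ≤ ‖a ξ‖ + m * ‖b ξ‖ := by
    rw [← Real.norm_of_nonneg (by positivity : 0 ≤ 1 + c * (2 * Real.pi * ξ) ^ 2),
      ← Complex.norm_real, ← norm_mul, heq]
    refine (norm_add_le _ _).trans_eq ?_
    rw [norm_mul, Complex.norm_real, Real.norm_of_nonneg hm]
  simp only [norm_mul, Complex.norm_real, Real.norm_of_nonneg (sobolevWeight_pos _ _).le,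
    Real.norm_of_nonneg hk]
  refine (sobolevWeight_mul_le_of_elliptic hc hmk (norm_nonneg _) (norm_nonneg _)
    hnorm).trans_eq ?_
  ring

theorem sobolevENorm_le_of_elliptic (hσ : 1 / 2 < σ) (hc : 0 ≤ c) (hm : 0 ≤ m)
    (hk : 0 ≤ k) (hmk : ∀ y : ℝ, 0 ≤ y → m * (1 + y) ≤ k * (1 + c * y)) {W A B : ℝ → ℝ}
    (hW : Continuous W) (hW' : sobolevENorm (σ + 2) W < ⊤) (hB : Continuous B)
    (hB' : sobolevENorm σ B < ⊤) (heq : ∀ x, W x - c * deriv (deriv W) x = A x + m * B x) :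
    sobolevENorm (σ + 2) W ≤ sobolevENorm (σ + 2) A + ENNReal.ofReal k * sobolevENorm σ B := by
  obtain ⟨gW, rW⟩ := FourierRep.exists_of_sobolevENorm (by linarith) hW hW'
  obtain ⟨gB, rB⟩ := FourierRep.exists_of_sobolevENorm hσ hB hB'
  rw [rW.sobolevENorm_eq, show σ + 2 = (σ + 1) + 1 by ring] at hW'
  have rW₁ := rW.deriv (by linarith) hW'
  have rW₂ := rW₁.deriv hσ ((weightedENorm_two_pi_I_mul_le _ _).trans_lt hW')
  have hA : A = fun x => W x + -c * deriv (deriv W) x + -m * B x := by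
    ext x
    linarith [heq x]
  have rA := (rW.add (rW₂.const_mul (-c))).add (rB.const_mul (-m))
  rw [← hA] at rA
  rw [rW.sobolevENorm_eq, rB.sobolevENorm_eq, rA.sobolevENorm_eq]
  refine weightedENorm_le_of_elliptic hc hm hk hmk rA.memLp.1 rB.memLp.1 fun ξ => ?_
  push_cast
  linear_combination ((c : ℂ) * (2 * Real.pi * ξ) ^ 2 * gW ξ) * Complex.I_sq

end Elliptic

/-! ### Exchanging time and space derivatives -/

section UniformLimit

variable {E α : Type*} [NormedAddCommGroup E] [NormedSpace ℝ E] {l : Filter α} [l.NeBot]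
  {I : Set ℝ} {F F' : α → ℝ → E} {G G' : ℝ → E}

theorem norm_sub_sub_le_of_tendsto (hI : Convex ℝ I) {a : α} {C : ℝ}
    (hF : ∀ b, ∀ t ∈ I, HasDerivWithinAt (F b) (F' b t) I t)
    (hG : ∀ t ∈ I, Tendsto (fun b => F b t) l (𝓝 (G t)))
    (hC : ∀ᶠ b in l, ∀ t ∈ I, ‖F' a t - F' b t‖ ≤ C) {t t₀ : ℝ} (ht : t ∈ I) (ht₀ : t₀ ∈ I) :
    ‖(F a t - G t) - (F a t₀ - G t₀)‖ ≤ C * ‖t - t₀‖ := by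
  refine le_of_tendsto (((tendsto_const_nhds.sub (hG t ht)).sub
    (tendsto_const_nhds.sub (hG t₀ ht₀))).norm) ?_
  filter_upwards [hC] with b hb
  exact hI.norm_image_sub_le_of_norm_hasDerivWithin_le
    (fun τ hτ => (hF a τ hτ).sub (hF b τ hτ)) hb ht₀ ht

theorem hasDerivWithinAt_of_tendstoUniformlyOn (hI : Convex ℝ I)
    (hF : ∀ b, ∀ t ∈ I, HasDerivWithinAt (F b) (F' b t) I t)
    (hG : ∀ t ∈ I, Tendsto (fun b => F b t) l (𝓝 (G t))) (hG' : TendstoUniformlyOn F' G' l I)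
    {t₀ : ℝ} (ht₀ : t₀ ∈ I) : HasDerivWithinAt G (G' t₀) I t₀ := by
  rw [hasDerivWithinAt_iff_isLittleO, Asymptotics.isLittleO_iff]
  intro c hc
  have hnear := Metric.tendstoUniformlyOn_iff.1 hG' (c / 4) (by positivity)
  simp only [dist_eq_norm] at hnear
  obtain ⟨a, ha⟩ := hnear.exists
  have hC : ∀ᶠ b in l, ∀ t ∈ I, ‖F' a t - F' b t‖ ≤ c / 2 := by
    filter_upwards [hnear] with b hb t ht
    calc ‖F' a t - F' b t‖ ≤ ‖G' t - F' a t‖ + ‖G' t - F' b t‖ := by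
          rw [norm_sub_rev (G' t) (F' a t)]
          exact norm_sub_le_norm_sub_add_norm_sub _ _ _
      _ ≤ c / 2 := by linarith [ha t ht, hb t ht]
  have hFa := hF a t₀ ht₀
  rw [hasDerivWithinAt_iff_isLittleO, Asymptotics.isLittleO_iff] at hFa
  filter_upwards [hFa (show 0 < c / 4 by positivity), self_mem_nhdsWithin] with t hlin ht
  have hdiff := norm_sub_sub_le_of_tendsto hI hF hG hC ht ht₀
  have hslope : ‖(t - t₀) • (G' t₀ - F' a t₀)‖ ≤ c / 4 * ‖t - t₀‖ := by
    rw [norm_smul, mul_comm]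
    gcongr
    exact (ha t₀ ht₀).le
  calc ‖G t - G t₀ - (t - t₀) • G' t₀‖
      = ‖(F a t - F a t₀ - (t - t₀) • F' a t₀) - (t - t₀) • (G' t₀ - F' a t₀)
        - ((F a t - G t) - (F a t₀ - G t₀))‖ := by
        congr 1
        module
    _ ≤ c / 4 * ‖t - t₀‖ + c / 4 * ‖t - t₀‖ + c / 2 * ‖t - t₀‖ :=
        (norm_sub_le _ _).trans
          (add_le_add ((norm_sub_le _ _).trans (add_le_add hlin hslope)) hdiff)
    _ = c * ‖t - t₀‖ := by ring

end UniformLimit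

theorem abs_slope_sub_deriv_le {k : ℝ → ℝ} (hk : Differentiable ℝ k) {x d e η : ℝ}
    (h : ∀ y, |y - x| < d → |deriv k y - deriv k x| ≤ e) (hη : 0 < η) (hηd : η < d) :
    |η⁻¹ * (k (x + η) - k x) - deriv k x| ≤ e := by
  obtain ⟨y, ⟨hxy, hyη⟩, hy⟩ := exists_deriv_eq_slope k (show x < x + η by linarith)
    hk.continuous.continuousOn hk.differentiableOn
  rw [add_sub_cancel_left, div_eq_inv_mul] at hy
  rw [← hy]
  exact h y (by rw [abs_lt]; constructor <;> linarith)

/- The time derivatives of the difference quotients of `u` in space are the difference quotients of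
`ut`, which converge uniformly in time by equicontinuity. -/
theorem hasDerivWithinAt_deriv {I : Set ℝ} (hI : Convex ℝ I) {u ut : ℝ → ℝ → ℝ}
    (hu : ∀ t ∈ I, Differentiable ℝ (u t)) (hut : ∀ t ∈ I, Differentiable ℝ (ut t))
    (h : ∀ t ∈ I, ∀ x, HasDerivWithinAt (fun τ => u τ x) (ut t x) I t)
    (heq : ∀ x, ∀ e > 0, ∃ d > 0, ∀ t ∈ I, ∀ y, |y - x| < d →
      |deriv (ut t) y - deriv (ut t) x| ≤ e) {t₀ : ℝ} (ht₀ : t₀ ∈ I) (x : ℝ) :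
    HasDerivWithinAt (fun τ => deriv (u τ) x) (deriv (ut t₀) x) I t₀ := by
  refine hasDerivWithinAt_of_tendstoUniformlyOn (l := 𝓝[>] (0 : ℝ))
    (F := fun η τ => η⁻¹ * (u τ (x + η) - u τ x))
    (F' := fun η τ => η⁻¹ * (ut τ (x + η) - ut τ x)) (G' := fun τ => deriv (ut τ) x) hI
    (fun η t ht => ((h t ht (x + η)).sub (h t ht x)).const_mul η⁻¹)
    (fun t ht => (hu t ht x).hasDerivAt.tendsto_slope_zero_right) ?_ ht₀
  rw [Metric.tendstoUniformlyOn_iff]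
  intro e he
  obtain ⟨d, hd, hclose⟩ := heq x (e / 2) (by positivity)
  filter_upwards [Ioo_mem_nhdsGT hd] with η hη t ht
  rw [dist_comm, Real.dist_eq]
  exact (abs_slope_sub_deriv_le (hut t ht) (hclose t ht) hη.1 hη.2).trans_lt (by linarith)

theorem convex_timeInterval (T : EReal) : Convex ℝ (timeInterval T) := by
  refine Set.OrdConnected.convex ⟨fun a ha b hb c hc => ⟨ha.1.trans hc.1, lt_of_le_of_lt ?_ hb.2⟩⟩
  exact_mod_cast hc.2

theorem uniqueDiffOn_timeInterval {T : EReal} (hT : 0 < T) : UniqueDiffOn ℝ (timeInterval T) := by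
  obtain ⟨r, hr0, hrT⟩ := EReal.lt_iff_exists_real_btwn.1 hT
  have hr : (0 : ℝ) < r := by exact_mod_cast hr0
  have hsub : Set.Ioo 0 r ⊆ timeInterval T := fun t ht =>
    ⟨ht.1.le, lt_trans (by exact_mod_cast ht.2) hrT⟩
  refine uniqueDiffOn_convex (convex_timeInterval T) ⟨r / 2, interior_mono hsub ?_⟩
  rw [interior_Ioo]
  exact ⟨by linarith, by linarith⟩

/-! ### Uniformly bounded families -/

section Families

variable {Ω : Type*}

/-- A bounded family of numbers. -/
def UnifBdd (c : Ω → ℝ) : Prop := ∃ K : ℝ, ∀ ω, |c ω| ≤ K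

namespace UnifBdd

variable {c d : Ω → ℝ}

theorem const (a : ℝ) : UnifBdd fun _ : Ω => a := ⟨|a|, fun _ => le_rfl⟩

theorem add (hc : UnifBdd c) (hd : UnifBdd d) : UnifBdd fun ω => c ω + d ω := by
  obtain ⟨K, hK⟩ := hc
  obtain ⟨L, hL⟩ := hd
  exact ⟨K + L, fun ω => (abs_add_le _ _).trans (add_le_add (hK ω) (hL ω))⟩

theorem mul (hc : UnifBdd c) (hd : UnifBdd d) : UnifBdd fun ω => c ω * d ω := by
  obtain ⟨K, hK⟩ := hc
  obtain ⟨L, hL⟩ := hd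
  refine ⟨K * L, fun ω => ?_⟩
  rw [abs_mul]
  exact mul_le_mul (hK ω) (hL ω) (abs_nonneg _) ((abs_nonneg _).trans (hK ω))

theorem neg (hc : UnifBdd c) : UnifBdd fun ω => -c ω := by
  obtain ⟨K, hK⟩ := hc
  exact ⟨K, fun ω => (abs_neg _).trans_le (hK ω)⟩

theorem sub (hc : UnifBdd c) (hd : UnifBdd d) : UnifBdd fun ω => c ω - d ω := by
  simpa only [sub_eq_add_neg] using hc.add hd.neg

theorem pow (hc : UnifBdd c) (n : ℕ) : UnifBdd fun ω => c ω ^ n := by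
  obtain ⟨K, hK⟩ := hc
  refine ⟨K ^ n, fun ω => ?_⟩
  rw [abs_pow]
  exact pow_le_pow_left₀ (abs_nonneg _) (hK ω) n

theorem div {a : ℝ} (ha : 0 < a) (hc : UnifBdd c) (hd : ∀ ω, a ≤ d ω) :
    UnifBdd fun ω => c ω / d ω := by
  obtain ⟨K, hK⟩ := hc
  refine ⟨K / a, fun ω => ?_⟩
  rw [abs_div, abs_of_pos (ha.trans_le (hd ω))]
  exact div_le_div₀ ((abs_nonneg _).trans (hK ω)) (hK ω) ha (hd ω)

end UnifBdd

/-- A family of functions of time and space, the member of index `ω` living on the time interval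
`[0, T ω)`, that is continuous in space and bounded in `L^∞([0, T ω); H^σ)` uniformly in `ω`. -/
def UnifH (T : Ω → EReal) (σ : ℝ) (F : Ω → ℝ → ℝ → ℝ) : Prop :=
  ∃ K : ℝ≥0∞, K < ⊤ ∧ ∀ ω, ∀ t ∈ timeInterval (T ω), Continuous (F ω t) ∧ sobolevENorm σ (F ω t) ≤ K

namespace UnifH

variable {T : Ω → EReal} {σ τ : ℝ} {F G : Ω → ℝ → ℝ → ℝ} {c : Ω → ℝ}

theorem continuous (hF : UnifH T σ F) {ω : Ω} {t : ℝ} (ht : t ∈ timeInterval (T ω)) :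
    Continuous (F ω t) := by
  obtain ⟨K, -, h⟩ := hF
  exact (h ω t ht).1

theorem lt_top (hF : UnifH T σ F) {ω : Ω} {t : ℝ} (ht : t ∈ timeInterval (T ω)) :
    sobolevENorm σ (F ω t) < ⊤ := by
  obtain ⟨K, hK, h⟩ := hF
  exact (h ω t ht).2.trans_lt hK

theorem memLp (hF : UnifH T σ F) {ω : Ω} {t : ℝ} (ht : t ∈ timeInterval (T ω)) :
    MemLp (fun x => (F ω t x : ℂ)) 2 :=
  memLp_of_sobolevENorm_lt_top (hF.lt_top ht)

theorem congr (hF : UnifH T σ F) (h : ∀ ω, ∀ t ∈ timeInterval (T ω), ∀ x, G ω t x = F ω t x) :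
    UnifH T σ G := by
  obtain ⟨K, hK, hF⟩ := hF
  refine ⟨K, hK, fun ω t ht => ?_⟩
  rw [show G ω t = F ω t from funext (h ω t ht)]
  exact hF ω t ht

theorem mono (h : σ ≤ τ) (hF : UnifH T τ F) : UnifH T σ F := by
  obtain ⟨K, hK, hF⟩ := hF
  exact ⟨K, hK, fun ω t ht => ⟨(hF ω t ht).1, (sobolevENorm_mono h _).trans (hF ω t ht).2⟩⟩

theorem add (hF : UnifH T σ F) (hG : UnifH T σ G) : UnifH T σ fun ω t x => F ω t x + G ω t x := by
  obtain ⟨K, hK, hF⟩ := hF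
  obtain ⟨L, hL, hG⟩ := hG
  exact ⟨K + L, ENNReal.add_lt_top.2 ⟨hK, hL⟩, fun ω t ht => ⟨(hF ω t ht).1.add (hG ω t ht).1,
    (sobolevENorm_add_le σ _ _).trans (add_le_add (hF ω t ht).2 (hG ω t ht).2)⟩⟩

theorem const_mul (hc : UnifBdd c) (hF : UnifH T σ F) : UnifH T σ fun ω t x => c ω * F ω t x := by
  obtain ⟨K, hK, hF⟩ := hF
  obtain ⟨L, hL⟩ := hc
  refine ⟨ENNReal.ofReal L * K, ENNReal.mul_lt_top ENNReal.ofReal_lt_top hK,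
    fun ω t ht => ⟨(hF ω t ht).1.const_mul _, (sobolevENorm_const_mul_le σ _ _).trans ?_⟩⟩
  rw [Real.enorm_eq_ofReal_abs]
  exact mul_le_mul' (ENNReal.ofReal_le_ofReal (hL ω)) (hF ω t ht).2

theorem neg (hF : UnifH T σ F) : UnifH T σ fun ω t x => -F ω t x := by
  simpa using hF.const_mul (UnifBdd.const (-1))

theorem sub (hF : UnifH T σ F) (hG : UnifH T σ G) : UnifH T σ fun ω t x => F ω t x - G ω t x := by
  simpa only [sub_eq_add_neg] using hF.add hG.neg

theorem mul (hσ : 1 / 2 < σ) (hF : UnifH T σ F) (hG : UnifH T σ G) :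
    UnifH T σ fun ω t x => F ω t x * G ω t x := by
  have hsq : ∀ {ω t}, t ∈ timeInterval (T ω) → _ := fun {ω t} ht => sobolevENorm_mul_sq_le hσ
    (hF.continuous ht) (hG.continuous ht) (hF.lt_top ht) (hG.lt_top ht)
  obtain ⟨K, hK, hF⟩ := hF
  obtain ⟨L, hL, hG⟩ := hG
  refine ⟨(sobolevProductConstSq σ * (K ^ 2 * L ^ 2)) ^ (2⁻¹ : ℝ),
    (ENNReal.rpow_lt_top_of_nonneg (by norm_num)
      (ENNReal.mul_lt_top (sobolevProductConstSq_lt_top hσ)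
        (ENNReal.mul_lt_top (ENNReal.pow_lt_top hK) (ENNReal.pow_lt_top hL))).ne),
    fun ω t ht => ⟨(hF ω t ht).1.mul (hG ω t ht).1, ?_⟩⟩
  rw [ENNReal.le_rpow_inv_iff two_pos, ENNReal.rpow_two]
  refine (hsq ht).trans ?_
  gcongr
  exacts [(hF ω t ht).2, (hG ω t ht).2]

theorem differentiable (hσ : 1 / 2 < σ) (hF : UnifH T (σ + 1) F) {ω : Ω} {t : ℝ}
    (ht : t ∈ timeInterval (T ω)) : Differentiable ℝ (F ω t) :=
  differentiable_of_sobolevENorm hσ (hF.continuous ht) (hF.lt_top ht)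

protected theorem deriv (hσ : 1 / 2 < σ) (hF : UnifH T (σ + 1) F) :
    UnifH T σ fun ω t x => deriv (F ω t) x := by
  have hcont : ∀ {ω t}, t ∈ timeInterval (T ω) → Continuous (deriv (F ω t)) := fun ht =>
    continuous_deriv_of_sobolevENorm hσ (hF.continuous ht) (hF.lt_top ht)
  obtain ⟨K, hK, hF⟩ := hF
  exact ⟨K, hK, fun ω t ht =>
    ⟨hcont ht, (sobolevENorm_deriv_le hσ (hF ω t ht).1).trans (hF ω t ht).2⟩⟩

theorem of_hasDerivAt (hF : UnifH T σ F) (hG : UnifH T σ G)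
    (hd : ∀ ω, ∀ t ∈ timeInterval (T ω), ∀ x, HasDerivAt (F ω t) (G ω t x) x) :
    UnifH T (σ + 1) F := by
  have hle : ∀ {ω t}, t ∈ timeInterval (T ω) → _ := fun {ω t} ht =>
    sobolevENorm_add_one_le σ (hF.memLp ht) (hG.memLp ht) (hd ω t ht)
  obtain ⟨K, hK, hF⟩ := hF
  obtain ⟨L, hL, hG⟩ := hG
  exact ⟨K + L, ENNReal.add_lt_top.2 ⟨hK, hL⟩, fun ω t ht =>
    ⟨(hF ω t ht).1, (hle ht).trans (add_le_add (hF ω t ht).2 (hG ω t ht).2)⟩⟩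

theorem of_abs_le {a : ℝ} (hF : UnifH T 0 F)
    (hG : ∀ ω, ∀ t ∈ timeInterval (T ω), Continuous (G ω t))
    (h : ∀ ω, ∀ t ∈ timeInterval (T ω), ∀ x, |G ω t x| ≤ a * |F ω t x|) : UnifH T 0 G := by
  have hF₂ : ∀ {ω t}, t ∈ timeInterval (T ω) → _ := fun {ω t} ht => hF.memLp (ω := ω) (t := t) ht
  obtain ⟨K, hK, hF⟩ := hF
  refine ⟨ENNReal.ofReal a * K, ENNReal.mul_lt_top ENNReal.ofReal_lt_top hK,
    fun ω t ht => ⟨hG ω t ht, ?_⟩⟩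
  have hle : ∀ x, ‖((G ω t x : ℝ) : ℂ)‖ ≤ a * ‖((F ω t x : ℝ) : ℂ)‖ := by
    simpa only [Complex.norm_real, Real.norm_eq_abs] using h ω t ht
  have hG₂ : MemLp (fun x => (G ω t x : ℂ)) 2 volume :=
    (hF₂ ht).of_le_mul (Complex.continuous_ofReal.comp (hG ω t ht)).aestronglyMeasurable
      (Eventually.of_forall hle)
  calc sobolevENorm 0 (G ω t) = eLpNorm (fun x => (G ω t x : ℂ)) 2 volume :=
        sobolevENorm_order_zero hG₂
    _ ≤ ENNReal.ofReal a * eLpNorm (fun x => (F ω t x : ℂ)) 2 volume :=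
        eLpNorm_le_mul_eLpNorm_of_ae_le_mul (Eventually.of_forall hle) 2
    _ ≤ ENNReal.ofReal a * K := by
        rw [← sobolevENorm_order_zero (hF₂ ht)]
        gcongr
        exact (hF ω t ht).2

theorem of_bootstrap (hσ : 3 / 2 < σ) (hF : UnifH T 1 F)
    (hstep : ∀ r, 1 / 2 < r → r ≤ σ - 1 → UnifH T r F → UnifH T (r + 1) F) : UnifH T σ F := by
  have hnat (n : ℕ) (hn : (n : ℝ) + 1 ≤ σ) : UnifH T ((n : ℝ) + 1) F := by
    induction n with
    | zero => simpa using hF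
    | succ n ih =>
      push_cast at hn ⊢
      exact hstep _ (by linarith [n.cast_nonneg (α := ℝ)]) (by linarith) (ih (by linarith))
  have hfloor := Nat.floor_le (show 0 ≤ σ - 1 by linarith)
  have hlt := Nat.lt_floor_add_one (σ - 1)
  simpa using hstep (σ - 1) (by linarith) le_rfl ((hnat ⌊σ - 1⌋₊ (by linarith)).mono hlt.le)

end UnifH

theorem hasDerivWithinAt_div_one_sub {f : ℝ → ℝ} {f' c x : ℝ} {s : Set ℝ}
    (hf : HasDerivWithinAt f f' s x) (h : 1 - c * f x ≠ 0) :
    HasDerivWithinAt (fun y => f y / (1 - c * f y)) (f' / (1 - c * f x) ^ 2) s x := by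
  convert! hf.div ((hf.const_mul c).const_sub 1) h using 1
  ring

theorem div_one_sub_sq {f f' c : ℝ} (h : 1 - c * f ≠ 0) :
    f' / (1 - c * f) ^ 2 = f' + 2 * c * (f' * (f / (1 - c * f)))
      + c ^ 2 * (f' * (f / (1 - c * f) * (f / (1 - c * f)))) := by
  field_simp
  ring

namespace UnifH

variable {T : Ω → EReal} {σ τ : ℝ} {F G : Ω → ℝ → ℝ → ℝ} {c : Ω → ℝ} {a : ℝ}

theorem div_one_sub_sq (hσ : 1 / 2 < σ) (hc : UnifBdd c)
    (h : ∀ ω, ∀ t ∈ timeInterval (T ω), ∀ x, 1 - c ω * F ω t x ≠ 0) (hG : UnifH T σ G)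
    (hY : UnifH T σ fun ω t x => F ω t x / (1 - c ω * F ω t x)) :
    UnifH T σ fun ω t x => G ω t x / (1 - c ω * F ω t x) ^ 2 :=
  ((hG.add ((hG.mul hσ hY).const_mul ((UnifBdd.const 2).mul hc))).add
    ((hG.mul hσ (hY.mul hσ hY)).const_mul (hc.pow 2))).congr fun ω t ht x =>
      _root_.div_one_sub_sq (h ω t ht x)

theorem div_pow_of_le {n : ℕ} (ha : 0 < a) (hF : UnifH T 0 F)
    (hG : ∀ ω, ∀ t ∈ timeInterval (T ω), Continuous (G ω t))
    (h : ∀ ω, ∀ t ∈ timeInterval (T ω), ∀ x, a ≤ G ω t x) :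
    UnifH T 0 fun ω t x => F ω t x / G ω t x ^ n := by
  have hpos {ω t} (ht : t ∈ timeInterval (T ω)) (x : ℝ) : 0 < G ω t x := ha.trans_le (h ω t ht x)
  refine hF.of_abs_le (a := (a ^ n)⁻¹)
    (fun ω t ht => (hF.continuous ht).div ((hG ω t ht).pow n) fun x => (pow_pos (hpos ht x) n).ne')
    fun ω t ht x => ?_
  rw [abs_div, abs_of_pos (pow_pos (hpos ht x) n), ← div_eq_inv_mul]
  exact div_le_div_of_nonneg_left (abs_nonneg _) (pow_pos ha n)
    (pow_le_pow_left₀ ha.le (h ω t ht x) n)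

theorem div_one_sub (ha : 0 < a) (hσ : 3 / 2 < σ) (hc : UnifBdd c) (hF : UnifH T σ F)
    (h : ∀ ω, ∀ t ∈ timeInterval (T ω), ∀ x, a ≤ 1 - c ω * F ω t x) :
    UnifH T σ fun ω t x => F ω t x / (1 - c ω * F ω t x) := by
  have hne : ∀ ω, ∀ t ∈ timeInterval (T ω), ∀ x, 1 - c ω * F ω t x ≠ 0 :=
    fun ω t ht x => (ha.trans_le (h ω t ht x)).ne'
  have hF₁ : UnifH T (σ - 1 + 1) F := by rwa [sub_add_cancel]
  have hF' : UnifH T (σ - 1) fun ω t x => deriv (F ω t) x := hF₁.deriv (by linarith)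
  have hcont : ∀ ω, ∀ t ∈ timeInterval (T ω), Continuous fun x => 1 - c ω * F ω t x :=
    fun ω t ht => continuous_const.sub ((hF.continuous ht).const_mul _)
  have hderiv : ∀ ω, ∀ t ∈ timeInterval (T ω), ∀ x, HasDerivAt
      (fun x => F ω t x / (1 - c ω * F ω t x)) (deriv (F ω t) x / (1 - c ω * F ω t x) ^ 2) x :=
    fun ω t ht x => by
      rw [← hasDerivWithinAt_univ]
      exact hasDerivWithinAt_div_one_sub
        (hF₁.differentiable (by linarith) ht x).hasDerivAt.hasDerivWithinAt (hne ω t ht x)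
  refine of_bootstrap hσ ?_ fun r hr hrσ hY =>
    hY.of_hasDerivAt (UnifH.div_one_sub_sq hr hc hne (hF'.mono hrσ) hY) hderiv
  have h₀ : UnifH T 0 fun ω t x => F ω t x / (1 - c ω * F ω t x) := by
    simpa only [pow_one] using (hF.mono (by linarith)).div_pow_of_le (n := 1) ha hcont h
  simpa only [zero_add] using
    h₀.of_hasDerivAt ((hF'.mono (by linarith)).div_pow_of_le ha hcont h) hderiv

end UnifH

/-! ### Families differentiable in time -/

/-- A family bounded in `L^∞([0,T); H^σ)` whose time derivative exists pointwise and is bounded in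
`L^∞([0,T); H^τ)`. -/
structure UnifC1 (T : Ω → EReal) (σ τ : ℝ) (F : Ω → ℝ → ℝ → ℝ) : Prop where
  unifH : UnifH T σ F
  unifH_dt : UnifH T τ fun ω => dt (T ω) (F ω)
  differentiableWithinAt : ∀ ω, ∀ t ∈ timeInterval (T ω), ∀ x,
    DifferentiableWithinAt ℝ (fun r => F ω r x) (timeInterval (T ω)) t

theorem dt_eq {T : EReal} (hT : 0 < T) {u : ℝ → ℝ → ℝ} {t x a : ℝ} (ht : t ∈ timeInterval T)
    (h : HasDerivWithinAt (fun r => u r x) a (timeInterval T) t) : dt T u t x = a :=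
  h.derivWithin (uniqueDiffOn_timeInterval hT t ht)

namespace UnifC1

variable {T : Ω → EReal} {σ τ : ℝ} {F G : Ω → ℝ → ℝ → ℝ} {c : Ω → ℝ}

theorem hasDerivWithinAt (hF : UnifC1 T σ τ F) {ω : Ω} {t : ℝ} (ht : t ∈ timeInterval (T ω))
    (x : ℝ) : HasDerivWithinAt (fun r => F ω r x) (dt (T ω) (F ω) t x) (timeInterval (T ω)) t :=
  (hF.differentiableWithinAt ω t ht x).hasDerivWithinAt

theorem of_hasDerivWithinAt (hT : ∀ ω, 0 < T ω) (hF : UnifH T σ F) (hG : UnifH T τ G)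
    (h : ∀ ω, ∀ t ∈ timeInterval (T ω), ∀ x,
      HasDerivWithinAt (fun r => F ω r x) (G ω t x) (timeInterval (T ω)) t) : UnifC1 T σ τ F :=
  ⟨hF, hG.congr fun ω t ht x => dt_eq (hT ω) ht (h ω t ht x),
    fun ω t ht x => (h ω t ht x).differentiableWithinAt⟩

theorem mono {σ' τ' : ℝ} (hσ : σ' ≤ σ) (hτ : τ' ≤ τ) (hF : UnifC1 T σ τ F) : UnifC1 T σ' τ' F :=
  ⟨hF.1.mono hσ, hF.2.mono hτ, hF.3⟩

theorem add (hT : ∀ ω, 0 < T ω) (hF : UnifC1 T σ τ F) (hG : UnifC1 T σ τ G) :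
    UnifC1 T σ τ fun ω t x => F ω t x + G ω t x :=
  of_hasDerivWithinAt hT (hF.1.add hG.1) (hF.2.add hG.2) fun _ _ ht x =>
    (hF.hasDerivWithinAt ht x).add (hG.hasDerivWithinAt ht x)

theorem sub (hT : ∀ ω, 0 < T ω) (hF : UnifC1 T σ τ F) (hG : UnifC1 T σ τ G) :
    UnifC1 T σ τ fun ω t x => F ω t x - G ω t x :=
  of_hasDerivWithinAt hT (hF.1.sub hG.1) (hF.2.sub hG.2) fun _ _ ht x =>
    (hF.hasDerivWithinAt ht x).sub (hG.hasDerivWithinAt ht x)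

theorem const_mul (hT : ∀ ω, 0 < T ω) (hc : UnifBdd c) (hF : UnifC1 T σ τ F) :
    UnifC1 T σ τ fun ω t x => c ω * F ω t x :=
  of_hasDerivWithinAt hT (hF.1.const_mul hc) (hF.2.const_mul hc) fun ω _ ht x =>
    (hF.hasDerivWithinAt ht x).const_mul (c ω)

theorem mul (hT : ∀ ω, 0 < T ω) (hτ : 1 / 2 < τ) (hτσ : τ ≤ σ) (hF : UnifC1 T σ τ F)
    (hG : UnifC1 T σ τ G) : UnifC1 T σ τ fun ω t x => F ω t x * G ω t x :=
  of_hasDerivWithinAt hT (hF.1.mul (hτ.trans_le hτσ) hG.1)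
    ((hF.2.mul hτ (hG.1.mono hτσ)).add ((hF.1.mono hτσ).mul hτ hG.2)) fun _ _ ht x =>
    (hF.hasDerivWithinAt ht x).mul (hG.hasDerivWithinAt ht x)

theorem hasDerivWithinAt_deriv (hσ : 1 / 2 < σ) (hτ : 1 / 2 < τ) (hF : UnifC1 T (σ + 1) (τ + 1) F)
    {ω : Ω} {t : ℝ} (ht : t ∈ timeInterval (T ω)) (x : ℝ) :
    HasDerivWithinAt (fun r => deriv (F ω r) x) (deriv (dt (T ω) (F ω) t) x)
      (timeInterval (T ω)) t := by
  refine _root_.hasDerivWithinAt_deriv (convex_timeInterval _)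
    (fun t ht => hF.1.differentiable hσ ht) (fun t ht => hF.2.differentiable hτ ht)
    (fun t ht x => hF.hasDerivWithinAt ht x) (fun x e he => ?_) ht x
  obtain ⟨K, hK, h⟩ := hF.2.deriv hτ
  obtain ⟨d, hd, hd'⟩ := equicontinuous_of_sobolevENorm hτ hK he
  exact ⟨d, hd, fun t ht y hy => hd' _ (h ω t ht).1 (h ω t ht).2 y x hy⟩

protected theorem deriv (hT : ∀ ω, 0 < T ω) (hσ : 1 / 2 < σ) (hτ : 1 / 2 < τ)
    (hF : UnifC1 T (σ + 1) (τ + 1) F) : UnifC1 T σ τ fun ω t x => deriv (F ω t) x :=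
  of_hasDerivWithinAt hT (hF.1.deriv hσ) (hF.2.deriv hτ) fun _ _ ht x =>
    hF.hasDerivWithinAt_deriv hσ hτ ht x

theorem div_one_sub {a : ℝ} (ha : 0 < a) (hT : ∀ ω, 0 < T ω) (hτ : 1 / 2 < τ)
    (hσ : 3 / 2 < σ) (hτσ : τ ≤ σ) (hc : UnifBdd c) (hF : UnifC1 T σ τ F)
    (h : ∀ ω, ∀ t ∈ timeInterval (T ω), ∀ x, a ≤ 1 - c ω * F ω t x) :
    UnifC1 T σ τ fun ω t x => F ω t x / (1 - c ω * F ω t x) := by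
  have hne : ∀ ω, ∀ t ∈ timeInterval (T ω), ∀ x, 1 - c ω * F ω t x ≠ 0 :=
    fun ω t ht x => (ha.trans_le (h ω t ht x)).ne'
  have hY := hF.1.div_one_sub ha hσ hc h
  exact of_hasDerivWithinAt hT hY (UnifH.div_one_sub_sq hτ hc hne hF.2 (hY.mono hτσ))
    fun ω t ht x => hasDerivWithinAt_div_one_sub (hF.hasDerivWithinAt ht x) (hne ω t ht x)

end UnifC1

end Families

/-! ### Expansion of the Green–Naghdi operators -/

section LayerVelocities

/-- The velocity `h₁ V / (h₁ + γ h₂)` of the lower layer. -/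
def lowerVelocity (γ : ℝ) (h₁ h₂ V : ℝ → ℝ) : ℝ → ℝ := fun x => h₁ x * V x / (h₁ x + γ * h₂ x)

/-- The velocity `h₂ V / (h₁ + γ h₂)` of the upper layer, up to sign. -/
def upperVelocity (γ : ℝ) (h₁ h₂ V : ℝ → ℝ) : ℝ → ℝ := fun x => h₂ x * V x / (h₁ x + γ * h₂ x)

variable {γ : ℝ} {h₁ h₂ V : ℝ → ℝ} {x : ℝ}

theorem deriv_pow_three_mul_deriv {f g : ℝ → ℝ} (hf : DifferentiableAt ℝ f x)
    (hg : DifferentiableAt ℝ (deriv g) x) :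
    deriv (fun y => f y ^ 3 * deriv g y) x
      = 3 * f x ^ 2 * deriv f x * deriv g x + f x ^ 3 * deriv (deriv g) x := by
  rw [deriv_fun_mul (by fun_prop) hg, deriv_fun_pow hf]
  norm_num

theorem lowerTerm_eq (hd : DifferentiableAt ℝ h₂ x)
    (hl : DifferentiableAt ℝ (deriv (lowerVelocity γ h₁ h₂ V)) x) :
    lowerTerm γ h₁ h₂ V x = 3 * h₂ x ^ 2 * deriv h₂ x * deriv (lowerVelocity γ h₁ h₂ V) x
      + h₂ x ^ 3 * deriv (deriv (lowerVelocity γ h₁ h₂ V)) x :=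
  deriv_pow_three_mul_deriv hd hl

theorem upperTerm_eq (hd : DifferentiableAt ℝ h₁ x)
    (hu : DifferentiableAt ℝ (deriv (upperVelocity γ h₁ h₂ V)) x) :
    upperTerm γ h₁ h₂ V x = 3 * h₁ x ^ 2 * deriv h₁ x * deriv (upperVelocity γ h₁ h₂ V) x
      + h₁ x ^ 3 * deriv (deriv (upperVelocity γ h₁ h₂ V)) x :=
  deriv_pow_three_mul_deriv hd hu

theorem opQ_eq_layerVelocities (hd₁ : DifferentiableAt ℝ h₁ x) (hd₂ : DifferentiableAt ℝ h₂ x)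
    (hl : DifferentiableAt ℝ (deriv (lowerVelocity γ h₁ h₂ V)) x)
    (hu : DifferentiableAt ℝ (deriv (upperVelocity γ h₁ h₂ V)) x)
    (hne₁ : h₁ x ≠ 0) (hne₂ : h₂ x ≠ 0) :
    opQ γ h₁ h₂ V x = -1 / 3 *
      (3 * h₂ x * deriv h₂ x * deriv (lowerVelocity γ h₁ h₂ V) x
        + h₂ x ^ 2 * deriv (deriv (lowerVelocity γ h₁ h₂ V)) x
        + γ * (3 * h₁ x * deriv h₁ x * deriv (upperVelocity γ h₁ h₂ V) x
          + h₁ x ^ 2 * deriv (deriv (upperVelocity γ h₁ h₂ V)) x)) := by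
  rw [opQ, lowerTerm_eq hd₂ hl, upperTerm_eq hd₁ hu]
  field_simp

theorem opR_eq_layerVelocities (hd₁ : DifferentiableAt ℝ h₁ x) (hd₂ : DifferentiableAt ℝ h₂ x)
    (hl : DifferentiableAt ℝ (deriv (lowerVelocity γ h₁ h₂ V)) x)
    (hu : DifferentiableAt ℝ (deriv (upperVelocity γ h₁ h₂ V)) x) :
    opR γ h₁ h₂ V x =
      1 / 2 * ((h₂ x * deriv (lowerVelocity γ h₁ h₂ V) x) ^ 2
        - γ * (h₁ x * deriv (upperVelocity γ h₁ h₂ V) x) ^ 2)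
      + 1 / 3 * (V x / (h₁ x + γ * h₂ x)) *
        (h₁ x * (3 * h₂ x * deriv h₂ x * deriv (lowerVelocity γ h₁ h₂ V) x
          + h₂ x ^ 2 * deriv (deriv (lowerVelocity γ h₁ h₂ V)) x)
        - γ * h₂ x * (3 * h₁ x * deriv h₁ x * deriv (upperVelocity γ h₁ h₂ V) x
          + h₁ x ^ 2 * deriv (deriv (upperVelocity γ h₁ h₂ V)) x)) := by
  rw [opR, lowerTerm_eq hd₂ hl, upperTerm_eq hd₁ hu]
  unfold lowerVelocity upperVelocity
  field_simp

end LayerVelocities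

namespace Param

/-- The coefficient of the expansion parameter in `h₁ + γ h₂ = (γ + δ) / δ (1 - q ε ζ)`. -/
def q (p : Param) : ℝ := (1 - p.γ) * p.δ / (p.γ + p.δ)

/-- The coefficient of `ε ζ w` in the Taylor expansion of the mass flux. -/
def c₁ (p : Param) : ℝ := p.δ - 1 + p.q

/-- The coefficient of `ε² ζ² w` in the Taylor expansion of the mass flux. -/
def c₂ (p : Param) : ℝ := (p.q + p.δ) * (p.q - 1)

variable {p : Param}

theorem α₁_eq (h : p.γ + p.δ ≠ 0) : p.α₁ = 3 / 2 * p.c₁ := by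
  unfold α₁ c₁ q
  field_simp
  ring

theorem α₂_eq (h : p.γ + p.δ ≠ 0) : p.α₂ = 3 * p.c₂ := by
  unfold α₂ c₂ q
  field_simp
  ring

theorem α₃_eq (h : p.γ + p.δ ≠ 0) : p.α₃ = 5 * (p.q * p.c₂) := by
  unfold α₃ c₂ q
  field_simp
  ring

theorem ν_eq (hδ : p.δ ≠ 0) (h : p.γ + p.δ ≠ 0) : (p.γ + p.δ) * p.ν = (1 / p.δ + p.γ) / 6 := by
  rw [ν, add_comm p.δ]
  field_simp

theorem κ₁_sub_κ₂_eq (hδ : p.δ ≠ 0) (h : p.γ + p.δ ≠ 0) :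
    (p.γ + p.δ) * (p.κ₁ - p.κ₂) = 1 / 3 * ((p.q - 1) / p.δ + p.γ * (p.q + p.δ)) := by
  unfold κ₁ κ₂ q
  field_simp
  ring

theorem κ₂_eq (h : p.γ + p.δ ≠ 0) : (p.γ + p.δ) * p.κ₂ = (1 - p.γ) / 3 := by
  unfold κ₂
  field_simp

theorem κ₃_eq (h : p.γ + p.δ ≠ 0) : (p.γ + p.δ) * p.κ₃ = (p.γ - 1) / 2 := by
  unfold κ₃
  field_simp

end Param

section Expansions

/-- `P = ζ w / (1 - q ε ζ)`, the only nonpolynomial ingredient of the Green–Naghdi operators at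
`v = (γ + δ) w`. -/
def profile (p : Param) (Z W : ℝ → ℝ) : ℝ → ℝ := fun x => Z x / (1 - p.q * p.ε * Z x) * W x

/-- Taylor polynomial in `ε` of the mass flux. -/
def massPoly (p : Param) (Z W : ℝ → ℝ) : ℝ → ℝ := fun x =>
  W x + p.ε * (p.c₁ * (Z x * W x)) + p.ε ^ 2 * (p.c₂ * (Z x * (Z x * W x)))
    + p.ε ^ 3 * (p.q * p.c₂ * (Z x * (Z x * (Z x * W x))))

/-- The coefficient of `ε⁴` in the remainder of the mass flux. -/
def massRemainder (p : Param) (Z W : ℝ → ℝ) : ℝ → ℝ := fun x =>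
  p.q * p.q * p.c₂ * (Z x * (Z x * (Z x * profile p Z W x)))

/-- Taylor polynomial in `ε` of the velocity flux, divided by `γ + δ`. -/
def velocityPoly (p : Param) (Z W : ℝ → ℝ) : ℝ → ℝ := fun x =>
  p.ε * (p.c₁ / 2 * (W x * W x)) + p.ε ^ 2 * (p.c₂ * (Z x * (W x * W x)))
    + p.ε ^ 3 * (3 / 2 * (p.q * p.c₂) * (Z x * (Z x * (W x * W x))))

/-- The coefficient of `ε⁴` in the remainder of the velocity flux, divided by `γ + δ`. -/
def velocityRemainder (p : Param) (Z W : ℝ → ℝ) : ℝ → ℝ := fun x =>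
  1 / 2 * (p.q * p.q * p.c₂) * (4 * (Z x * (Z x * (profile p Z W x * W x)))
    + p.q * p.ε * (Z x * (Z x * (profile p Z W x * profile p Z W x))))

/-- The bracket `2 B(u_l,u_r)` in the variables `ζ = u_l + u_r`, `w = u_l - u_r`. -/
def bracketForm (p : Param) (Z W : ℝ → ℝ) : ℝ → ℝ := fun x =>
  (p.κ₁ + p.κ₂) * (Z x * deriv (deriv W) x) + (p.κ₁ - p.κ₂) * (W x * deriv (deriv Z) x)
    + (2 * p.κ₁ + p.κ₂) * (deriv Z x * deriv W x)

/-- The coefficient of `ε²` in the remainder of `𝒬̄`. -/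
def opQRemainder (p : Param) (Z W : ℝ → ℝ) : ℝ → ℝ := fun x =>
  -1 / 3 * (3 * (p.δ * (Z x * (deriv Z x * deriv W x))
      + (p.q - 1) * (deriv Z x * deriv (profile p Z W) x)
      + p.ε * p.δ * (p.q - 1) * (Z x * (deriv Z x * deriv (profile p Z W) x)))
    + (p.δ * (Z x * (Z x * deriv (deriv W) x))
      + 2 * (p.q - 1) * (Z x * deriv (deriv (profile p Z W)) x)
      + p.ε * p.δ * (p.q - 1) * (Z x * (Z x * deriv (deriv (profile p Z W)) x)))
    - 3 * p.γ * ((p.q + p.δ) * (deriv Z x * deriv (profile p Z W) x)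
      - Z x * (deriv Z x * deriv W x)
      - p.ε * (p.q + p.δ) * (Z x * (deriv Z x * deriv (profile p Z W) x)))
    + p.γ * (Z x * (Z x * deriv (deriv W) x)
      - 2 * (p.q + p.δ) * (Z x * deriv (deriv (profile p Z W)) x)
      + p.ε * (p.q + p.δ) * (Z x * (Z x * deriv (deriv (profile p Z W)) x)))
    + ((p.q - 1) / p.δ + p.γ * (p.q + p.δ)) * p.q *
      (deriv (deriv Z) x * profile p Z W x + 2 * (deriv Z x * deriv (profile p Z W) x)
        + Z x * deriv (deriv (profile p Z W)) x))

/-- The leading part of `ℛ̄`, divided by `1 - γ`. -/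
def quadraticPoly (W : ℝ → ℝ) : ℝ → ℝ := fun x =>
  1 / 3 * (W x * deriv (deriv W) x) + 1 / 2 * (deriv W x * deriv W x)

/-- The remainder `E` in `h₂ δ (a + ε (q - 1) b) = a + ε E`, where `Z`, `a`, `b` are the values of
`ζ` and of derivatives of the same order of `w` and `P`. -/
def lowerRemainder (p : Param) (Z a b : ℝ) : ℝ :=
  p.δ * (Z * a) + (p.q - 1) * b + p.ε * p.δ * (p.q - 1) * (Z * b)

/-- The remainder `E` in `h₁ (a + ε (q + δ) b) = a + ε E`, where `Z`, `a`, `b` are the values of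
`ζ` and of derivatives of the same order of `w` and `P`. -/
def upperRemainder (p : Param) (Z a b : ℝ) : ℝ :=
  (p.q + p.δ) * b - Z * a - p.ε * (p.q + p.δ) * (Z * b)

/-- The remainder `F` in `h₁ δ h₂ (a + ε E) = a + ε F`, where `Z` is the value of `ζ`. -/
def productRemainder (p : Param) (Z a E : ℝ) : ℝ :=
  E + (p.δ - 1) * (Z * a) - p.ε * p.δ * (Z * (Z * a))
    + p.ε * ((p.δ - 1) * (Z * E)) - p.ε * (p.ε * p.δ) * (Z * (Z * E))

/-- The coefficient of `ε` in the remainder of `ℛ̄`, as a function of the derivatives of orders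
`0`, `1`, `2` of `ζ`, `w` and `P`. -/
def opRRemainderJet (p : Param) (z z₁ w w₁ w₂ P P₁ P₂ : ℝ) : ℝ :=
  1 / 2 * (2 * (w₁ * lowerRemainder p z w₁ P₁)
      + p.ε * (lowerRemainder p z w₁ P₁ * lowerRemainder p z w₁ P₁)
      - p.γ * (2 * (w₁ * upperRemainder p z w₁ P₁)
        + p.ε * (upperRemainder p z w₁ P₁ * upperRemainder p z w₁ P₁)))
    + 1 / 3 * (p.q * (1 - p.γ) * (P * w₂) + (w + p.ε * p.q * P) *
      ((3 * p.δ * (z₁ * (w₁ + p.ε * lowerRemainder p z w₁ P₁)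
          - p.ε * (z * (z₁ * (w₁ + p.ε * lowerRemainder p z w₁ P₁))))
          + productRemainder p z w₂ (lowerRemainder p z w₂ P₂))
        - p.γ * (-3 * (z₁ * (w₁ + p.ε * upperRemainder p z w₁ P₁)
          + p.δ * p.ε * (z * (z₁ * (w₁ + p.ε * upperRemainder p z w₁ P₁))))
          + productRemainder p z w₂ (upperRemainder p z w₂ P₂))))

/-- The coefficient of `ε` in the remainder of `ℛ̄`. -/
def opRRemainder (p : Param) (Z W : ℝ → ℝ) : ℝ → ℝ := fun x =>
  opRRemainderJet p (Z x) (deriv Z x) (W x) (deriv W x) (deriv (deriv W) x)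
    (profile p Z W x) (deriv (profile p Z W) x) (deriv (deriv (profile p Z W)) x)

variable {p : Param} {Z W : ℝ → ℝ} {x : ℝ}

theorem depth₁_add_depth₂_eq (hδ : p.δ ≠ 0) (h : p.γ + p.δ ≠ 0) (Z : ℝ → ℝ) (x : ℝ) :
    depth₁ p Z x + p.γ * depth₂ p Z x = (p.γ + p.δ) / p.δ * (1 - p.q * p.ε * Z x) := by
  unfold depth₁ depth₂ Param.q
  field_simp
  ring

theorem massFlux_eq (hδ : p.δ ≠ 0) (h : p.γ + p.δ ≠ 0) (hne : 1 - p.q * p.ε * Z x ≠ 0) :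
    massFlux p Z (fun y => (p.γ + p.δ) * W y) x
      = massPoly p Z W x + p.ε ^ 4 * massRemainder p Z W x := by
  unfold massFlux
  rw [depth₁_add_depth₂_eq hδ h]
  unfold massPoly massRemainder depth₁ depth₂ profile Param.c₁ Param.c₂
  generalize hD : 1 - p.q * p.ε * Z x = D at *
  field_simp
  rw [← hD]
  ring

theorem depth₁_sq_sub_depth₂_sq_eq (hδ : p.δ ≠ 0) (h : p.γ + p.δ ≠ 0) (Z : ℝ → ℝ) (x : ℝ) :
    p.δ ^ 2 * (depth₁ p Z x ^ 2 - p.γ * depth₂ p Z x ^ 2) = (p.γ + p.δ) *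
      ((1 - p.q * p.ε * Z x) ^ 2 * (p.c₁ + 2 * p.c₂ * (p.ε * Z x)
        + 3 * (p.q * p.c₂) * (p.ε * Z x) ^ 2)
        + p.q ^ 2 * p.c₂ * (4 * (p.ε * Z x) ^ 3 * (1 - p.q * p.ε * Z x)
          + p.q * (p.ε * Z x) ^ 4)) := by
  unfold depth₁ depth₂ Param.c₁ Param.c₂ Param.q
  field_simp
  ring

theorem velocityFlux_eq (hδ : p.δ ≠ 0) (h : p.γ + p.δ ≠ 0) (hne : 1 - p.q * p.ε * Z x ≠ 0) :
    p.ε / 2 * velocityFlux p Z (fun y => (p.γ + p.δ) * W y) x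
      = (p.γ + p.δ) * (velocityPoly p Z W x + p.ε ^ 4 * velocityRemainder p Z W x) := by
  have hflux : velocityFlux p Z (fun y => (p.γ + p.δ) * W y) x =
      p.δ ^ 2 * (depth₁ p Z x ^ 2 - p.γ * depth₂ p Z x ^ 2) * W x ^ 2 /
        (1 - p.q * p.ε * Z x) ^ 2 := by
    unfold velocityFlux
    rw [depth₁_add_depth₂_eq hδ h]
    field_simp
  rw [hflux, depth₁_sq_sub_depth₂_sq_eq hδ h]
  unfold velocityPoly velocityRemainder profile
  generalize 1 - p.q * p.ε * Z x = D at *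
  field_simp

theorem lowerVelocity_eq (hδ : p.δ ≠ 0) (h : p.γ + p.δ ≠ 0)
    (hne : ∀ x, 1 - p.q * p.ε * Z x ≠ 0) :
    lowerVelocity p.γ (depth₁ p Z) (depth₂ p Z) (fun y => (p.γ + p.δ) * W y)
      = fun x => p.δ * (W x + p.ε * (p.q - 1) * profile p Z W x) := by
  ext x
  rw [lowerVelocity, depth₁_add_depth₂_eq hδ h, depth₁, profile]
  have := hne x
  generalize hD : 1 - p.q * p.ε * Z x = D at *
  field_simp
  rw [← hD]
  ring

theorem upperVelocity_eq (hδ : p.δ ≠ 0) (h : p.γ + p.δ ≠ 0)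
    (hne : ∀ x, 1 - p.q * p.ε * Z x ≠ 0) :
    upperVelocity p.γ (depth₁ p Z) (depth₂ p Z) (fun y => (p.γ + p.δ) * W y)
      = fun x => W x + p.ε * (p.q + p.δ) * profile p Z W x := by
  ext x
  rw [upperVelocity, depth₁_add_depth₂_eq hδ h, depth₂, profile]
  have := hne x
  generalize hD : 1 - p.q * p.ε * Z x = D at *
  field_simp
  rw [← hD]
  ring

theorem velocity_div_depth_eq (hδ : p.δ ≠ 0) (h : p.γ + p.δ ≠ 0)
    (hne : 1 - p.q * p.ε * Z x ≠ 0) :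
    (p.γ + p.δ) * W x / (depth₁ p Z x + p.γ * depth₂ p Z x)
      = p.δ * (W x + p.ε * p.q * profile p Z W x) := by
  rw [depth₁_add_depth₂_eq hδ h, profile]
  generalize hD : 1 - p.q * p.ε * Z x = D at *
  field_simp
  rw [← hD]
  ring

theorem profile_eq (hne : 1 - p.q * p.ε * Z x ≠ 0) :
    profile p Z W x = Z x * W x + p.ε * p.q * (Z x * profile p Z W x) := by
  unfold profile
  generalize hD : 1 - p.q * p.ε * Z x = D at *
  field_simp
  rw [← hD]
  ring

end Expansions

/-- A deformation `Z` and a rescaled velocity `W = v / (γ + δ)` at a fixed time, regular enough for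
the Green–Naghdi operators to be defined pointwise. -/
structure RegularState (p : Param) (Z W : ℝ → ℝ) : Prop where
  γ_nonneg : 0 ≤ p.γ
  δ_pos : 0 < p.δ
  depth₁_pos : ∀ x, 0 < depth₁ p Z x
  depth₂_pos : ∀ x, 0 < depth₂ p Z x
  differentiable_fst : Differentiable ℝ Z
  differentiable_deriv_fst : Differentiable ℝ (deriv Z)
  differentiable_snd : Differentiable ℝ W
  differentiable_deriv_snd : Differentiable ℝ (deriv W)

namespace RegularState

variable {p : Param} {Z W : ℝ → ℝ}

theorem γ_add_δ_ne (h : RegularState p Z W) : p.γ + p.δ ≠ 0 :=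
  (add_pos_of_nonneg_of_pos h.γ_nonneg h.δ_pos).ne'

theorem depth_sum_pos (h : RegularState p Z W) (x : ℝ) :
    0 < depth₁ p Z x + p.γ * depth₂ p Z x :=
  add_pos_of_pos_of_nonneg (h.depth₁_pos x) (mul_nonneg h.γ_nonneg (h.depth₂_pos x).le)

theorem one_sub_ne (h : RegularState p Z W) (x : ℝ) : 1 - p.q * p.ε * Z x ≠ 0 := by
  have hpos := h.depth_sum_pos x
  rw [depth₁_add_depth₂_eq h.δ_pos.ne' h.γ_add_δ_ne] at hpos
  exact right_ne_zero_of_mul hpos.ne'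

theorem hasDerivAt_depth₁ (h : RegularState p Z W) (x : ℝ) :
    HasDerivAt (depth₁ p Z) (-(p.ε * deriv Z x)) x :=
  ((h.differentiable_fst x).hasDerivAt.const_mul p.ε).const_sub 1

theorem hasDerivAt_depth₂ (h : RegularState p Z W) (x : ℝ) :
    HasDerivAt (depth₂ p Z) (p.ε * deriv Z x) x :=
  ((h.differentiable_fst x).hasDerivAt.const_mul p.ε).const_add _

theorem hasDerivAt_profile (h : RegularState p Z W) (x : ℝ) :
    HasDerivAt (profile p Z W) (deriv Z x / (1 - p.q * p.ε * Z x) ^ 2 * W x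
      + Z x / (1 - p.q * p.ε * Z x) * deriv W x) x := by
  have hdiv := hasDerivWithinAt_div_one_sub
    (h.differentiable_fst x).hasDerivAt.hasDerivWithinAt (s := Set.univ) (h.one_sub_ne x)
  exact (hasDerivWithinAt_univ.1 hdiv).mul (h.differentiable_snd x).hasDerivAt

theorem differentiable_profile (h : RegularState p Z W) : Differentiable ℝ (profile p Z W) :=
  fun x => (h.hasDerivAt_profile x).differentiableAt

theorem differentiable_deriv_profile (h : RegularState p Z W) :
    Differentiable ℝ (deriv (profile p Z W)) := by
  have hZ := h.differentiable_fst
  have hZ₁ := h.differentiable_deriv_fst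
  have hW := h.differentiable_snd
  have hW₁ := h.differentiable_deriv_snd
  have hD : Differentiable ℝ fun x => 1 - p.q * p.ε * Z x := by fun_prop
  rw [funext fun x => (h.hasDerivAt_profile x).deriv]
  exact ((hZ₁.div (hD.pow 2) fun x => pow_ne_zero 2 (h.one_sub_ne x)).mul hW).add
    ((hZ.div hD h.one_sub_ne).mul hW₁)

theorem deriv_deriv_profile (h : RegularState p Z W) (x : ℝ) :
    deriv (deriv (profile p Z W)) x =
      deriv (deriv Z) x * W x + 2 * (deriv Z x * deriv W x) + Z x * deriv (deriv W) x
      + p.ε * p.q * (deriv (deriv Z) x * profile p Z W x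
        + 2 * (deriv Z x * deriv (profile p Z W) x) + Z x * deriv (deriv (profile p Z W)) x) := by
  have hZ := fun x => (h.differentiable_fst x).hasDerivAt
  have hZ₁ := fun x => (h.differentiable_deriv_fst x).hasDerivAt
  have hW := fun x => (h.differentiable_snd x).hasDerivAt
  have hW₁ := fun x => (h.differentiable_deriv_snd x).hasDerivAt
  have hP := fun x => (h.differentiable_profile x).hasDerivAt
  have hP₁ := fun x => (h.differentiable_deriv_profile x).hasDerivAt
  have hderiv : deriv (profile p Z W) = fun x => (deriv Z x * W x + Z x * deriv W x)
      + p.ε * p.q * (deriv Z x * profile p Z W x + Z x * deriv (profile p Z W) x) := by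
    ext x
    conv_lhs => rw [show profile p Z W = fun x => Z x * W x + p.ε * p.q * (Z x * profile p Z W x)
      from funext fun x => profile_eq (h.one_sub_ne x)]
    exact (((hZ x).mul (hW x)).add (((hZ x).mul (hP x)).const_mul _)).deriv
  conv_lhs => rw [hderiv]
  refine ((((hZ₁ x).mul (hW x)).add ((hZ x).mul (hW₁ x))).add
    ((((hZ₁ x).mul (hP x)).add ((hZ x).mul (hP₁ x))).const_mul _)).deriv.trans ?_
  ring

theorem deriv_lowerVelocity (h : RegularState p Z W) :
    deriv (lowerVelocity p.γ (depth₁ p Z) (depth₂ p Z) fun y => (p.γ + p.δ) * W y)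
      = fun x => p.δ * (deriv W x + p.ε * (p.q - 1) * deriv (profile p Z W) x) := by
  rw [lowerVelocity_eq h.δ_pos.ne' h.γ_add_δ_ne h.one_sub_ne]
  exact funext fun x => (((h.differentiable_snd x).hasDerivAt.add
    ((h.differentiable_profile x).hasDerivAt.const_mul _)).const_mul _).deriv

theorem deriv_upperVelocity (h : RegularState p Z W) :
    deriv (upperVelocity p.γ (depth₁ p Z) (depth₂ p Z) fun y => (p.γ + p.δ) * W y)
      = fun x => deriv W x + p.ε * (p.q + p.δ) * deriv (profile p Z W) x := by
  rw [upperVelocity_eq h.δ_pos.ne' h.γ_add_δ_ne h.one_sub_ne]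
  exact funext fun x => ((h.differentiable_snd x).hasDerivAt.add
    ((h.differentiable_profile x).hasDerivAt.const_mul _)).deriv

theorem hasDerivAt_deriv_lowerVelocity (h : RegularState p Z W) (x : ℝ) :
    HasDerivAt
      (deriv (lowerVelocity p.γ (depth₁ p Z) (depth₂ p Z) fun y => (p.γ + p.δ) * W y))
      (p.δ * (deriv (deriv W) x + p.ε * (p.q - 1) * deriv (deriv (profile p Z W)) x)) x := by
  rw [h.deriv_lowerVelocity]
  exact ((h.differentiable_deriv_snd x).hasDerivAt.add
    ((h.differentiable_deriv_profile x).hasDerivAt.const_mul _)).const_mul _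

theorem hasDerivAt_deriv_upperVelocity (h : RegularState p Z W) (x : ℝ) :
    HasDerivAt
      (deriv (upperVelocity p.γ (depth₁ p Z) (depth₂ p Z) fun y => (p.γ + p.δ) * W y))
      (deriv (deriv W) x + p.ε * (p.q + p.δ) * deriv (deriv (profile p Z W)) x) x := by
  rw [h.deriv_upperVelocity]
  exact (h.differentiable_deriv_snd x).hasDerivAt.add
    ((h.differentiable_deriv_profile x).hasDerivAt.const_mul _)

theorem opQ_eq (h : RegularState p Z W) (x : ℝ) :
    opQ p.γ (depth₁ p Z) (depth₂ p Z) (fun y => (p.γ + p.δ) * W y) x =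
      (p.γ + p.δ) * (-2 * p.ν * deriv (deriv W) x - p.ε * bracketForm p Z W x)
      + p.ε ^ 2 * opQRemainder p Z W x := by
  have hlow := h.hasDerivAt_deriv_lowerVelocity x
  have hupp := h.hasDerivAt_deriv_upperVelocity x
  rw [opQ_eq_layerVelocities (h.hasDerivAt_depth₁ x).differentiableAt
    (h.hasDerivAt_depth₂ x).differentiableAt hlow.differentiableAt hupp.differentiableAt
    (h.depth₁_pos x).ne' (h.depth₂_pos x).ne', hlow.deriv, hupp.deriv, h.deriv_lowerVelocity,
    h.deriv_upperVelocity, (h.hasDerivAt_depth₁ x).deriv, (h.hasDerivAt_depth₂ x).deriv]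
  have hP₂ := h.deriv_deriv_profile x
  have hν := Param.ν_eq h.δ_pos.ne' h.γ_add_δ_ne
  have hκ₁ := Param.κ₁_sub_κ₂_eq h.δ_pos.ne' h.γ_add_δ_ne
  have hκ₂ := Param.κ₂_eq h.γ_add_δ_ne
  have hinv : p.δ * (1 / p.δ) = 1 := mul_one_div_cancel h.δ_pos.ne'
  unfold depth₁ depth₂ bracketForm opQRemainder
  rw [div_eq_mul_one_div (p.q - 1)] at *
  generalize 1 / p.δ = d at *
  linear_combination 2 * deriv (deriv W) x * hν
    + p.ε * (Z x * deriv (deriv W) x + W x * deriv (deriv Z) x + 2 * (deriv Z x * deriv W x)) * hκ₁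
    + p.ε * (2 * (Z x * deriv (deriv W) x) + 3 * (deriv Z x * deriv W x)) * hκ₂
    - 1 / 3 * (3 * p.ε * deriv Z x * (deriv W x + p.ε * (p.q - 1) * deriv (profile p Z W) x)
      + (d + 2 * p.ε * Z x) * (deriv (deriv W) x
        + p.ε * (p.q - 1) * deriv (deriv (profile p Z W)) x)) * hinv
    - 1 / 3 * p.ε * ((p.q - 1) * d + p.γ * (p.q + p.δ)) * hP₂

theorem opR_eq (h : RegularState p Z W) (x : ℝ) :
    opR p.γ (depth₁ p Z) (depth₂ p Z) (fun y => (p.γ + p.δ) * W y) x =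
      (1 - p.γ) * quadraticPoly W x + p.ε * opRRemainder p Z W x := by
  have hlow := h.hasDerivAt_deriv_lowerVelocity x
  have hupp := h.hasDerivAt_deriv_upperVelocity x
  have hδ := h.δ_pos.ne'
  rw [opR_eq_layerVelocities (h.hasDerivAt_depth₁ x).differentiableAt
    (h.hasDerivAt_depth₂ x).differentiableAt hlow.differentiableAt hupp.differentiableAt,
    hlow.deriv, hupp.deriv, h.deriv_lowerVelocity, h.deriv_upperVelocity,
    (h.hasDerivAt_depth₁ x).deriv, (h.hasDerivAt_depth₂ x).deriv,
    velocity_div_depth_eq hδ h.γ_add_δ_ne (h.one_sub_ne x)]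
  unfold depth₁ depth₂ quadraticPoly opRRemainder opRRemainderJet productRemainder lowerRemainder
    upperRemainder
  generalize p.q = q at *
  field_simp
  ring

end RegularState

/-! ### The weakly coupled system in the variables `ζ = u_l + u_r`, `w = u_l - u_r` -/

section SerreSystem

/-- The flux `F` for which the hyperbolic parts of `f_l` and `f_r` are `∂ₓ F(u_l, u_r)` and
`-∂ₓ F(u_r, u_l)`. -/
def serreFlux (p : Param) (a b : ℝ → ℝ) : ℝ → ℝ := fun y =>
  p.ε * (p.α₁ / 2) * ((a y + 1 / 3 * b y) * (a y - b y))
    + p.ε ^ 2 * (p.α₂ / 3) * ((a y - b y) * a y * (a y + b y))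
    + p.ε ^ 3 * (p.α₃ / 4) * ((a y - 1 / 5 * b y) * (a y - b y) * (a y + b y) ^ 2)

/-- The dispersive part of `f_l`, and of `-f_r`, in terms of `ζ` and `w`. -/
def serreDispersion (p : Param) (T : EReal) (ζ w : ℝ → ℝ → ℝ) : ℝ → ℝ → ℝ := fun t x =>
  -(p.μ * p.ν * deriv (deriv (dt T w t)) x) + p.μ * p.ε * p.κ₃ * deriv (quadraticPoly (w t)) x
    - p.μ * p.ε * (1 / 2 * dt T (fun τ => bracketForm p (ζ τ) (w τ)) t x)

variable {p : Param} {T : EReal} {t x : ℝ}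

theorem massPoly_eq_add_serreFlux (h : p.γ + p.δ ≠ 0) (a b : ℝ → ℝ) :
    massPoly p (fun y => a y + b y) (fun y => a y - b y)
      = fun y => a y - b y + (serreFlux p a b y - serreFlux p b a y) := by
  ext y
  rw [massPoly, serreFlux, serreFlux, Param.α₁_eq h, Param.α₂_eq h, Param.α₃_eq h]
  ring

theorem velocityPoly_eq_serreFlux_add (h : p.γ + p.δ ≠ 0) (a b : ℝ → ℝ) :
    velocityPoly p (fun y => a y + b y) (fun y => a y - b y)
      = fun y => serreFlux p a b y + serreFlux p b a y := by
  ext y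
  rw [velocityPoly, serreFlux, serreFlux, Param.α₁_eq h, Param.α₂_eq h, Param.α₃_eq h]
  ring

theorem differentiable_serreFlux {a b : ℝ → ℝ} (ha : Differentiable ℝ a) (hb : Differentiable ℝ b) :
    Differentiable ℝ (serreFlux p a b) := by
  unfold serreFlux
  fun_prop

theorem deriv_serreFlux {a b : ℝ → ℝ} (ha : Differentiable ℝ a) (hb : Differentiable ℝ b) (x : ℝ) :
    deriv (serreFlux p a b) x =
      p.ε * (p.α₁ / 2) * deriv (fun y => (a y + 1 / 3 * b y) * (a y - b y)) x
      + p.ε ^ 2 * (p.α₂ / 3) * deriv (fun y => (a y - b y) * a y * (a y + b y)) x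
      + p.ε ^ 3 * (p.α₃ / 4) *
        deriv (fun y => (a y - 1 / 5 * b y) * (a y - b y) * (a y + b y) ^ 2) x := by
  unfold serreFlux
  rw [deriv_fun_add (by fun_prop) (by fun_prop), deriv_fun_add (by fun_prop) (by fun_prop),
    deriv_const_mul _ (by fun_prop), deriv_const_mul _ (by fun_prop),
    deriv_const_mul _ (by fun_prop)]

theorem quadraticPoly_sub {a b : ℝ → ℝ} (ha : Differentiable ℝ a) (hb : Differentiable ℝ b)
    (ha₁ : Differentiable ℝ (deriv a)) (hb₁ : Differentiable ℝ (deriv b)) :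
    quadraticPoly (fun y => a y - b y) = fun y =>
      1 / 3 * (a y - b y) * (iteratedDeriv 2 a y - iteratedDeriv 2 b y)
        + 1 / 2 * (deriv a y - deriv b y) ^ 2 := by
  have hderiv : deriv (fun y => a y - b y) = fun y => deriv a y - deriv b y :=
    funext fun y => deriv_fun_sub (ha y) (hb y)
  ext y
  rw [quadraticPoly, hderiv, deriv_fun_sub (ha₁ y) (hb₁ y)]
  simp only [iteratedDeriv_succ, iteratedDeriv_zero]
  ring

theorem serreBracket_eq {a b : ℝ → ℝ → ℝ} (ha : Differentiable ℝ (a t))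
    (hb : Differentiable ℝ (b t)) (ha₁ : Differentiable ℝ (deriv (a t)))
    (hb₁ : Differentiable ℝ (deriv (b t))) (x : ℝ) :
    serreBracket p a b t x =
      1 / 2 * bracketForm p (fun y => a t y + b t y) (fun y => a t y - b t y) x := by
  have hadd : deriv (fun y => a t y + b t y) = fun y => deriv (a t) y + deriv (b t) y :=
    funext fun y => deriv_fun_add (ha y) (hb y)
  have hsub : deriv (fun y => a t y - b t y) = fun y => deriv (a t) y - deriv (b t) y :=
    funext fun y => deriv_fun_sub (ha y) (hb y)
  rw [serreBracket, bracketForm, hadd, hsub, deriv_fun_add (ha₁ x) (hb₁ x),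
    deriv_fun_sub (ha₁ x) (hb₁ x)]
  simp only [iteratedDeriv_succ, iteratedDeriv_zero]
  ring

theorem dt_neg (u : ℝ → ℝ → ℝ) : dt T (fun τ y => -u τ y) t = fun x => -dt T u t x :=
  funext fun _ => derivWithin.fun_neg

variable {ul ur : ℝ → ℝ → ℝ}

theorem dt_serreBracket (ht : t ∈ timeInterval T)
    (dl : ∀ τ ∈ timeInterval T, Differentiable ℝ (ul τ))
    (dr : ∀ τ ∈ timeInterval T, Differentiable ℝ (ur τ))
    (dl₁ : ∀ τ ∈ timeInterval T, Differentiable ℝ (deriv (ul τ)))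
    (dr₁ : ∀ τ ∈ timeInterval T, Differentiable ℝ (deriv (ur τ))) (x : ℝ) :
    dt T (serreBracket p ul ur) t x = 1 / 2 *
      dt T (fun τ => bracketForm p (fun y => ul τ y + ur τ y) (fun y => ul τ y - ur τ y)) t x := by
  have heq : ∀ τ ∈ timeInterval T, serreBracket p ul ur τ x = _ := fun τ hτ =>
    serreBracket_eq (dl τ hτ) (dr τ hτ) (dl₁ τ hτ) (dr₁ τ hτ) x
  exact (derivWithin_congr heq (heq t ht)).trans (derivWithin_const_mul_field _)

theorem serreL_eq (ht : t ∈ timeInterval T)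
    (dl : ∀ τ ∈ timeInterval T, Differentiable ℝ (ul τ))
    (dr : ∀ τ ∈ timeInterval T, Differentiable ℝ (ur τ))
    (dl₁ : ∀ τ ∈ timeInterval T, Differentiable ℝ (deriv (ul τ)))
    (dr₁ : ∀ τ ∈ timeInterval T, Differentiable ℝ (deriv (ur τ))) (x : ℝ) :
    serreL p T ul ur t x = deriv (serreFlux p (ul t) (ur t)) x
      + serreDispersion p T (fun τ y => ul τ y + ur τ y) (fun τ y => ul τ y - ur τ y) t x := by
  rw [serreL, dt_serreBracket ht dl dr dl₁ dr₁, deriv_serreFlux (dl t ht) (dr t ht),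
    serreDispersion, quadraticPoly_sub (dl t ht) (dr t ht) (dl₁ t ht) (dr₁ t ht)]
  simp only [iteratedDeriv_succ, iteratedDeriv_zero]
  ring

theorem serreR_eq (ht : t ∈ timeInterval T)
    (dl : ∀ τ ∈ timeInterval T, Differentiable ℝ (ul τ))
    (dr : ∀ τ ∈ timeInterval T, Differentiable ℝ (ur τ))
    (dl₁ : ∀ τ ∈ timeInterval T, Differentiable ℝ (deriv (ul τ)))
    (dr₁ : ∀ τ ∈ timeInterval T, Differentiable ℝ (deriv (ur τ))) (x : ℝ) :
    serreR p T ul ur t x = -deriv (serreFlux p (ur t) (ul t)) x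
      - serreDispersion p T (fun τ y => ul τ y + ur τ y) (fun τ y => ul τ y - ur τ y) t x := by
  have hneg : dt T (fun τ y => ur τ y - ul τ y) t
      = fun y => -dt T (fun τ y => ul τ y - ur τ y) t y := by
    simp only [← dt_neg, neg_sub]
  have hbracket : dt T (serreBracket p ur ul) t x = -dt T (serreBracket p ul ur) t x := by
    rw [← congrFun (dt_neg _) x]
    congr 1
    ext τ y
    unfold serreBracket
    ring
  have hquadratic : quadraticPoly (fun y => ul t y - ur t y) = fun y =>
      1 / 3 * (ur t y - ul t y) * (iteratedDeriv 2 (ur t) y - iteratedDeriv 2 (ul t) y)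
        + 1 / 2 * (deriv (ur t) y - deriv (ul t) y) ^ 2 := by
    rw [quadraticPoly_sub (dl t ht) (dr t ht) (dl₁ t ht) (dr₁ t ht)]
    ext y
    ring
  rw [serreR, hneg, hbracket, dt_serreBracket ht dl dr dl₁ dr₁,
    deriv_serreFlux (dr t ht) (dl t ht), serreDispersion, hquadratic]
  simp only [iteratedDeriv_succ, iteratedDeriv_zero, deriv.fun_neg', add_comm (ul t _),
    add_comm (1 / 3 * ul t _)]
  ring

theorem SolvesSerre.sum (h : SolvesSerre p T ul ur) (hp : p.γ + p.δ ≠ 0) (hT : 0 < T)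
    (ht : t ∈ timeInterval T)
    (hl : DifferentiableWithinAt ℝ (fun τ => ul τ x) (timeInterval T) t)
    (hr : DifferentiableWithinAt ℝ (fun τ => ur τ x) (timeInterval T) t)
    (dl : ∀ τ ∈ timeInterval T, Differentiable ℝ (ul τ))
    (dr : ∀ τ ∈ timeInterval T, Differentiable ℝ (ur τ))
    (dl₁ : ∀ τ ∈ timeInterval T, Differentiable ℝ (deriv (ul τ)))
    (dr₁ : ∀ τ ∈ timeInterval T, Differentiable ℝ (deriv (ur τ))) :
    dt T (fun τ y => ul τ y + ur τ y) t x
      + deriv (massPoly p (fun y => ul t y + ur t y) (fun y => ul t y - ur t y)) x = 0 := by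
  obtain ⟨h₁, h₂⟩ := h t ht x
  rw [serreL_eq ht dl dr dl₁ dr₁] at h₁
  rw [serreR_eq ht dl dr dl₁ dr₁] at h₂
  have hdt : dt T (fun τ y => ul τ y + ur τ y) t x = dt T ul t x + dt T ur t x :=
    dt_eq hT ht (hl.hasDerivWithinAt.fun_add hr.hasDerivWithinAt)
  have dF := differentiable_serreFlux (p := p) (dl t ht) (dr t ht) x
  have dF' := differentiable_serreFlux (p := p) (dr t ht) (dl t ht) x
  rw [hdt, massPoly_eq_add_serreFlux hp,
    deriv_fun_add ((dl t ht x).fun_sub (dr t ht x)) (dF.fun_sub dF'),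
    deriv_fun_sub (dl t ht x) (dr t ht x), deriv_fun_sub dF dF']
  linear_combination h₁ + h₂

theorem SolvesSerre.diff (h : SolvesSerre p T ul ur) (hp : p.γ + p.δ ≠ 0) (hT : 0 < T)
    (ht : t ∈ timeInterval T)
    (hl : DifferentiableWithinAt ℝ (fun τ => ul τ x) (timeInterval T) t)
    (hr : DifferentiableWithinAt ℝ (fun τ => ur τ x) (timeInterval T) t)
    (dl : ∀ τ ∈ timeInterval T, Differentiable ℝ (ul τ))
    (dr : ∀ τ ∈ timeInterval T, Differentiable ℝ (ur τ))
    (dl₁ : ∀ τ ∈ timeInterval T, Differentiable ℝ (deriv (ul τ)))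
    (dr₁ : ∀ τ ∈ timeInterval T, Differentiable ℝ (deriv (ur τ))) :
    dt T (fun τ y => ul τ y - ur τ y) t x + deriv (fun y => ul t y + ur t y) x
      + deriv (velocityPoly p (fun y => ul t y + ur t y) (fun y => ul t y - ur t y)) x
      + 2 * serreDispersion p T (fun τ y => ul τ y + ur τ y) (fun τ y => ul τ y - ur τ y) t x
      = 0 := by
  obtain ⟨h₁, h₂⟩ := h t ht x
  rw [serreL_eq ht dl dr dl₁ dr₁] at h₁
  rw [serreR_eq ht dl dr dl₁ dr₁] at h₂
  have hdt : dt T (fun τ y => ul τ y - ur τ y) t x = dt T ul t x - dt T ur t x :=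
    dt_eq hT ht (hl.hasDerivWithinAt.fun_sub hr.hasDerivWithinAt)
  rw [hdt, velocityPoly_eq_serreFlux_add hp, deriv_fun_add (dl t ht x) (dr t ht x),
    deriv_fun_add (differentiable_serreFlux (dl t ht) (dr t ht) x)
      (differentiable_serreFlux (dr t ht) (dl t ht) x)]
  linear_combination h₁ - h₂

end SerreSystem

/-! ### Uniform bounds on the remainders -/

section UniformRemainders

variable {Ω : Type*} {p : Ω → Param} {T : Ω → EReal} {σ τ : ℝ} {Z W F : Ω → ℝ → ℝ → ℝ}

/-- A family of parameters whose coefficients are bounded; `quot` is the quotient occurring in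
`Param.κ₁_sub_κ₂_eq`. -/
structure UnifBddParam (p : Ω → Param) : Prop where
  μ : UnifBdd fun ω => (p ω).μ
  ε : UnifBdd fun ω => (p ω).ε
  δ : UnifBdd fun ω => (p ω).δ
  γ : UnifBdd fun ω => (p ω).γ
  q : UnifBdd fun ω => (p ω).q
  quot : UnifBdd fun ω => ((p ω).q - 1) / (p ω).δ
  κ₁ : UnifBdd fun ω => (p ω).κ₁
  κ₂ : UnifBdd fun ω => (p ω).κ₂
  κ₃ : UnifBdd fun ω => (p ω).κ₃

namespace UnifBddParam

theorem c₁ (hp : UnifBddParam p) : UnifBdd fun ω => (p ω).c₁ :=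
  (hp.δ.sub (UnifBdd.const 1)).add hp.q

theorem c₂ (hp : UnifBddParam p) : UnifBdd fun ω => (p ω).c₂ :=
  (hp.q.add hp.δ).mul (hp.q.sub (UnifBdd.const 1))

theorem of_mem {μmax εmax δmin δmax : ℝ} (hδ : 0 < δmin)
    (h : ∀ ω, p ω ∈ paramSet μmax εmax δmin δmax) : UnifBddParam p := by
  have hμ : UnifBdd fun ω => (p ω).μ := ⟨μmax, fun ω => by
    rw [abs_of_nonneg (h ω).1]; exact (h ω).2.1⟩
  have hε : UnifBdd fun ω => (p ω).ε := ⟨εmax, fun ω => by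
    rw [abs_of_nonneg (h ω).2.2.1]; exact (h ω).2.2.2.1⟩
  have hle : ∀ ω, δmin ≤ (p ω).δ := fun ω => (h ω).2.2.2.2.1.le
  have hδ' : UnifBdd fun ω => (p ω).δ := ⟨δmax, fun ω => by
    rw [abs_of_pos (hδ.trans_le (hle ω))]; exact (h ω).2.2.2.2.2.1.le⟩
  have hγ : UnifBdd fun ω => (p ω).γ := ⟨1, fun ω => by
    rw [abs_of_nonneg (h ω).2.2.2.2.2.2.1]; exact (h ω).2.2.2.2.2.2.2.le⟩
  have hle' : ∀ ω, δmin ≤ (p ω).γ + (p ω).δ := fun ω => by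
    linarith [hle ω, (h ω).2.2.2.2.2.2.1]
  have h1 := UnifBdd.const (Ω := Ω) 1
  have hq : UnifBdd fun ω => (p ω).q := ((h1.sub hγ).mul hδ').div hδ hle'
  refine ⟨hμ, hε, hδ', hγ, hq, (hq.sub h1).div hδ hle, ?_, ?_, ?_⟩
  · refine ((h1.add (hγ.mul hδ')).mul ((hδ'.pow 2).sub hγ)).div (a := 3 * δmin * δmin ^ 2)
      (by positivity) fun ω => ?_
    have hδω := hδ.trans_le (hle ω)
    gcongr
    exacts [hle ω, hle' ω]
  · refine (h1.sub hγ).div (a := 3 * δmin) (by positivity) fun ω => ?_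
    linarith [hle' ω]
  · refine (hγ.sub h1).div (a := 2 * δmin) (by positivity) fun ω => ?_
    linarith [hle' ω]

end UnifBddParam

theorem UnifH.jet (hσ : 1 / 2 < σ) (hF : UnifH T (σ + 2) F) :
    UnifH T σ F ∧ UnifH T σ (fun ω t x => deriv (F ω t) x) ∧
      UnifH T σ (fun ω t x => deriv (deriv (F ω t)) x) := by
  have hF₁ : UnifH T (σ + 1) (fun ω t x => deriv (F ω t) x) :=
    UnifH.deriv (by linarith) (hF.mono (by linarith))
  exact ⟨hF.mono (by linarith), hF₁.mono (by linarith), hF₁.deriv hσ⟩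

theorem UnifC1.jet (hT : ∀ ω, 0 < T ω) (hσ : 1 / 2 < σ) (hτ : 1 / 2 < τ)
    (hF : UnifC1 T (σ + 2) (τ + 2) F) :
    UnifC1 T σ τ F ∧ UnifC1 T σ τ (fun ω t x => deriv (F ω t) x) ∧
      UnifC1 T σ τ (fun ω t x => deriv (deriv (F ω t)) x) := by
  have hF₁ : UnifC1 T (σ + 1) (τ + 1) (fun ω t x => deriv (F ω t) x) :=
    UnifC1.deriv hT (by linarith) (by linarith) (hF.mono (by linarith) (by linarith))
  exact ⟨hF.mono (by linarith) (by linarith), hF₁.mono (by linarith) (by linarith),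
    UnifC1.deriv hT hσ hτ hF₁⟩

theorem unifH_profile {a : ℝ} (ha : 0 < a) (hp : UnifBddParam p) (hσ : 3 / 2 < σ)
    (hZ : UnifH T σ Z) (hW : UnifH T σ W)
    (h : ∀ ω, ∀ t ∈ timeInterval (T ω), ∀ x, a ≤ 1 - (p ω).q * (p ω).ε * Z ω t x) :
    UnifH T σ fun ω t => profile (p ω) (Z ω t) (W ω t) :=
  (hZ.div_one_sub ha hσ (hp.q.mul hp.ε) h).mul (by linarith) hW

theorem unifC1_profile {a : ℝ} (ha : 0 < a) (hp : UnifBddParam p) (hT : ∀ ω, 0 < T ω)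
    (hσ : 3 / 2 < σ) (hτ : 1 / 2 < τ) (hτσ : τ ≤ σ) (hZ : UnifC1 T σ τ Z) (hW : UnifC1 T σ τ W)
    (h : ∀ ω, ∀ t ∈ timeInterval (T ω), ∀ x, a ≤ 1 - (p ω).q * (p ω).ε * Z ω t x) :
    UnifC1 T σ τ fun ω t => profile (p ω) (Z ω t) (W ω t) :=
  (hZ.div_one_sub ha hT hτ hσ hτσ (hp.q.mul hp.ε) h).mul hT hτ hτσ hW

theorem unifC1_bracketForm (hp : UnifBddParam p) (hT : ∀ ω, 0 < T ω) (hτ : 1 / 2 < τ)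
    (hτσ : τ ≤ σ) (hZ : UnifC1 T (σ + 2) (τ + 2) Z) (hW : UnifC1 T (σ + 2) (τ + 2) W) :
    UnifC1 T σ τ fun ω t => bracketForm (p ω) (Z ω t) (W ω t) := by
  obtain ⟨z, z₁, z₂⟩ := hZ.jet hT (hτ.trans_le hτσ) hτ
  obtain ⟨w, w₁, w₂⟩ := hW.jet hT (hτ.trans_le hτσ) hτ
  exact (((z.mul hT hτ hτσ w₂).const_mul hT (hp.κ₁.add hp.κ₂)).add hT
    ((w.mul hT hτ hτσ z₂).const_mul hT (hp.κ₁.sub hp.κ₂))).add hT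
    ((z₁.mul hT hτ hτσ w₁).const_mul hT (((UnifBdd.const 2).mul hp.κ₁).add hp.κ₂))

theorem unifC1_opQRemainder {a : ℝ} (ha : 0 < a) (hp : UnifBddParam p) (hT : ∀ ω, 0 < T ω)
    (hτ : 1 / 2 < τ) (hτσ : τ ≤ σ) (hZ : UnifC1 T (σ + 2) (τ + 2) Z)
    (hW : UnifC1 T (σ + 2) (τ + 2) W)
    (h : ∀ ω, ∀ t ∈ timeInterval (T ω), ∀ x, a ≤ 1 - (p ω).q * (p ω).ε * Z ω t x) :
    UnifC1 T σ τ fun ω t => opQRemainder (p ω) (Z ω t) (W ω t) := by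
  have hσ := hτ.trans_le hτσ
  obtain ⟨z, z₁, z₂⟩ := hZ.jet hT hσ hτ
  obtain ⟨-, w₁, w₂⟩ := hW.jet hT hσ hτ
  obtain ⟨P, P₁, P₂⟩ := (unifC1_profile ha hp hT (by linarith) (by linarith) (by linarith)
    hZ hW h).jet hT hσ hτ
  obtain ⟨-, hε, hδ, hγ, hq, hquot, -⟩ := hp
  unfold opQRemainder
  repeat' first
    | assumption
    | exact UnifBdd.const _
    | apply UnifBdd.sub
    | apply UnifBdd.add
    | apply UnifBdd.mul
    | apply UnifC1.sub
    | apply UnifC1.add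
    | apply UnifC1.const_mul
    | apply UnifC1.mul

theorem unifH_opRRemainder {a : ℝ} (ha : 0 < a) (hp : UnifBddParam p) (hσ : 1 / 2 < σ)
    (hZ : UnifH T (σ + 2) Z) (hW : UnifH T (σ + 2) W)
    (h : ∀ ω, ∀ t ∈ timeInterval (T ω), ∀ x, a ≤ 1 - (p ω).q * (p ω).ε * Z ω t x) :
    UnifH T σ fun ω t => opRRemainder (p ω) (Z ω t) (W ω t) := by
  obtain ⟨z, z₁, -⟩ := hZ.jet hσ
  obtain ⟨w, w₁, w₂⟩ := hW.jet hσ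
  obtain ⟨P, P₁, P₂⟩ := (unifH_profile ha hp (by linarith) hZ hW h).jet hσ
  obtain ⟨-, hε, hδ, hγ, hq, -⟩ := hp
  unfold opRRemainder opRRemainderJet lowerRemainder upperRemainder productRemainder
  repeat' first
    | assumption
    | exact UnifBdd.const _
    | apply UnifBdd.sub
    | apply UnifBdd.add
    | apply UnifBdd.mul
    | apply UnifH.sub
    | apply UnifH.add
    | apply UnifH.const_mul
    | apply UnifH.mul

theorem unifH_quadraticPoly (hσ : 1 / 2 < σ) (hW : UnifH T (σ + 2) W) :
    UnifH T σ fun ω t => quadraticPoly (W ω t) := by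
  obtain ⟨w, w₁, w₂⟩ := hW.jet hσ
  exact ((w.mul hσ w₂).const_mul (UnifBdd.const _)).add
    ((w₁.mul hσ w₁).const_mul (UnifBdd.const _))

theorem unifH_massRemainder {a : ℝ} (ha : 0 < a) (hp : UnifBddParam p) (hσ : 3 / 2 < σ)
    (hZ : UnifH T σ Z) (hW : UnifH T σ W)
    (h : ∀ ω, ∀ t ∈ timeInterval (T ω), ∀ x, a ≤ 1 - (p ω).q * (p ω).ε * Z ω t x) :
    UnifH T σ fun ω t => massRemainder (p ω) (Z ω t) (W ω t) := by
  have hσ' : 1 / 2 < σ := by linarith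
  have hP := unifH_profile ha hp hσ hZ hW h
  exact (hZ.mul hσ' (hZ.mul hσ' (hZ.mul hσ' hP))).const_mul ((hp.q.mul hp.q).mul hp.c₂)

theorem unifH_velocityRemainder {a : ℝ} (ha : 0 < a) (hp : UnifBddParam p) (hσ : 3 / 2 < σ)
    (hZ : UnifH T σ Z) (hW : UnifH T σ W)
    (h : ∀ ω, ∀ t ∈ timeInterval (T ω), ∀ x, a ≤ 1 - (p ω).q * (p ω).ε * Z ω t x) :
    UnifH T σ fun ω t => velocityRemainder (p ω) (Z ω t) (W ω t) := by
  have hσ' : 1 / 2 < σ := by linarith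
  have hP := unifH_profile ha hp hσ hZ hW h
  exact (((hZ.mul hσ' (hZ.mul hσ' (hP.mul hσ' hW))).const_mul (UnifBdd.const 4)).add
    ((hZ.mul hσ' (hZ.mul hσ' (hP.mul hσ' hP))).const_mul (hp.q.mul hp.ε))).const_mul
      ((UnifBdd.const _).mul ((hp.q.mul hp.q).mul hp.c₂))

end UniformRemainders

/-! ### The Green–Naghdi residuals of a uniformly bounded family -/

section Consistency

variable {Ω : Type*} {p : Ω → Param} {T : Ω → EReal} {s : ℝ} {Z W : Ω → ℝ → ℝ → ℝ}

namespace UnifH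

theorem memLinfty {σ : ℝ} (hZ : UnifH T σ Z) (ω : Ω) : MemLinfty (T ω) σ (Z ω) := by
  refine ⟨fun t ht => hZ.continuous ht, ?_⟩
  obtain ⟨K, hK, hle⟩ := hZ
  exact (iSup₂_le fun t ht => (hle ω t ht).2).trans_lt hK

theorem exists_linftyENorm_le {σ : ℝ} (hZ : UnifH T σ Z) :
    ∃ C : ℝ, 0 ≤ C ∧ ∀ ω, linftyENorm (T ω) σ (Z ω) ≤ ENNReal.ofReal C := by
  obtain ⟨K, hK, hle⟩ := hZ
  refine ⟨K.toReal, ENNReal.toReal_nonneg, fun ω => ?_⟩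
  rw [ENNReal.ofReal_toReal hK.ne]
  exact iSup₂_le fun t ht => (hle ω t ht).2

end UnifH

/-- A uniformly bounded family of solutions of the weakly coupled system, written in the variables
`ζ = u_l + u_r` and `w = u_l - u_r`, which stays uniformly away from the singularity of
`Z / (1 - q ε Z)`. Uniformity over the index `ω` is what the constants of the theorem require. -/
structure UnifSerre (p : Ω → Param) (T : Ω → EReal) (s : ℝ) (Z W : Ω → ℝ → ℝ → ℝ) : Prop where
  unifBddParam : UnifBddParam p
  μ_nonneg : ∀ ω, 0 ≤ (p ω).μ
  ε_nonneg : ∀ ω, 0 ≤ (p ω).ε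
  γ_nonneg : ∀ ω, 0 ≤ (p ω).γ
  δ_pos : ∀ ω, 0 < (p ω).δ
  pos : ∀ ω, 0 < T ω
  unifC1_fst : UnifC1 T (s + 3) (s + 2) Z
  unifC1_snd : UnifC1 T (s + 3) (s + 2) W
  depth₁_pos : ∀ ω, ∀ t ∈ timeInterval (T ω), ∀ x, 0 < depth₁ (p ω) (Z ω t) x
  depth₂_pos : ∀ ω, ∀ t ∈ timeInterval (T ω), ∀ x, 0 < depth₂ (p ω) (Z ω t) x
  exists_le_one_sub : ∃ a > 0, ∀ ω, ∀ t ∈ timeInterval (T ω), ∀ x,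
    a ≤ 1 - (p ω).q * (p ω).ε * Z ω t x
  mass : ∀ ω, ∀ t ∈ timeInterval (T ω), ∀ x,
    dt (T ω) (Z ω) t x + deriv (massPoly (p ω) (Z ω t) (W ω t)) x = 0
  velocity : ∀ ω, ∀ t ∈ timeInterval (T ω), ∀ x,
    dt (T ω) (W ω) t x + deriv (Z ω t) x + deriv (velocityPoly (p ω) (Z ω t) (W ω t)) x
      + 2 * serreDispersion (p ω) (T ω) (Z ω) (W ω) t x = 0

/-- The residual of the Green–Naghdi mass equation, divided by `μ ε² + ε⁴`. -/
def massResidual (p : Param) (Z W : ℝ → ℝ → ℝ) : ℝ → ℝ → ℝ := fun t x =>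
  p.ε ^ 4 / serrePrecision p * deriv (massRemainder p (Z t) (W t)) x

/-- The residual of the Green–Naghdi velocity equation, divided by `μ ε² + ε⁴`. -/
def velocityResidual (p : Param) (T : EReal) (Z W : ℝ → ℝ → ℝ) : ℝ → ℝ → ℝ := fun t x =>
  p.ε ^ 4 / serrePrecision p * ((p.γ + p.δ) * deriv (velocityRemainder p (Z t) (W t)) x)
    + p.μ * p.ε ^ 2 / serrePrecision p *
      (dt T (fun τ => opQRemainder p (Z τ) (W τ)) t x - deriv (opRRemainder p (Z t) (W t)) x)

section Precision

variable {p : Param}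

theorem serrePrecision_mul_ε_pow_div (hμ : 0 ≤ p.μ) :
    serrePrecision p * (p.ε ^ 4 / serrePrecision p) = p.ε ^ 4 := by
  refine mul_div_cancel_of_imp' fun hzero => ?_
  have hμε : 0 ≤ p.μ * p.ε ^ 2 := by positivity
  have hε4 : 0 ≤ p.ε ^ 4 := by positivity
  rw [serrePrecision] at hzero
  linarith

theorem serrePrecision_mul_μ_ε_sq_div (hμ : 0 ≤ p.μ) :
    serrePrecision p * (p.μ * p.ε ^ 2 / serrePrecision p) = p.μ * p.ε ^ 2 := by
  refine mul_div_cancel_of_imp' fun hzero => ?_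
  have hμε : 0 ≤ p.μ * p.ε ^ 2 := by positivity
  have hε4 : 0 ≤ p.ε ^ 4 := by positivity
  rw [serrePrecision] at hzero
  linarith

end Precision

theorem UnifBdd.div_of_nonneg_of_le {c d : Ω → ℝ} (hc : ∀ ω, 0 ≤ c ω) (hcd : ∀ ω, c ω ≤ d ω) :
    UnifBdd fun ω => c ω / d ω :=
  ⟨1, fun ω => by
    have hd := (hc ω).trans (hcd ω)
    rw [abs_of_nonneg (div_nonneg (hc ω) hd)]
    exact div_le_one_of_le₀ (hcd ω) hd⟩

theorem differentiable_massPoly {p : Param} {Z W : ℝ → ℝ} (hZ : Differentiable ℝ Z)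
    (hW : Differentiable ℝ W) : Differentiable ℝ (massPoly p Z W) := by
  unfold massPoly
  fun_prop

theorem differentiable_velocityPoly {p : Param} {Z W : ℝ → ℝ} (hZ : Differentiable ℝ Z)
    (hW : Differentiable ℝ W) : Differentiable ℝ (velocityPoly p Z W) := by
  unfold velocityPoly
  fun_prop

namespace RegularState

variable {p : Param} {Z W : ℝ → ℝ}

theorem hasDerivAt_massFlux (h : RegularState p Z W) {x : ℝ}
    (hrem : DifferentiableAt ℝ (massRemainder p Z W) x) :
    HasDerivAt (massFlux p Z fun y => (p.γ + p.δ) * W y)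
      (deriv (massPoly p Z W) x + p.ε ^ 4 * deriv (massRemainder p Z W) x) x := by
  rw [show massFlux p Z (fun y => (p.γ + p.δ) * W y) = fun y =>
      massPoly p Z W y + p.ε ^ 4 * massRemainder p Z W y from
    funext fun y => massFlux_eq h.δ_pos.ne' h.γ_add_δ_ne (h.one_sub_ne y)]
  exact (differentiable_massPoly h.differentiable_fst h.differentiable_snd x).hasDerivAt.add
    (hrem.hasDerivAt.const_mul _)

theorem differentiable_velocityFlux (h : RegularState p Z W) :
    Differentiable ℝ (velocityFlux p Z fun y => (p.γ + p.δ) * W y) := by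
  have h₁ : Differentiable ℝ (depth₁ p Z) := fun x => (h.hasDerivAt_depth₁ x).differentiableAt
  have h₂ : Differentiable ℝ (depth₂ p Z) := fun x => (h.hasDerivAt_depth₂ x).differentiableAt
  have hW := h.differentiable_snd
  unfold velocityFlux
  exact Differentiable.mul (Differentiable.div (by fun_prop) (by fun_prop)
    fun x => pow_ne_zero 2 (h.depth_sum_pos x).ne') (by fun_prop)

theorem deriv_velocityFlux (h : RegularState p Z W) {x : ℝ}
    (hrem : DifferentiableAt ℝ (velocityRemainder p Z W) x) :
    p.ε / 2 * deriv (velocityFlux p Z fun y => (p.γ + p.δ) * W y) x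
      = (p.γ + p.δ) * (deriv (velocityPoly p Z W) x
        + p.ε ^ 4 * deriv (velocityRemainder p Z W) x) := by
  refine ((h.differentiable_velocityFlux x).hasDerivAt.const_mul (p.ε / 2)).unique ?_
  rw [show (fun y => p.ε / 2 * velocityFlux p Z (fun y => (p.γ + p.δ) * W y) y) = fun y =>
      (p.γ + p.δ) * (velocityPoly p Z W y + p.ε ^ 4 * velocityRemainder p Z W y) from
    funext fun y => velocityFlux_eq h.δ_pos.ne' h.γ_add_δ_ne (h.one_sub_ne y)]
  exact ((differentiable_velocityPoly h.differentiable_fst h.differentiable_snd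
    x).hasDerivAt.add (hrem.hasDerivAt.const_mul _)).const_mul _

theorem hasDerivAt_quadraticTerm (h : RegularState p Z W) {x : ℝ}
    (hquad : DifferentiableAt ℝ (quadraticPoly W) x)
    (hrem : DifferentiableAt ℝ (opRRemainder p Z W) x) :
    HasDerivAt (quadraticTerm p Z fun y => (p.γ + p.δ) * W y)
      ((1 - p.γ) * deriv (quadraticPoly W) x + p.ε * deriv (opRRemainder p Z W) x) x := by
  rw [show quadraticTerm p Z (fun y => (p.γ + p.δ) * W y) = fun y =>
      (1 - p.γ) * quadraticPoly W y + p.ε * opRRemainder p Z W y from funext h.opR_eq]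
  exact (hquad.hasDerivAt.const_mul _).add (hrem.hasDerivAt.const_mul _)

end RegularState

theorem UnifC1.hasDerivWithinAt_deriv_deriv {σ τ : ℝ} (hσ : 1 / 2 < σ) (hτ : 1 / 2 < τ)
    (hT : ∀ ω, 0 < T ω) (hW : UnifC1 T (σ + 2) (τ + 2) W) {ω : Ω} {t : ℝ}
    (ht : t ∈ timeInterval (T ω)) (x : ℝ) :
    HasDerivWithinAt (fun t => deriv (deriv (W ω t)) x) (deriv (deriv (dt (T ω) (W ω) t)) x)
      (timeInterval (T ω)) t := by
  have hW₂ : UnifC1 T (σ + 1 + 1) (τ + 1 + 1) W := hW.mono (by linarith) (by linarith)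
  have hderiv := (UnifC1.deriv hT (by linarith) (by linarith) hW₂).hasDerivWithinAt_deriv hσ hτ ht x
  rwa [show dt (T ω) (fun t y => deriv (W ω t) y) t = deriv (dt (T ω) (W ω) t) from
    funext fun y => dt_eq (hT ω) ht
      (hW₂.hasDerivWithinAt_deriv (by linarith) (by linarith) ht y)] at hderiv

namespace UnifSerre

variable {ω : Ω} {t : ℝ}

theorem regularState (h : UnifSerre p T s Z W) (hs : 1 / 2 < s)
    (ht : t ∈ timeInterval (T ω)) : RegularState (p ω) (Z ω t) (W ω t) where
  γ_nonneg := h.γ_nonneg ω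
  δ_pos := h.δ_pos ω
  depth₁_pos := h.depth₁_pos ω t ht
  depth₂_pos := h.depth₂_pos ω t ht
  differentiable_fst := (h.unifC1_fst.unifH.mono (by linarith)).differentiable hs ht
  differentiable_deriv_fst :=
    ((h.unifC1_fst.unifH.mono (by linarith : s + 1 + 2 ≤ s + 3)).jet
      (by linarith)).2.1.differentiable hs ht
  differentiable_snd := (h.unifC1_snd.unifH.mono (by linarith)).differentiable hs ht
  differentiable_deriv_snd :=
    ((h.unifC1_snd.unifH.mono (by linarith : s + 1 + 2 ≤ s + 3)).jet
      (by linarith)).2.1.differentiable hs ht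

theorem unifC1_bracketForm (h : UnifSerre p T s Z W) (hs : 1 / 2 < s) :
    UnifC1 T (s + 1) s fun ω t => bracketForm (p ω) (Z ω t) (W ω t) :=
  _root_.unifC1_bracketForm h.unifBddParam h.pos hs (by linarith)
    (h.unifC1_fst.mono (by linarith) le_rfl) (h.unifC1_snd.mono (by linarith) le_rfl)

theorem unifC1_opQRemainder (h : UnifSerre p T s Z W) (hs : 1 / 2 < s) :
    UnifC1 T (s + 1) s fun ω t => opQRemainder (p ω) (Z ω t) (W ω t) := by
  obtain ⟨a, ha, hle⟩ := h.exists_le_one_sub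
  exact _root_.unifC1_opQRemainder ha h.unifBddParam h.pos hs (by linarith)
    (h.unifC1_fst.mono (by linarith) le_rfl) (h.unifC1_snd.mono (by linarith) le_rfl) hle

theorem unifH_opRRemainder (h : UnifSerre p T s Z W) (hs : 1 / 2 < s) :
    UnifH T (s + 1) fun ω t => opRRemainder (p ω) (Z ω t) (W ω t) := by
  obtain ⟨a, ha, hle⟩ := h.exists_le_one_sub
  exact _root_.unifH_opRRemainder ha h.unifBddParam (by linarith)
    (h.unifC1_fst.unifH.mono (by linarith)) (h.unifC1_snd.unifH.mono (by linarith)) hle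

theorem unifH_quadraticPoly (h : UnifSerre p T s Z W) (hs : 1 / 2 < s) :
    UnifH T (s + 1) fun ω t => quadraticPoly (W ω t) :=
  _root_.unifH_quadraticPoly (by linarith) (h.unifC1_snd.unifH.mono (by linarith))

theorem unifH_massRemainder (h : UnifSerre p T s Z W) (hs : 1 / 2 < s) :
    UnifH T (s + 1) fun ω t => massRemainder (p ω) (Z ω t) (W ω t) := by
  obtain ⟨a, ha, hle⟩ := h.exists_le_one_sub
  exact (_root_.unifH_massRemainder ha h.unifBddParam (by linarith) h.unifC1_fst.unifH
    h.unifC1_snd.unifH hle).mono (by linarith)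

theorem unifH_velocityRemainder (h : UnifSerre p T s Z W) (hs : 1 / 2 < s) :
    UnifH T (s + 1) fun ω t => velocityRemainder (p ω) (Z ω t) (W ω t) := by
  obtain ⟨a, ha, hle⟩ := h.exists_le_one_sub
  exact (_root_.unifH_velocityRemainder ha h.unifBddParam (by linarith) h.unifC1_fst.unifH
    h.unifC1_snd.unifH hle).mono (by linarith)

theorem hasDerivWithinAt_momentum (h : UnifSerre p T s Z W) (hs : 1 / 2 < s)
    (ht : t ∈ timeInterval (T ω)) (x : ℝ) :
    HasDerivWithinAt
      (fun τ => momentum (p ω) (Z ω) (fun τ y => ((p ω).γ + (p ω).δ) * W ω τ y) τ x)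
      (((p ω).γ + (p ω).δ) * (dt (T ω) (W ω) t x
          - 2 * (p ω).μ * (p ω).ν * deriv (deriv (dt (T ω) (W ω) t)) x
          - (p ω).μ * (p ω).ε * dt (T ω) (fun τ => bracketForm (p ω) (Z ω τ) (W ω τ)) t x)
        + (p ω).μ * (p ω).ε ^ 2 * dt (T ω) (fun τ => opQRemainder (p ω) (Z ω τ) (W ω τ)) t x)
      (timeInterval (T ω)) t := by
  have hexpand : ∀ τ ∈ timeInterval (T ω),
      momentum (p ω) (Z ω) (fun τ y => ((p ω).γ + (p ω).δ) * W ω τ y) τ x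
        = ((p ω).γ + (p ω).δ) * (W ω τ x - 2 * (p ω).μ * (p ω).ν * deriv (deriv (W ω τ)) x
            - (p ω).μ * (p ω).ε * bracketForm (p ω) (Z ω τ) (W ω τ) x)
          + (p ω).μ * (p ω).ε ^ 2 * opQRemainder (p ω) (Z ω τ) (W ω τ) x := fun τ hτ => by
    rw [momentum, (h.regularState hs hτ).opQ_eq]
    ring
  have hdd : HasDerivWithinAt (fun τ => deriv (deriv (W ω τ)) x)
      (deriv (deriv (dt (T ω) (W ω) t)) x) (timeInterval (T ω)) t :=
    (h.unifC1_snd.mono (by linarith) le_rfl).hasDerivWithinAt_deriv_deriv (σ := s) hs hs h.pos ht x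
  refine HasDerivWithinAt.congr ?_ hexpand (hexpand t ht)
  exact ((((h.unifC1_snd.hasDerivWithinAt ht x).sub (hdd.const_mul _)).sub
    (((h.unifC1_bracketForm hs).hasDerivWithinAt ht x).const_mul _)).const_mul _).add
    (((h.unifC1_opQRemainder hs).hasDerivWithinAt ht x).const_mul _)

theorem solvesGN (h : UnifSerre p T s Z W) (hs : 1 / 2 < s) (ω : Ω) :
    SolvesGN (p ω) (T ω) (Z ω) (fun t x => ((p ω).γ + (p ω).δ) * W ω t x)
      (fun t x => serrePrecision (p ω) * massResidual (p ω) (Z ω) (W ω) t x)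
      (fun t x => serrePrecision (p ω) * velocityResidual (p ω) (T ω) (Z ω) (W ω) t x) := by
  intro t ht x
  have hreg := h.regularState hs ht
  have hmass := hreg.hasDerivAt_massFlux ((h.unifH_massRemainder hs).differentiable hs ht x)
  have hvel := hreg.deriv_velocityFlux ((h.unifH_velocityRemainder hs).differentiable hs ht x)
  have hquad := hreg.hasDerivAt_quadraticTerm ((h.unifH_quadraticPoly hs).differentiable hs ht x)
    ((h.unifH_opRRemainder hs).differentiable hs ht x)
  have hmom := h.hasDerivWithinAt_momentum hs ht x
  have hε4 := serrePrecision_mul_ε_pow_div (h.μ_nonneg ω)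
  have hμε := serrePrecision_mul_μ_ε_sq_div (h.μ_nonneg ω)
  refine ⟨h.unifC1_fst.differentiableWithinAt ω t ht x, hmom.differentiableWithinAt,
    hreg.differentiable_fst x, hmass.differentiableAt, hreg.differentiable_velocityFlux x,
    hquad.differentiableAt, ?_, ?_⟩
  · rw [hmass.deriv]
    unfold massResidual
    linear_combination h.mass ω t ht x
      - deriv (massRemainder (p ω) (Z ω t) (W ω t)) x * hε4
  · have hκ₃ := Param.κ₃_eq hreg.γ_add_δ_ne
    have hdisp := h.velocity ω t ht x
    rw [serreDispersion] at hdisp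
    rw [hquad.deriv, dt_eq (h.pos ω) ht hmom, hvel]
    unfold velocityResidual
    linear_combination ((p ω).γ + (p ω).δ) * hdisp
      - ((p ω).γ + (p ω).δ) * deriv (velocityRemainder (p ω) (Z ω t) (W ω t)) x * hε4
      - (dt (T ω) (fun τ => opQRemainder (p ω) (Z ω τ) (W ω τ)) t x
        - deriv (opRRemainder (p ω) (Z ω t) (W ω t)) x) * hμε
      - 2 * (p ω).μ * (p ω).ε * deriv (quadraticPoly (W ω t)) x * hκ₃

theorem unifBdd_ε_pow_div (h : UnifSerre p T s Z W) :
    UnifBdd fun ω => (p ω).ε ^ 4 / serrePrecision (p ω) := by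
  refine .div_of_nonneg_of_le (fun ω => by positivity) fun ω => ?_
  have := mul_nonneg (h.μ_nonneg ω) (sq_nonneg (p ω).ε)
  rw [serrePrecision]
  linarith

theorem unifH_massResidual (h : UnifSerre p T s Z W) (hs : 1 / 2 < s) :
    UnifH T s fun ω => massResidual (p ω) (Z ω) (W ω) :=
  ((h.unifH_massRemainder hs).deriv hs).const_mul h.unifBdd_ε_pow_div

theorem unifH_velocityResidual (h : UnifSerre p T s Z W) (hs : 1 / 2 < s) :
    UnifH T s fun ω => velocityResidual (p ω) (T ω) (Z ω) (W ω) := by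
  have hquot : UnifBdd fun ω => (p ω).μ * (p ω).ε ^ 2 / serrePrecision (p ω) := by
    refine .div_of_nonneg_of_le (fun ω => mul_nonneg (h.μ_nonneg ω) (sq_nonneg _)) fun ω => ?_
    rw [serrePrecision]
    have : 0 ≤ (p ω).ε ^ 4 := by positivity
    linarith
  exact ((((h.unifH_velocityRemainder hs).deriv hs).const_mul
      (h.unifBddParam.γ.add h.unifBddParam.δ)).const_mul h.unifBdd_ε_pow_div).add
    (((h.unifC1_opQRemainder hs).unifH_dt.sub ((h.unifH_opRRemainder hs).deriv hs)).const_mul hquot)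

theorem exists_consistent (h : UnifSerre p T s Z W) (hs : 1 / 2 < s) :
    ∃ C > 0, ∀ ω, ∃ r₁ r₂ : ℝ → ℝ → ℝ,
      SolvesGN (p ω) (T ω) (Z ω) (fun t x => ((p ω).γ + (p ω).δ) * W ω t x)
        (fun t x => serrePrecision (p ω) * r₁ t x) (fun t x => serrePrecision (p ω) * r₂ t x) ∧
      MemLinfty (T ω) s r₁ ∧ MemLinfty (T ω) s r₂ ∧
      linftyENorm (T ω) s r₁ + linftyENorm (T ω) s r₂ ≤ ENNReal.ofReal C := by
  have hr₁ := h.unifH_massResidual hs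
  have hr₂ := h.unifH_velocityResidual hs
  obtain ⟨C₁, hC₁, hle₁⟩ := hr₁.exists_linftyENorm_le
  obtain ⟨C₂, hC₂, hle₂⟩ := hr₂.exists_linftyENorm_le
  refine ⟨C₁ + C₂ + 1, by positivity, fun ω => ⟨_, _, h.solvesGN hs ω, hr₁.memLinfty ω,
    hr₂.memLinfty ω, (add_le_add (hle₁ ω) (hle₂ ω)).trans ?_⟩⟩
  rw [← ENNReal.ofReal_add hC₁ hC₂]
  exact ENNReal.ofReal_le_ofReal (by linarith)

end UnifSerre

end Consistency

/-! ### Control of the time derivatives -/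

section TimeDerivatives

variable {Ω : Type*} {p : Ω → Param} {T : Ω → EReal} {s : ℝ} {Z W : Ω → ℝ → ℝ → ℝ}

theorem sobolevENorm_neg_deriv_add_le {σ : ℝ} (hσ : 1 / 2 < σ) {f g : ℝ → ℝ} (c : ℝ)
    (hf : Continuous f) (hg : Continuous g) :
    sobolevENorm σ (fun x => -1 * (deriv f x + c * deriv g x))
      ≤ sobolevENorm (σ + 1) f + ‖c‖ₑ * sobolevENorm (σ + 1) g := by
  refine (sobolevENorm_const_mul_le σ (-1) _).trans ?_
  rw [enorm_neg, enorm_one, one_mul]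
  refine (sobolevENorm_add_le σ _ _).trans (add_le_add (sobolevENorm_deriv_le hσ hf) ?_)
  grw [sobolevENorm_const_mul_le, sobolevENorm_deriv_le hσ hg]

theorem UnifH.exists_sobolevENorm_le {σ : ℝ} (hZ : UnifH T σ Z) : ∃ C : ℝ, 0 ≤ C ∧
    ∀ ω, ∀ t ∈ timeInterval (T ω), sobolevENorm σ (Z ω t) ≤ ENNReal.ofReal C := by
  obtain ⟨C, hC, hle⟩ := hZ.exists_linftyENorm_le
  exact ⟨C, hC, fun ω t ht =>
    (le_iSup₂ (f := fun t _ => sobolevENorm σ (Z ω t)) t ht).trans (hle ω)⟩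

theorem UnifBdd.exists_nonneg {c : Ω → ℝ} (hc : UnifBdd c) : ∃ K : ℝ, 0 ≤ K ∧ ∀ ω, c ω ≤ K := by
  obtain ⟨K, hK⟩ := hc
  exact ⟨|K|, abs_nonneg K, fun ω => (le_abs_self _).trans ((hK ω).trans (le_abs_self K))⟩

/-- The nonlinear part of the mass flux, divided by `ε`. -/
def massNonlinearity (p : Param) (Z W : ℝ → ℝ) : ℝ → ℝ := fun x =>
  p.c₁ * (Z x * W x) + p.ε * p.c₂ * (Z x * (Z x * W x))
    + p.ε ^ 2 * (p.q * p.c₂) * (Z x * (Z x * (Z x * W x)))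

/-- The velocity flux, divided by `ε`. -/
def velocityNonlinearity (p : Param) (Z W : ℝ → ℝ) : ℝ → ℝ := fun x =>
  p.c₁ / 2 * (W x * W x) + p.ε * p.c₂ * (Z x * (W x * W x))
    + p.ε ^ 2 * (3 / 2) * (p.q * p.c₂) * (Z x * (Z x * (W x * W x)))

/-- The nonlinear dispersive terms of the equation for `w`, divided by `-μ ε`. -/
def dispersiveNonlinearity (p : Param) (T : EReal) (Z W : ℝ → ℝ → ℝ) : ℝ → ℝ → ℝ := fun t x =>
  -2 * p.κ₃ * deriv (quadraticPoly (W t)) x + dt T (fun τ => bracketForm p (Z τ) (W τ)) t x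

theorem massPoly_eq (p : Param) (Z W : ℝ → ℝ) :
    massPoly p Z W = fun y => W y + p.ε * massNonlinearity p Z W y := by
  ext y
  rw [massPoly, massNonlinearity]
  ring

theorem velocityPoly_eq (p : Param) (Z W : ℝ → ℝ) :
    velocityPoly p Z W = fun y => p.ε * velocityNonlinearity p Z W y := by
  ext y
  rw [velocityPoly, velocityNonlinearity]
  ring

theorem unifH_massNonlinearity {σ : ℝ} (hp : UnifBddParam p) (hσ : 1 / 2 < σ) (hZ : UnifH T σ Z)
    (hW : UnifH T σ W) : UnifH T σ fun ω t => massNonlinearity (p ω) (Z ω t) (W ω t) :=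
  (((hZ.mul hσ hW).const_mul hp.c₁).add
    ((hZ.mul hσ (hZ.mul hσ hW)).const_mul (hp.ε.mul hp.c₂))).add
    ((hZ.mul hσ (hZ.mul hσ (hZ.mul hσ hW))).const_mul ((hp.ε.pow 2).mul (hp.q.mul hp.c₂)))

theorem unifH_velocityNonlinearity {σ : ℝ} (hp : UnifBddParam p) (hσ : 1 / 2 < σ)
    (hZ : UnifH T σ Z) (hW : UnifH T σ W) :
    UnifH T σ fun ω t => velocityNonlinearity (p ω) (Z ω t) (W ω t) :=
  (((hW.mul hσ hW).const_mul (hp.c₁.div two_pos fun _ => le_rfl)).add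
    ((hZ.mul hσ (hW.mul hσ hW)).const_mul (hp.ε.mul hp.c₂))).add
    ((hZ.mul hσ (hZ.mul hσ (hW.mul hσ hW))).const_mul
      (((hp.ε.pow 2).mul (UnifBdd.const _)).mul (hp.q.mul hp.c₂)))

namespace UnifSerre

variable {ω : Ω} {t : ℝ}

theorem unifH_dispersiveNonlinearity (h : UnifSerre p T s Z W) (hs : 1 / 2 < s) :
    UnifH T s fun ω => dispersiveNonlinearity (p ω) (T ω) (Z ω) (W ω) :=
  (((h.unifH_quadraticPoly hs).deriv hs).const_mul
    ((UnifBdd.const (-2)).mul h.unifBddParam.κ₃)).add (h.unifC1_bracketForm hs).unifH_dt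

theorem dt_fst_eq (h : UnifSerre p T s Z W) (hs : 1 / 2 < s) (ht : t ∈ timeInterval (T ω)) :
    dt (T ω) (Z ω) t = fun x => -1 * (deriv (W ω t) x
      + (p ω).ε * deriv (massNonlinearity (p ω) (Z ω t) (W ω t)) x) := by
  have hN : Differentiable ℝ (massNonlinearity (p ω) (Z ω t) (W ω t)) :=
    (unifH_massNonlinearity h.unifBddParam (by linarith) (h.unifC1_fst.unifH.mono (by linarith))
      (h.unifC1_snd.unifH.mono (by linarith))).differentiable hs ht
  ext x
  have hmass := h.mass ω t ht x
  rw [massPoly_eq, deriv_fun_add ((h.regularState hs ht).differentiable_snd x)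
    ((hN x).const_mul _), deriv_const_mul _ (hN x)] at hmass
  linear_combination hmass

theorem dt_snd_eq (h : UnifSerre p T s Z W) (hs : 1 / 2 < s) (ht : t ∈ timeInterval (T ω)) (x : ℝ) :
    dt (T ω) (W ω) t x - 2 * (p ω).μ * (p ω).ν * deriv (deriv (dt (T ω) (W ω) t)) x
      = -1 * (deriv (Z ω t) x
          + (p ω).ε * deriv (velocityNonlinearity (p ω) (Z ω t) (W ω t)) x)
        + (p ω).μ * ((p ω).ε * dispersiveNonlinearity (p ω) (T ω) (Z ω) (W ω) t x) := by
  have hN : Differentiable ℝ (velocityNonlinearity (p ω) (Z ω t) (W ω t)) :=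
    (unifH_velocityNonlinearity h.unifBddParam (by linarith)
      (h.unifC1_fst.unifH.mono (by linarith)) (h.unifC1_snd.unifH.mono
        (by linarith))).differentiable hs ht
  have hvel := h.velocity ω t ht x
  rw [velocityPoly_eq, deriv_const_mul _ (hN x), serreDispersion] at hvel
  rw [dispersiveNonlinearity]
  linear_combination hvel

theorem exists_dt_fst_le (h : UnifSerre p T s Z W) (hs : 1 / 2 < s) : ∃ L : ℝ, 0 ≤ L ∧
    ∀ ω, ∀ t ∈ timeInterval (T ω), sobolevENorm (s + 2) (dt (T ω) (Z ω) t)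
      ≤ sobolevENorm (s + 3) (W ω t) + ENNReal.ofReal ((p ω).ε * L) := by
  have hN := unifH_massNonlinearity h.unifBddParam (by linarith) h.unifC1_fst.unifH
    h.unifC1_snd.unifH
  obtain ⟨L, hL, hle⟩ := hN.exists_sobolevENorm_le
  refine ⟨L, hL, fun ω t ht => ?_⟩
  rw [h.dt_fst_eq hs ht]
  refine (sobolevENorm_neg_deriv_add_le (by linarith) _ (h.unifC1_snd.unifH.continuous ht)
    (hN.continuous ht)).trans ?_
  rw [show s + 2 + 1 = s + 3 by ring, ENNReal.ofReal_mul (h.ε_nonneg ω),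
    Real.enorm_of_nonneg (h.ε_nonneg ω)]
  gcongr
  exact hle ω t ht

/-- Inverting `1 - 2 μ ν ∂ₓ²` gains two derivatives on terms that carry a factor `μ`, uniformly in
the parameters, because `ν` is bounded below: `6 ν δ (γ + δ) = 1 + γ δ ≥ 1`. -/
theorem exists_μ_mul_le (h : UnifSerre p T s Z W) : ∃ k : ℝ, 0 ≤ k ∧ ∀ ω, ∀ y : ℝ, 0 ≤ y →
    (p ω).μ * (1 + y) ≤ k * (1 + 2 * (p ω).μ * (p ω).ν * y) := by
  obtain ⟨A, hA, hμA⟩ := h.unifBddParam.μ.exists_nonneg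
  obtain ⟨B, hB, hδB⟩ :=
    (h.unifBddParam.δ.mul (h.unifBddParam.δ.add h.unifBddParam.γ)).exists_nonneg
  refine ⟨A + 3 * B, by positivity, fun ω y hy => ?_⟩
  have hμ := h.μ_nonneg ω
  have hδ := h.δ_pos ω
  have hγ := h.γ_nonneg ω
  have hν : 0 ≤ (p ω).ν := by
    unfold Param.ν
    positivity
  have hBν : 1 ≤ 6 * B * (p ω).ν := calc
    1 ≤ 1 + (p ω).γ * (p ω).δ := le_add_of_nonneg_right (by positivity)
    _ = 6 * ((p ω).δ * ((p ω).δ + (p ω).γ)) * (p ω).ν := by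
      unfold Param.ν
      field_simp
    _ ≤ 6 * B * (p ω).ν := by
      gcongr
      exact hδB ω
  calc (p ω).μ * (1 + y) = (p ω).μ + (p ω).μ * y * 1 := by ring
    _ ≤ A + (p ω).μ * y * (6 * B * (p ω).ν) := by
      gcongr
      exact hμA ω
    _ ≤ A + (p ω).μ * y * (6 * B * (p ω).ν) + (3 * B + A * (2 * (p ω).μ * (p ω).ν * y)) :=
      le_add_of_nonneg_right (by positivity)
    _ = (A + 3 * B) * (1 + 2 * (p ω).μ * (p ω).ν * y) := by ring

theorem exists_dt_snd_le (h : UnifSerre p T s Z W) (hs : 1 / 2 < s) : ∃ L : ℝ, 0 ≤ L ∧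
    ∀ ω, ∀ t ∈ timeInterval (T ω), sobolevENorm (s + 2) (dt (T ω) (W ω) t)
      ≤ sobolevENorm (s + 3) (Z ω t) + ENNReal.ofReal ((p ω).ε * L) := by
  have hN := unifH_velocityNonlinearity h.unifBddParam (by linarith) h.unifC1_fst.unifH
    h.unifC1_snd.unifH
  have hB := (h.unifH_dispersiveNonlinearity hs).const_mul h.unifBddParam.ε
  obtain ⟨L₁, hL₁, hle₁⟩ := hN.exists_sobolevENorm_le
  obtain ⟨L₂, hL₂, hle₂⟩ := (h.unifH_dispersiveNonlinearity hs).exists_sobolevENorm_le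
  obtain ⟨k, hk, hμk⟩ := h.exists_μ_mul_le
  refine ⟨L₁ + k * L₂, by positivity, fun ω t ht => ?_⟩
  have hε := h.ε_nonneg ω
  have hμν : 0 ≤ 2 * (p ω).μ * (p ω).ν := by
    have := h.μ_nonneg ω
    have := h.γ_nonneg ω
    have := h.δ_pos ω
    unfold Param.ν
    positivity
  refine (sobolevENorm_le_of_elliptic hs hμν (h.μ_nonneg ω) hk (hμk ω)
    (h.unifC1_snd.unifH_dt.continuous ht) (h.unifC1_snd.unifH_dt.lt_top ht) (hB.continuous ht)
    (hB.lt_top ht) (h.dt_snd_eq hs ht)).trans ?_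
  grw [sobolevENorm_neg_deriv_add_le (by linarith) _ (h.unifC1_fst.unifH.continuous ht)
    (hN.continuous ht), sobolevENorm_const_mul_le, show s + 2 + 1 = s + 3 by ring,
    hle₁ ω t ht, hle₂ ω t ht, Real.enorm_of_nonneg hε, add_assoc, ← ENNReal.ofReal_mul hε,
    ← ENNReal.ofReal_mul hε, ← ENNReal.ofReal_mul hk, ← ENNReal.ofReal_add (by positivity)
      (by positivity)]
  rw [show (p ω).ε * (L₁ + k * L₂) = (p ω).ε * L₁ + k * ((p ω).ε * L₂) by ring]

end UnifSerre

end TimeDerivatives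

/-! ### Functions bounded in time with values in a Sobolev space -/

section BoundedFunctions

variable {T : EReal} {σ t : ℝ} {u v : ℝ → ℝ → ℝ}

theorem sobolevENorm_le_linftyENorm (ht : t ∈ timeInterval T) :
    sobolevENorm σ (u t) ≤ linftyENorm T σ u :=
  le_iSup₂_of_le t ht le_rfl

theorem linftyENorm_congr (h : ∀ t ∈ timeInterval T, u t = v t) :
    linftyENorm T σ u = linftyENorm T σ v :=
  iSup_congr fun t => iSup_congr fun ht => by rw [h t ht]

theorem linftyENorm_add_le :
    linftyENorm T σ (fun t x => u t x + v t x) ≤ linftyENorm T σ u + linftyENorm T σ v :=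
  iSup₂_le fun _ ht => (sobolevENorm_add_le σ _ _).trans
    (add_le_add (sobolevENorm_le_linftyENorm ht) (sobolevENorm_le_linftyENorm ht))

theorem linftyENorm_const_mul_le (c : ℝ) :
    linftyENorm T σ (fun t x => c * u t x) ≤ ‖c‖ₑ * linftyENorm T σ u :=
  iSup₂_le fun _ ht => (sobolevENorm_const_mul_le σ c _).trans
    (mul_le_mul_right (sobolevENorm_le_linftyENorm ht) _)

theorem linftyENorm_neg_le : linftyENorm T σ (fun t x => -u t x) ≤ linftyENorm T σ u := by
  simpa using linftyENorm_const_mul_le (T := T) (σ := σ) (u := u) (-1)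

theorem linftyENorm_le_div_of_le {a c : ℝ} (ha : 0 < a) (hac : a ≤ c)
    (hfin : linftyENorm T σ (fun t x => c * u t x) ≠ ⊤) :
    linftyENorm T σ u
      ≤ ENNReal.ofReal ((linftyENorm T σ fun t x => c * u t x).toReal / a) := by
  have hc : 0 < c := ha.trans_le hac
  calc linftyENorm T σ u = linftyENorm T σ fun t x => c⁻¹ * (c * u t x) := by
        simp only [inv_mul_cancel_left₀ hc.ne']
    _ ≤ ‖c⁻¹‖ₑ * linftyENorm T σ fun t x => c * u t x := linftyENorm_const_mul_le _
    _ = ENNReal.ofReal ((linftyENorm T σ fun t x => c * u t x).toReal / c) := by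
        rw [div_eq_inv_mul, ENNReal.ofReal_mul (by positivity), ENNReal.ofReal_toReal hfin,
          Real.enorm_eq_ofReal (by positivity)]
    _ ≤ _ := by gcongr

namespace MemLinfty

theorem unifH (hu : MemLinfty T σ u) : UnifH (fun _ : Unit => T) σ fun _ => u :=
  ⟨_, hu.2, fun _ t ht => ⟨hu.1 t ht, sobolevENorm_le_linftyENorm ht⟩⟩

theorem congr (hu : MemLinfty T σ u) (h : ∀ t ∈ timeInterval T, v t = u t) : MemLinfty T σ v :=
  ⟨fun t ht => h t ht ▸ hu.1 t ht, linftyENorm_congr h ▸ hu.2⟩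

theorem add (hu : MemLinfty T σ u) (hv : MemLinfty T σ v) :
    MemLinfty T σ fun t x => u t x + v t x :=
  ⟨fun t ht => (hu.1 t ht).add (hv.1 t ht),
    linftyENorm_add_le.trans_lt (ENNReal.add_lt_top.2 ⟨hu.2, hv.2⟩)⟩

theorem neg (hu : MemLinfty T σ u) : MemLinfty T σ fun t x => -u t x :=
  ⟨fun t ht => (hu.1 t ht).neg, linftyENorm_neg_le.trans_lt hu.2⟩

end MemLinfty

theorem dt_add_of_memW1 (hT : 0 < T) (hu : MemW1 T σ u) (hv : MemW1 T σ v)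
    (ht : t ∈ timeInterval T) :
    dt T (fun τ x => u τ x + v τ x) t = fun x => dt T u t x + dt T v t x :=
  funext fun x => dt_eq hT ht
    ((hu.2.1 t ht x).hasDerivWithinAt.fun_add (hv.2.1 t ht x).hasDerivWithinAt)

theorem dt_fun_neg : dt T (fun τ x => -u τ x) = fun t x => -dt T u t x :=
  funext fun _ => dt_neg u

theorem w1ENorm_add_le (hT : 0 < T) (hu : MemW1 T σ u) (hv : MemW1 T σ v) :
    w1ENorm T σ (fun t x => u t x + v t x) ≤ w1ENorm T σ u + w1ENorm T σ v := by
  rw [w1ENorm, linftyENorm_congr fun _ ht => dt_add_of_memW1 hT hu hv ht]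
  exact (add_le_add linftyENorm_add_le linftyENorm_add_le).trans_eq (add_add_add_comm _ _ _ _)

theorem w1ENorm_neg_le : w1ENorm T σ (fun t x => -u t x) ≤ w1ENorm T σ u := by
  rw [w1ENorm, dt_fun_neg]
  exact add_le_add linftyENorm_neg_le linftyENorm_neg_le

namespace MemW1

theorem add (hT : 0 < T) (hu : MemW1 T σ u) (hv : MemW1 T σ v) :
    MemW1 T σ fun t x => u t x + v t x :=
  ⟨hu.1.add hv.1, fun t ht x => (hu.2.1 t ht x).fun_add (hv.2.1 t ht x),
    (hu.2.2.add hv.2.2).congr fun _ ht => dt_add_of_memW1 hT hu hv ht⟩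

theorem neg (hu : MemW1 T σ u) : MemW1 T σ fun t x => -u t x :=
  ⟨hu.1.neg, fun t ht x => (hu.2.1 t ht x).fun_neg, by rw [dt_fun_neg]; exact hu.2.2.neg⟩

theorem sub (hT : 0 < T) (hu : MemW1 T σ u) (hv : MemW1 T σ v) :
    MemW1 T σ fun t x => u t x - v t x := by
  simpa only [sub_eq_add_neg] using hu.add hT hv.neg

end MemW1

theorem w1ENorm_sub_le (hT : 0 < T) (hu : MemW1 T σ u) (hv : MemW1 T σ v) :
    w1ENorm T σ (fun t x => u t x - v t x) ≤ w1ENorm T σ u + w1ENorm T σ v := by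
  simpa only [sub_eq_add_neg] using (w1ENorm_add_le hT hu hv.neg).trans
    (add_le_add_right w1ENorm_neg_le _)

theorem UnifC1.of_memW1 {Ω : Type*} {T : Ω → EReal} {F : Ω → ℝ → ℝ → ℝ} {K : ℝ≥0∞} (hK : K < ⊤)
    (hF : ∀ ω, MemW1 (T ω) σ (F ω)) (hle : ∀ ω, w1ENorm (T ω) σ (F ω) ≤ K) :
    UnifC1 T σ (σ - 1) F where
  unifH := ⟨K, hK, fun ω t ht => ⟨(hF ω).1.1 t ht,
    (sobolevENorm_le_linftyENorm ht).trans (le_self_add.trans (hle ω))⟩⟩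
  unifH_dt := ⟨K, hK, fun ω t ht => ⟨(hF ω).2.2.1 t ht,
    (sobolevENorm_le_linftyENorm ht).trans (le_add_self.trans (hle ω))⟩⟩
  differentiableWithinAt ω := (hF ω).2.1

end BoundedFunctions

/-! ### Solutions of the weakly coupled system in the variables `ζ` and `w` -/

/-- `(ζ, w) = (u_l + u_r, u_l - u_r)` for a solution of the weakly coupled system on `[0, T)` that
is bounded by `K` in `W¹([0,T); H^{s+3})`, both depths being at least `h`. -/
structure IsSerreSolution (s h K : ℝ) (p : Param) (T : EReal) (ζ w : ℝ → ℝ → ℝ) : Prop where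
  pos : 0 < T
  memW1_ζ : MemW1 T (s + 3) ζ
  memW1_w : MemW1 T (s + 3) w
  w1ENorm_ζ_le : w1ENorm T (s + 3) ζ ≤ ENNReal.ofReal K
  w1ENorm_w_le : w1ENorm T (s + 3) w ≤ ENNReal.ofReal K
  le_depth₁ : ∀ t ∈ timeInterval T, ∀ x, h ≤ depth₁ p (ζ t) x
  le_depth₂ : ∀ t ∈ timeInterval T, ∀ x, h ≤ depth₂ p (ζ t) x
  mass : ∀ t ∈ timeInterval T, ∀ x, dt T ζ t x + deriv (massPoly p (ζ t) (w t)) x = 0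
  velocity : ∀ t ∈ timeInterval T, ∀ x,
    dt T w t x + deriv (ζ t) x + deriv (velocityPoly p (ζ t) (w t)) x
      + 2 * serreDispersion p T ζ w t x = 0

/-- A solution of the weakly coupled system with an admissible parameter. The solutions that share
the bounds `μmax`, …, `K` index the families to which the uniform estimates are applied. -/
structure AdmissibleSolution (μmax εmax δmin δmax s h K : ℝ) where
  p : Param
  T : EReal
  ζ : ℝ → ℝ → ℝ
  w : ℝ → ℝ → ℝ
  mem : p ∈ paramSet μmax εmax δmin δmax
  isSerreSolution : IsSerreSolution s h K p T ζ w

section Solutions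

variable {μmax εmax δmin δmax s h K : ℝ}

theorem γ_add_δ_pos_of_mem {p : Param} (hδ : 0 < δmin) (hp : p ∈ paramSet μmax εmax δmin δmax) :
    0 < p.γ + p.δ := by
  linarith [hp.2.2.2.2.1, hp.2.2.2.2.2.2.1]

theorem mul_δ_div_le_one_sub {p : Param} {Z : ℝ → ℝ} {x : ℝ} (hδ : 0 < p.δ) (hγ : 0 ≤ p.γ)
    (h₁ : h ≤ depth₁ p Z x) (h₂ : 0 ≤ depth₂ p Z x) :
    h * p.δ / (p.γ + p.δ) ≤ 1 - p.q * p.ε * Z x := by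
  have hsum := depth₁_add_depth₂_eq hδ.ne' (by positivity) Z x
  have hle : h ≤ (p.γ + p.δ) / p.δ * (1 - p.q * p.ε * Z x) := by
    rw [← hsum]
    linarith [mul_nonneg hγ h₂]
  calc h * p.δ / (p.γ + p.δ)
      ≤ (p.γ + p.δ) / p.δ * (1 - p.q * p.ε * Z x) * p.δ / (p.γ + p.δ) := by gcongr
    _ = 1 - p.q * p.ε * Z x := by field_simp

namespace AdmissibleSolution

theorem unifSerre (hδ : 0 < δmin) (hδ' : 0 < δmax) (hh : 0 < h) :
    UnifSerre (fun D : AdmissibleSolution μmax εmax δmin δmax s h K => D.p) (fun D => D.T) s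
      (fun D => D.ζ) (fun D => D.w) where
  unifBddParam := .of_mem hδ fun D => D.mem
  μ_nonneg D := D.mem.1
  ε_nonneg D := D.mem.2.2.1
  γ_nonneg D := D.mem.2.2.2.2.2.2.1
  δ_pos D := hδ.trans D.mem.2.2.2.2.1
  pos D := D.isSerreSolution.pos
  unifC1_fst := (UnifC1.of_memW1 ENNReal.ofReal_lt_top (fun D => D.isSerreSolution.memW1_ζ)
    fun D => D.isSerreSolution.w1ENorm_ζ_le).mono le_rfl (by linarith)
  unifC1_snd := (UnifC1.of_memW1 ENNReal.ofReal_lt_top (fun D => D.isSerreSolution.memW1_w)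
    fun D => D.isSerreSolution.w1ENorm_w_le).mono le_rfl (by linarith)
  depth₁_pos D t ht x := hh.trans_le (D.isSerreSolution.le_depth₁ t ht x)
  depth₂_pos D t ht x := hh.trans_le (D.isSerreSolution.le_depth₂ t ht x)
  exists_le_one_sub := by
    refine ⟨h * δmin / (1 + δmax), by positivity, fun D t ht x => ?_⟩
    obtain ⟨-, -, -, -, hδD, hδD', hγ, hγ'⟩ := D.mem
    refine le_trans ?_ (mul_δ_div_le_one_sub (hδ.trans hδD) hγ
      (D.isSerreSolution.le_depth₁ t ht x) (hh.le.trans (D.isSerreSolution.le_depth₂ t ht x)))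
    have := γ_add_δ_pos_of_mem hδ D.mem
    have hδpos := hδ.trans hδD
    gcongr
  mass D := D.isSerreSolution.mass
  velocity D := D.isSerreSolution.velocity

end AdmissibleSolution

theorem SerreFamily.isSerreSolution {S : Set Param} {T : EReal} {ul ur : Param → ℝ → ℝ → ℝ}
    (hF : SerreFamily S T s h K ul ur) (hs : 1 / 2 < s) (hT : 0 < T) {p : Param} (hp : p ∈ S)
    (hγδ : p.γ + p.δ ≠ 0) :
    IsSerreSolution s h K p T (fun t x => ul p t x + ur p t x) fun t x => ul p t x - ur p t x := by
  obtain ⟨hl, hr, hK, hsol, hdepth⟩ := hF p hp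
  have hdiff {u : ℝ → ℝ → ℝ} (hu : MemW1 T (s + 3) u) (τ) (hτ : τ ∈ timeInterval T) :
      Differentiable ℝ (u τ) :=
    (hu.1.unifH.mono (by linarith)).differentiable hs hτ (ω := ())
  have hdiff' {u : ℝ → ℝ → ℝ} (hu : MemW1 T (s + 3) u) (τ) (hτ : τ ∈ timeInterval T) :
      Differentiable ℝ (deriv (u τ)) :=
    (UnifH.deriv (σ := s + 1) (by linarith) (hu.1.unifH.mono (by linarith))).differentiable hs hτ
      (ω := ())
  exact {
    pos := hT
    memW1_ζ := hl.add hT hr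
    memW1_w := hl.sub hT hr
    w1ENorm_ζ_le := (w1ENorm_add_le hT hl hr).trans hK
    w1ENorm_w_le := (w1ENorm_sub_le hT hl hr).trans hK
    le_depth₁ := fun t ht x => (hdepth t ht x).1
    le_depth₂ := fun t ht x => (hdepth t ht x).2
    mass := fun t ht x => hsol.sum hγδ hT ht (hl.2.1 t ht x) (hr.2.1 t ht x)
      (hdiff hl) (hdiff hr) (hdiff' hl) (hdiff' hr)
    velocity := fun t ht x => hsol.diff hγδ hT ht (hl.2.1 t ht x) (hr.2.1 t ht x)
      (hdiff hl) (hdiff hr) (hdiff' hl) (hdiff' hr) }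

end Solutions

/-! ### Independence of the depth and `W¹` bounds -/

section SmallAmplitude

variable {μmax εmax δmin δmax s h h' K : ℝ}

theorem UnifSerre.exists_linftyENorm_le {Ω : Type*} {p : Ω → Param} {T : Ω → EReal}
    {Z W : Ω → ℝ → ℝ → ℝ} (h : UnifSerre p T s Z W) : ∃ C : ℝ, ∀ ω,
      MemLinfty (T ω) (s + 3) (Z ω) ∧
      MemLinfty (T ω) (s + 3) (fun t x => ((p ω).γ + (p ω).δ) * W ω t x) ∧
      linftyENorm (T ω) (s + 3) (Z ω)
        + linftyENorm (T ω) (s + 3) (fun t x => ((p ω).γ + (p ω).δ) * W ω t x)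
        ≤ ENNReal.ofReal C := by
  have hZ := h.unifC1_fst.unifH
  have hV := h.unifC1_snd.unifH.const_mul (h.unifBddParam.γ.add h.unifBddParam.δ)
  obtain ⟨C₁, hC₁, hle₁⟩ := hZ.exists_linftyENorm_le
  obtain ⟨C₂, hC₂, hle₂⟩ := hV.exists_linftyENorm_le
  refine ⟨C₁ + C₂, fun ω => ⟨hZ.memLinfty ω, hV.memLinfty ω, ?_⟩⟩
  rw [ENNReal.ofReal_add hC₁ hC₂]
  exact add_le_add (hle₁ ω) (hle₂ ω)

theorem IsSerreSolution.mono {K' : ℝ} {p : Param} {T : EReal} {ζ w : ℝ → ℝ → ℝ} (hK : K ≤ K')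
    (hsol : IsSerreSolution s h K p T ζ w) : IsSerreSolution s h K' p T ζ w :=
  { hsol with
    w1ENorm_ζ_le := hsol.w1ENorm_ζ_le.trans (ENNReal.ofReal_le_ofReal hK)
    w1ENorm_w_le := hsol.w1ENorm_w_le.trans (ENNReal.ofReal_le_ofReal hK) }

theorem exists_monotone_consistent (hδ : 0 < δmin) (hδ' : 0 < δmax) (hs : 1 / 2 < s)
    (hh : 0 < h) : ∃ C : ℝ → ℝ, Monotone C ∧ (∀ K, 0 < C K) ∧
      ∀ {K} (D : AdmissibleSolution μmax εmax δmin δmax s h K), ∃ r₁ r₂ : ℝ → ℝ → ℝ,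
        SolvesGN D.p D.T D.ζ (fun t x => (D.p.γ + D.p.δ) * D.w t x)
          (fun t x => serrePrecision D.p * r₁ t x) (fun t x => serrePrecision D.p * r₂ t x) ∧
        MemLinfty D.T s r₁ ∧ MemLinfty D.T s r₂ ∧
        linftyENorm D.T s r₁ + linftyENorm D.T s r₂ ≤ ENNReal.ofReal (C K) := by
  choose C hC hcons using fun n : ℕ =>
    (AdmissibleSolution.unifSerre (μmax := μmax) (εmax := εmax) (s := s) (K := n) hδ hδ'
      hh).exists_consistent hs
  refine ⟨fun K => ∑ n ∈ Finset.range (⌈K⌉₊ + 1), C n, fun K K' hK => ?_,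
    fun K => Finset.sum_pos (fun n _ => hC n) (by simp), fun {K} D => ?_⟩
  · exact Finset.sum_le_sum_of_subset_of_nonneg (Finset.range_mono (by gcongr))
      fun n _ _ => (hC n).le
  · obtain ⟨r₁, r₂, hsol, hr₁, hr₂, hle⟩ := hcons ⌈K⌉₊
      ⟨D.p, D.T, D.ζ, D.w, D.mem, D.isSerreSolution.mono (Nat.le_ceil K)⟩
    exact ⟨r₁, r₂, hsol, hr₁, hr₂, hle.trans (ENNReal.ofReal_le_ofReal
      (Finset.single_le_sum (fun n _ => (hC n).le) (Finset.self_mem_range_succ _)))⟩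

theorem ε_le_of_serrePrecision_le {p : Param} {r : ℝ} (hμ : 0 ≤ p.μ) (hr : 0 ≤ r)
    (h : serrePrecision p ≤ r ^ 4) : p.ε ≤ r := by
  refine le_of_pow_le_pow_left₀ four_ne_zero hr (le_trans ?_ h)
  exact le_add_of_nonneg_left (by positivity)

namespace AdmissibleSolution

theorem abs_ζ_le (hs : 1 / 2 < s) (D : AdmissibleSolution μmax εmax δmin δmax s h K) {t : ℝ}
    (ht : t ∈ timeInterval D.T) (x : ℝ) :
    |D.ζ t x| ≤ (sobolevEmbeddingConst (s + 3) * ENNReal.ofReal K).toReal := by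
  have hmem := D.isSerreSolution.memW1_ζ.1
  have hle : sobolevENorm (s + 3) (D.ζ t) ≤ ENNReal.ofReal K :=
    (sobolevENorm_le_linftyENorm ht).trans
      (le_self_add.trans D.isSerreSolution.w1ENorm_ζ_le)
  have hpoint : ‖D.ζ t x‖ₑ ≤ sobolevEmbeddingConst (s + 3) * ENNReal.ofReal K :=
    (enorm_le_sobolevENorm (by linarith) (hmem.1 t ht) (hle.trans_lt ENNReal.ofReal_lt_top)
      x).trans (by gcongr)
  rw [← Real.norm_eq_abs, ← toReal_enorm]
  exact ENNReal.toReal_mono (ENNReal.mul_lt_top (sobolevEmbeddingConst_lt_top (by linarith))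
    ENNReal.ofReal_lt_top).ne hpoint

theorem exists_bounds_of_ε_le (hδ : 0 < δmin) (hδ' : 0 < δmax) (hs : 1 / 2 < s) (hh : 0 < h)
    (hh' : 0 < h') (K : ℝ) :
    ∃ r > 0, ∀ D : AdmissibleSolution μmax εmax δmin δmax s h K, D.p.ε ≤ r →
      ∀ t ∈ timeInterval D.T, (∀ x, |D.p.ε * D.ζ t x| ≤ h') ∧
        sobolevENorm (s + 2) (dt D.T D.ζ t) ≤ sobolevENorm (s + 3) (D.w t) + 1 ∧
        sobolevENorm (s + 2) (dt D.T D.w t) ≤ sobolevENorm (s + 3) (D.ζ t) + 1 := by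
  have hunif := unifSerre (μmax := μmax) (εmax := εmax) (s := s) (K := K) hδ hδ' hh
  obtain ⟨L₁, hL₁, hζ⟩ := hunif.exists_dt_fst_le hs
  obtain ⟨L₂, hL₂, hw⟩ := hunif.exists_dt_snd_le hs
  set E : ℝ := (sobolevEmbeddingConst (s + 3) * ENNReal.ofReal K).toReal
  have hE : 0 ≤ E := ENNReal.toReal_nonneg
  refine ⟨min 1 h' / (L₁ + L₂ + E + 1), by positivity, fun D hε t ht => ?_⟩
  have hε₀ : 0 ≤ D.p.ε := D.mem.2.2.1
  have hεsum : D.p.ε * (L₁ + L₂ + E + 1) ≤ min 1 h' := (le_div_iff₀ (by positivity)).1 hε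
  have hεle {X : ℝ} (hX : X ≤ L₁ + L₂ + E + 1) : D.p.ε * X ≤ min 1 h' :=
    (mul_le_mul_of_nonneg_left hX hε₀).trans hεsum
  have hle_one {X : ℝ} (hX : X ≤ L₁ + L₂ + E + 1) : ENNReal.ofReal (D.p.ε * X) ≤ 1 :=
    ENNReal.ofReal_le_one.2 ((hεle hX).trans (min_le_left _ _))
  refine ⟨fun x => ?_, (hζ D t ht).trans ?_, (hw D t ht).trans ?_⟩
  · rw [abs_mul, abs_of_nonneg hε₀]
    calc D.p.ε * |D.ζ t x| ≤ D.p.ε * E := by gcongr; exact D.abs_ζ_le hs ht x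
      _ ≤ h' := (hεle (by linarith)).trans (min_le_right _ _)
  · gcongr
    exact hle_one (by linarith)
  · gcongr
    exact hle_one (by linarith)

end AdmissibleSolution

theorem w1ENorm_le_of_dt_le {T : EReal} {u v : ℝ → ℝ → ℝ} {a b : ℝ} (ha : 0 ≤ a) (hb : 0 ≤ b)
    (hu : linftyENorm T (s + 3) u ≤ ENNReal.ofReal a)
    (hv : linftyENorm T (s + 3) v ≤ ENNReal.ofReal b)
    (hdt : ∀ t ∈ timeInterval T, sobolevENorm (s + 2) (dt T u t) ≤ sobolevENorm (s + 3) (v t) + 1) :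
    w1ENorm T (s + 3) u ≤ ENNReal.ofReal (a + b + 1) := by
  rw [w1ENorm, show s + 3 - 1 = s + 2 by ring, ENNReal.ofReal_add (by positivity) one_pos.le,
    ENNReal.ofReal_add ha hb, ENNReal.ofReal_one, add_assoc]
  exact add_le_add hu (iSup₂_le fun t ht =>
    (hdt t ht).trans (by gcongr; exact (sobolevENorm_le_linftyENorm ht).trans hv))

theorem le_depth_of_abs_le {p : Param} {Z : ℝ → ℝ} {x : ℝ} (h : |p.ε * Z x| ≤ h')
    (h₁ : h' ≤ 1 / 2) (h₂ : h' ≤ 1 / (2 * p.δ)) : h' ≤ depth₁ p Z x ∧ h' ≤ depth₂ p Z x := by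
  obtain ⟨hlow, hup⟩ := abs_le.1 h
  rw [← div_div, div_right_comm] at h₂
  constructor
  · rw [depth₁]
    linarith
  · rw [depth₂]
    linarith

-- For small `ε` the equations control the time derivatives and the embedding `H^{s+3} ⊂ L^∞` keeps
-- the depths close to `1` and `1/δ`, so that neither `h` nor `K` enters the new bounds.
theorem AdmissibleSolution.exists_isSerreSolution_of_serrePrecision_le (hδ : 0 < δmin)
    (hδ' : 0 < δmax) (hs : 1 / 2 < s) (hh : 0 < h) (K : ℝ) :
    ∃ ρ > 0, ∀ D : AdmissibleSolution μmax εmax δmin δmax s h K, serrePrecision D.p ≤ ρ →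
      IsSerreSolution s (min (1 / 2) (1 / (2 * δmax)))
        ((linftyENorm D.T (s + 3) D.ζ).toReal
          + (linftyENorm D.T (s + 3) fun t x => (D.p.γ + D.p.δ) * D.w t x).toReal / δmin + 1)
        D.p D.T D.ζ D.w := by
  obtain ⟨r, hr, hsmall⟩ := exists_bounds_of_ε_le (μmax := μmax) (εmax := εmax) hδ hδ' hs hh
    (h' := min (1 / 2) (1 / (2 * δmax))) (by positivity) K
  obtain ⟨_, hfin⟩ := (unifSerre (μmax := μmax) (εmax := εmax) (s := s) (K := K) hδ hδ'
    hh).exists_linftyENorm_le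
  refine ⟨r ^ 4, by positivity, fun D hD => ?_⟩
  have hbounds := hsmall D (ε_le_of_serrePrecision_le D.mem.1 hr.le hD)
  obtain ⟨-, -, -, -, hδD, hδD', hγ, -⟩ := D.mem
  have hζ := (ENNReal.ofReal_toReal (hfin D).1.2.ne).ge
  have hw := linftyENorm_le_div_of_le hδ (by linarith) (hfin D).2.1.2.ne
  have hδpos := hδ.trans hδD
  have hdepth (t) (ht : t ∈ timeInterval D.T) (x) := le_depth_of_abs_le ((hbounds t ht).1 x)
    (min_le_left _ _) ((min_le_right _ _).trans (by gcongr))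
  exact { D.isSerreSolution with
    w1ENorm_ζ_le := w1ENorm_le_of_dt_le ENNReal.toReal_nonneg (by positivity) hζ hw
      fun t ht => (hbounds t ht).2.1
    w1ENorm_w_le := by
      rw [add_comm (linftyENorm _ _ _).toReal]
      exact w1ENorm_le_of_dt_le (by positivity) ENNReal.toReal_nonneg hw hζ
        fun t ht => (hbounds t ht).2.2
    le_depth₁ := fun t ht x => (hdepth t ht x).1
    le_depth₂ := fun t ht x => (hdepth t ht x).2 }

end SmallAmplitude

end

theorem mainTheorem7 (μmax εmax δmin δmax s : ℝ)
    (hμ : 0 < μmax) (hε : 0 < εmax) (hδ : 0 < δmin) (hδ' : 0 < δmax) (hs : 1 / 2 < s) :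
    -- for all admissible parameters, with a constant depending on `h` and the `W¹` bound `M`
    (∀ h M : ℝ, 0 < h → 0 < M → ∃ C : ℝ, 0 < C ∧
      ∀ (S : Set Param) (T : EReal) (ul ur : Param → ℝ → ℝ → ℝ),
        S ⊆ paramSet μmax εmax δmin δmax → 0 < T → SerreFamily S T s h M ul ur →
        ConsistentGN S T s 3 serrePrecision (serreZeta ul ur) (serreVelocity ul ur)
          (fun _ _ => C)) ∧
    -- for small precision, with a constant depending only on the `L^∞([0,T); H^{s+3})` norms
    (∃ C : ℝ → ℝ → ℝ, (∀ a b a' b' : ℝ, a ≤ a' → b ≤ b' → C a b ≤ C a' b') ∧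
      ∀ h M : ℝ, 0 < h → 0 < M → ∃ ρ : ℝ, 0 < ρ ∧
      ∀ (S : Set Param) (T : EReal) (ul ur : Param → ℝ → ℝ → ℝ),
        S ⊆ paramSet μmax εmax δmin δmax → 0 < T → SerreFamily S T s h M ul ur →
        ConsistentGN {p ∈ S | serrePrecision p ≤ ρ} T s 3 serrePrecision
          (serreZeta ul ur) (serreVelocity ul ur) C) := by
  constructor
  · intro h M hh _
    obtain ⟨C, -, hC, hcons⟩ :=
      exists_monotone_consistent (μmax := μmax) (εmax := εmax) hδ hδ' hs hh
    obtain ⟨K, hK⟩ := (AdmissibleSolution.unifSerre (μmax := μmax) (εmax := εmax) (s := s) (K := M)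
      hδ hδ' hh).exists_linftyENorm_le
    refine ⟨C M, hC M, fun S T ul ur hS hT hF => ?_⟩
    have hsol (p) (hp : p ∈ S) :=
      hF.isSerreSolution hs hT hp (γ_add_δ_pos_of_mem hδ (hS hp)).ne'
    exact ⟨⟨K, fun p hp => hK ⟨p, T, _, _, hS hp, hsol p hp⟩⟩,
      fun p hp => hcons ⟨p, T, _, _, hS hp, hsol p hp⟩⟩
  · obtain ⟨C, hmono, -, hcons⟩ := exists_monotone_consistent (μmax := μmax) (εmax := εmax)
      (h := min (1 / 2) (1 / (2 * δmax))) hδ hδ' hs (by positivity)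
    refine ⟨fun a b => C (a + b / δmin + 1), fun a b a' b' ha hb => hmono (by gcongr),
      fun h M hh _ => ?_⟩
    obtain ⟨K, hK⟩ := (AdmissibleSolution.unifSerre (μmax := μmax) (εmax := εmax) (s := s) (K := M)
      hδ hδ' hh).exists_linftyENorm_le
    obtain ⟨ρ, hρ, hsmall⟩ :=
      AdmissibleSolution.exists_isSerreSolution_of_serrePrecision_le (εmax := εmax) hδ hδ' hs hh M
    refine ⟨ρ, hρ, fun S T ul ur hS hT hF => ?_⟩
    have hsol (p) (hp : p ∈ S) :=
      hF.isSerreSolution hs hT hp (γ_add_δ_pos_of_mem hδ (hS hp)).ne'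
    exact ⟨⟨K, fun p hp => hK ⟨p, T, _, _, hS hp.1, hsol p hp.1⟩⟩, fun p hp => hcons
      ⟨p, T, _, _, hS hp.1, hsmall ⟨p, T, _, _, hS hp.1, hsol p hp.1⟩ hp.2⟩⟩
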